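/- Let $\mathbb A$ be the complexification of one of the four real normed algebras $\mathbb R,\mathbb C,\mathbb H,\mathbb O$, and let $a=\dim_{\mathbb C}\mathbb A\in\{1,2,4,8\}$. Let $\mathbb O$ also denote the complexified octonions and $\mathcal J_3(\mathbb O)$ the complex Jordan algebra of Hermitian $3\times3$ matrices over $\mathbb O$, with traceless part $\mathcal J_3(\mathbb O)_0$. Let $$\mathfrak g(\mathbb A,\mathbb O)=\mathrm{Der}\,\mathbb A\times\mathrm{Der}\,\mathcal J_3(\mathbb O)\ \oplus\ \mathrm{Im}\,\mathbb A\otimes\mathcal J_3(\mathbb O)_0$$ be the complex Lie algebra given by the Tits construction; it is of type $\mathfrak f_4,\mathfrak e_6,\mathfrak e_7,\mathfrak e_8$ for $a=1,2,4,8$, and it contains $\mathfrak f_4=\mathrm{Der}\,\mathcal J_3(\mathbb O)$ as a subalgebra. Let $\mathcal O_1$ be a nilpotent orbit of the adjoint group in $\mathfrak f_4$, and let $\mathcal O_a\subset\mathfrak g(\mathbb A,\mathbb O)$ be the orbit of the adjoint group of $\mathfrak g(\mathbb A,\mathbb O)$ that contains $\mathcal O_1$. 1. There are integers $m,b$, depending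 only on $\mathcal O_1$, such that for each of the four algebras $\mathbb A$ and each $Z\in\mathcal O_a$ the nilpotent radical (the largest nilpotent ideal) $\mathfrak r(a)$ of the stabilizer $\{W\in\mathfrak g(\mathbb A,\mathbb O):[W,Z]=0\}$ has dimension $ma+b$. 2. For every integer $i\neq0$ there are integers $m_i,b_i$, depending only on $\mathcal O_1$ and $i$, such that for each of the four algebras $\mathbb A$, each $X\in\mathcal O_1$ and each $\mathfrak{sl}_2$-triple $(X,Y,H)$ of $\mathfrak f_4$ (that is, $[H,X]=2X$, $[H,Y]=-2Y$, $[X,Y]=H$), the $i$-th part $$\mathfrak g(a,i)=\{W\in\mathfrak g(\mathbb A,\mathbb O):[H,W]=iW\}$$ of the induced grading of $\mathfrak g(\mathbb A,\mathbb O)$ has dimension $m_ia+b_i$. -/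

import Mathlib

namespace MagicSquare

open scoped TensorProduct
set_option linter.unusedSectionVars false
set_option linter.unusedSimpArgs false

/- ## Complexified normed algebras by the Cayley-Dickson process -/

/-- A conjugation on a unital, not necessarily associative, algebra over `ℂ`: a `ℂ`-linear
anti-automorphism `x ↦ conj x` with `x + conj x = 2 re x`. -/
class ConjAlgebra (A : Type) [NonAssocRing A] [Module ℂ A] where
  conj : A →ₗ[ℂ] A
  re : A →ₗ[ℂ] ℂ
  conj_mul_rev : ∀ x y : A, conj (x * y) = conj y * conj x
  add_conj : ∀ x : A, x + conj x = (2 * re x) • (1 : A)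
  re_one : re 1 = 1

open ConjAlgebra


/-- Alternative rings: `x²y = x(xy)` and `xy² = (xy)y`. -/
class IsAlternativeRing (A : Type) [NonAssocRing A] : Prop where
  left_alt : ∀ x y : A, x * x * y = x * (x * y)
  right_alt : ∀ x y : A, x * y * y = x * (y * y)

/-- The Cayley-Dickson double of an algebra with conjugation: pairs `(a, b)` with
`(a, b)(c, d) = (ac - conj d b, da + b conj c)` and `conj (a, b) = (conj a, -b)`. -/
def CayleyDickson (A : Type) : Type := A × A

namespace CayleyDickson
section
variable {A : Type} [NonAssocRing A] [Module ℂ A]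

instance : AddCommGroup (CayleyDickson A) := inferInstanceAs (AddCommGroup (A × A))
instance : Module ℂ (CayleyDickson A) := inferInstanceAs (Module ℂ (A × A))

variable [IsScalarTower ℂ A A] [SMulCommClass ℂ A A] [ConjAlgebra A]

instance : Mul (CayleyDickson A) :=
  ⟨fun x y => (x.1 * y.1 - conj y.2 * x.2, y.2 * x.1 + x.2 * conj y.1)⟩
instance : One (CayleyDickson A) := ⟨((1 : A), (0 : A))⟩

theorem ext' {x y : CayleyDickson A} (h1 : x.1 = y.1) (h2 : x.2 = y.2) : x = y := Prod.ext h1 h2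
@[simp] theorem fst_add (x y : CayleyDickson A) : (x + y).1 = x.1 + y.1 := rfl
@[simp] theorem snd_add (x y : CayleyDickson A) : (x + y).2 = x.2 + y.2 := rfl
@[simp] theorem fst_sub (x y : CayleyDickson A) : (x - y).1 = x.1 - y.1 := rfl
@[simp] theorem snd_sub (x y : CayleyDickson A) : (x - y).2 = x.2 - y.2 := rfl
@[simp] theorem fst_neg (x : CayleyDickson A) : (-x).1 = -x.1 := rfl
@[simp] theorem snd_neg (x : CayleyDickson A) : (-x).2 = -x.2 := rfl
@[simp] theorem fst_zero : (0 : CayleyDickson A).1 = 0 := rfl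
@[simp] theorem snd_zero : (0 : CayleyDickson A).2 = 0 := rfl
@[simp] theorem fst_one : (1 : CayleyDickson A).1 = 1 := rfl
@[simp] theorem snd_one : (1 : CayleyDickson A).2 = 0 := rfl
@[simp] theorem fst_smul (c : ℂ) (x : CayleyDickson A) : (c • x).1 = c • x.1 := rfl
@[simp] theorem snd_smul (c : ℂ) (x : CayleyDickson A) : (c • x).2 = c • x.2 := rfl
@[simp] theorem fst_mul (x y : CayleyDickson A) :
    (x * y).1 = x.1 * y.1 - conj y.2 * x.2 := rfl
@[simp] theorem snd_mul (x y : CayleyDickson A) :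
    (x * y).2 = y.2 * x.1 + x.2 * conj y.1 := rfl

theorem conj_eq (x : A) : conj x = (2 * re x) • (1 : A) - x := by
  rw [← add_conj x]; abel

theorem conj_one : conj (1 : A) = 1 := by
  rw [conj_eq, re_one, mul_one, two_smul]; abel

theorem conj_conj (x : A) : conj (conj x) = x := by
  have h : conj (x + conj x) = conj ((2 * re x) • (1 : A)) := by rw [add_conj]
  rw [map_add, map_smul, conj_one, ← add_conj x, add_comm] at h
  exact add_right_cancel h

instance : NonAssocRing (CayleyDickson A) :=
  { (inferInstance : AddCommGroup (CayleyDickson A)) with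
    mul := (· * ·)
    one := 1
    left_distrib := fun x y z => by
      apply ext' <;> simp [mul_add, add_mul] <;> abel
    right_distrib := fun x y z => by
      apply ext' <;> simp [mul_add, add_mul] <;> abel
    zero_mul := fun x => by apply ext' <;> simp
    mul_zero := fun x => by apply ext' <;> simp
    one_mul := fun x => by apply ext' <;> simp
    mul_one := fun x => by apply ext' <;> simp [conj_one] }

instance : IsScalarTower ℂ (CayleyDickson A) (CayleyDickson A) :=
  ⟨fun c x y => by apply ext' <;> simp [smul_sub, smul_mul_assoc, mul_smul_comm, smul_add]⟩
instance : SMulCommClass ℂ (CayleyDickson A) (CayleyDickson A) :=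
  ⟨fun c x y => by apply ext' <;> simp [smul_sub, smul_mul_assoc, mul_smul_comm, smul_add]⟩

instance : ConjAlgebra (CayleyDickson A) where
  conj :=
    { toFun := fun x => (conj x.1, -x.2)
      map_add' := fun x y => ext' (map_add conj x.1 y.1) (neg_add x.2 y.2)
      map_smul' := fun c x => ext' (map_smul conj c x.1) (smul_neg c x.2).symm }
  re :=
    { toFun := fun x => re x.1
      map_add' := fun x y => map_add re x.1 y.1
      map_smul' := fun c x => map_smul re c x.1 }
  conj_mul_rev := fun x y => by
    apply ext'
    · change conj (x.1 * y.1 - conj y.2 * x.2) = conj y.1 * conj x.1 - conj (-x.2) * (-y.2)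
      simp [conj_mul_rev, conj_conj]
    · change -(y.2 * x.1 + x.2 * conj y.1) = (-x.2) * conj y.1 + (-y.2) * conj (conj x.1)
      simp [conj_conj]
  add_conj := fun x => by
    apply ext'
    · exact add_conj x.1
    · change x.2 + -x.2 = (2 * re x.1) • (0 : A)
      simp
  re_one := re_one (A := A)

@[simp] theorem fst_conj (x : CayleyDickson A) : (conj x).1 = conj x.1 := rfl
@[simp] theorem snd_conj (x : CayleyDickson A) : (conj x).2 = -x.2 := rfl
theorem re_def (x : CayleyDickson A) : re x = re x.1 := rfl

theorem conj_mul_self_eq (b : A) : conj b * b = re (conj b * b) • (1 : A) := by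
  have h := add_conj (conj b * b)
  rw [conj_mul_rev, conj_conj, ← two_smul ℂ, mul_smul] at h
  exact smul_right_injective A (two_ne_zero (α := ℂ)) h

theorem self_mul_conj_eq (b : A) : b * conj b = re (conj b * b) • (1 : A) := by
  rw [← conj_mul_self_eq, conj_eq, mul_sub, sub_mul, mul_smul_comm, smul_mul_assoc, mul_one, one_mul]

/-- The double of an associative algebra is alternative. -/
theorem alternative_of_assoc (assoc : ∀ x y z : A, x * y * z = x * (y * z)) :
    IsAlternativeRing (CayleyDickson A) := by
  have key : ∀ b c : A, conj b * (b * c) = c * (conj b * b) := fun b c => by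
    rw [← assoc, conj_mul_self_eq, smul_mul_assoc, mul_smul_comm, mul_one, one_mul]
  have key' : ∀ b c : A, b * (conj b * c) = c * (conj b * b) := fun b c => by
    rw [← assoc, self_mul_conj_eq, smul_mul_assoc, one_mul]
    conv_rhs => rw [conj_mul_self_eq, mul_smul_comm, mul_one]
  have tr : ∀ a c : A, c * a + c * conj a = a * c + conj a * c := fun a c => by
    rw [← mul_add, ← add_mul, add_conj, smul_mul_assoc, mul_smul_comm, mul_one, one_mul]
  refine ⟨fun x y => ?_, fun x y => ?_⟩
  · apply ext'
    · have h1 := key x.2 y.1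
      have h2 := tr x.1 (conj y.2 * x.2)
      simp only [fst_mul, snd_mul, map_add, map_sub, conj_mul_rev, conj_conj, mul_add, mul_sub,
        add_mul, sub_mul, assoc] at h1 h2 ⊢
      linear_combination (norm := abel) -h1 - h2
    · have h1 := key' x.2 y.2
      have h2 := tr x.1 (conj y.1)
      have h3 := congrArg (fun t => x.2 * t) h2
      simp only [fst_mul, snd_mul, map_add, map_sub, conj_mul_rev, conj_conj, mul_add, mul_sub,
        add_mul, sub_mul, assoc] at h1 h3 ⊢
      linear_combination (norm := abel) h1 - h3
  · apply ext'
    · have h1 := key y.2 x.1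
      have h2 := tr y.1 (conj y.2 * x.2)
      simp only [fst_mul, snd_mul, map_add, map_sub, conj_mul_rev, conj_conj, mul_add, mul_sub,
        add_mul, sub_mul, assoc] at h1 h2 ⊢
      linear_combination (norm := abel) -h1 - h2
    · have h1 := key' y.2 x.2
      have h2 := tr y.1 x.1
      have h3 := congrArg (fun t => y.2 * t) h2
      simp only [fst_mul, snd_mul, map_add, map_sub, conj_mul_rev, conj_conj, mul_add, mul_sub,
        add_mul, sub_mul, assoc] at h1 h3 ⊢
      linear_combination (norm := abel) h3 - h1
end
end CayleyDickson

/-- The ground field, as the complexification of `ℝ`, with trivial conjugation. -/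
noncomputable instance : ConjAlgebra ℂ where
  conj := LinearMap.id
  re := LinearMap.id
  conj_mul_rev := fun x y => mul_comm x y
  add_conj := fun x => by simp [two_mul]
  re_one := rfl

/-- The complexification of the real numbers. -/
abbrev AlgR : Type := ℂ
/-- The complexification of the complex numbers. -/
abbrev AlgC : Type := CayleyDickson AlgR
/-- The complexification of the quaternions. -/
abbrev AlgH : Type := CayleyDickson AlgC
/-- The complexification of the octonions. -/
abbrev AlgO : Type := CayleyDickson AlgH

@[simp] theorem conj_complex (x : ℂ) : (conj x : ℂ) = x := rfl

instance : IsAlternativeRing AlgR := ⟨fun x y => by ring, fun x y => by ring⟩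
instance : IsAlternativeRing AlgC :=
  ⟨fun x y => by apply CayleyDickson.ext' <;> simp <;> ring,
   fun x y => by apply CayleyDickson.ext' <;> simp <;> ring⟩
instance : IsAlternativeRing AlgH :=
  ⟨fun x y => by
    apply CayleyDickson.ext' <;> apply CayleyDickson.ext' <;> simp <;> ring,
   fun x y => by
    apply CayleyDickson.ext' <;> apply CayleyDickson.ext' <;> simp <;> ring⟩
theorem AlgH.mul_assoc (x y z : AlgH) : x * y * z = x * (y * z) := by
  apply CayleyDickson.ext' <;> apply CayleyDickson.ext' <;> simp <;> ring

instance : IsAlternativeRing AlgO := CayleyDickson.alternative_of_assoc AlgH.mul_assoc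

/- ## Identities in alternative algebras -/

section
variable {A : Type} [NonAssocRing A] [IsAlternativeRing A]
theorem alt_left (x y z : A) :
    (x * y) * z - x * (y * z) + ((y * x) * z - y * (x * z)) = 0 := by
  have h := IsAlternativeRing.left_alt (x + y) z
  simp only [add_mul, mul_add, IsAlternativeRing.left_alt] at h
  rw [← sub_eq_zero] at h
  rw [← h]; abel
theorem alt_right (x y z : A) :
    (x * y) * z - x * (y * z) + ((x * z) * y - x * (z * y)) = 0 := by
  have h := IsAlternativeRing.right_alt x (y + z)
  simp only [add_mul, mul_add, IsAlternativeRing.right_alt] at h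
  rw [← sub_eq_zero] at h
  rw [← h]; abel
/-- The map `[L_a, L_b] + [L_a, R_b] + [R_a, R_b]` -/
def innerDerFun (a b x : A) : A :=
  (a * (b * x) - b * (a * x)) + (a * (x * b) - (a * x) * b) + ((x * b) * a - (x * a) * b)
theorem innerDer_leibniz (a b c d : A) :
    innerDerFun a b (c * d) = innerDerFun a b c * d + c * innerDerFun a b d := by
  have h1 := @alt_left A _ _
  have h2 := @alt_right A _ _
  have R : ∀ {x : A}, x = 0 → ∀ w, x * w = 0 := fun h w => by rw [h, zero_mul]
  have L : ∀ {x : A}, x = 0 → ∀ w, w * x = 0 := fun h w => by rw [h, mul_zero]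
  simp only [add_mul, mul_add, sub_mul, mul_sub, innerDerFun] at h1 h2 R L ⊢
  linear_combination (norm := skip)
    -(h1 a (c * d) b) + (h1 d a (b * c)) - (h2 a d (b * c)) + (h2 (c * d) a b) - (L (h1 b c d) a)
    - (h1 (c * b) a d) + (h1 a c (b * d)) - (h2 d a (b * c)) + (h1 (b * c) d a) + (h1 b (a * c) d)
    + (L (h1 a c d) b) - (h1 c b (a * d)) + (h2 c a (d * b)) - (L (h2 c a d) b) - (h1 (c * d) b a)
    - (R (h2 b c d) a) + (R (h1 b d c) a) - (R (h2 d b c) a) + (h2 (a * d) c b) - (h1 c (a * d) b)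
    - (R (h2 c a d) b) + (h2 b (a * d) c) - (h1 b (a * d) c) + (h2 (c * a) d b) + (R (h1 c d b) a)
    + (h1 c b (d * a)) - (h2 c b (d * a))
  simp only [add_mul, mul_add, sub_mul, mul_sub, smul_add, smul_sub]
  abel
theorem innerDer_cyclic (a b c d : A) :
    innerDerFun (a * b - b * a) c d + innerDerFun (b * c - c * b) a d
      + innerDerFun (c * a - a * c) b d = 0 := by
  have h1 := @alt_left A _ _
  have h2 := @alt_right A _ _
  have R : ∀ {x : A}, x = 0 → ∀ w, x * w = 0 := fun h w => by rw [h, zero_mul]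
  have L : ∀ {x : A}, x = 0 → ∀ w, w * x = 0 := fun h w => by rw [h, mul_zero]
  simp only [add_mul, mul_add, sub_mul, mul_sub, innerDerFun] at h1 h2 R L ⊢
  linear_combination (norm := skip)
    (2 : ℤ) • (R (h2 d a b) c) - (2 : ℤ) • (L (h2 b c d) a) - (2 : ℤ) • (R (h1 a b d) c)
    + (h1 c a (b * d)) - (2 : ℤ) • (h2 a (b * d) c) - (3 : ℤ) • (h1 a (d * c) b)
    + (3 : ℤ) • (h2 a b (d * c)) + (2 : ℤ) • (h2 a (c * d) b) + (3 : ℤ) • (R (h2 b a d) c)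
    - (3 : ℤ) • (R (h1 b d a) c) + (h1 d (a * b) c) + (L (h1 a b c) d) - (2 : ℤ) • (h2 (d * a) b c)
    - (2 : ℤ) • (h1 (c * d) a b) + (L (h1 b c d) a) - (h2 (b * c) a d) + (2 : ℤ) • (h1 (c * a) b d)
    - (h2 b (c * a) d) + (h1 b d (c * a)) - (L (h2 b a c) d) - (h2 d (b * c) a)
    - (3 : ℤ) • (L (h2 a b d) c) + (3 : ℤ) • (R (h1 c d a) b) + (h1 (c * b) d a)
    + (2 : ℤ) • (L (h1 a d b) c) + (2 : ℤ) • (h1 c (d * a) b) + (2 : ℤ) • (h1 (c * a) d b)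
    - (2 : ℤ) • (h1 d c (a * b)) - (2 : ℤ) • (h2 (c * a) d b) - (h1 b a (c * d)) + (L (h2 a c d) b)
    - (h1 a b (d * c)) - (h1 b c (a * d)) + (h2 b c (a * d)) + (h2 c d (b * a))
    + (2 : ℤ) • (L (h1 a b d) c) + (h2 a (c * b) d) - (h1 (c * b) a d) - (h1 d a (c * b))
    - (h1 c d (b * a)) + (L (h2 c a b) d) - (h2 c (a * d) b) - (R (h2 c a d) b) + (R (h1 b c a) d)
    + (h1 d (a * c) b) + (L (h1 a c b) d) + (h1 a c (d * b)) - (h2 a c (d * b)) + (h1 a (d * b) c)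
  simp only [add_mul, mul_add, sub_mul, mul_sub, smul_add, smul_sub]
  abel
end

/- ## Derivations and imaginary elements -/

open CayleyDickson

attribute [local instance 100] LieRing.ofAssociativeRing

/-- The Lie algebra `Der B` of derivations of an algebra `B`, with the commutator bracket. -/
def Der (B : Type) [NonUnitalNonAssocRing B] [Module ℂ B] [IsScalarTower ℂ B B]
    [SMulCommClass ℂ B B] : LieSubalgebra ℂ (Module.End ℂ B) where
  carrier := {D | ∀ x y, D (x * y) = D x * y + x * D y}
  add_mem' := fun {D E} hD hE x y => by
    simp only [LinearMap.add_apply, hD x y, hE x y, add_mul, mul_add]; abel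
  zero_mem' := fun x y => by simp
  smul_mem' := fun c D hD x y => by
    simp only [LinearMap.smul_apply, hD x y, smul_add, smul_mul_assoc, mul_smul_comm]
  lie_mem' := fun {D E} hD hE x y => by
    simp only [LieHom.lie_apply, Module.End.lie_apply, hD x y, hE x y, map_add, hD _ _, hE _ _, sub_mul, mul_sub]
    abel

section
variable {A : Type} [NonAssocRing A] [Module ℂ A] [IsScalarTower ℂ A A] [SMulCommClass ℂ A A]
  [ConjAlgebra A] [IsAlternativeRing A]

variable (A) in
/-- The imaginary elements. -/
def Imag : Submodule ℂ A := LinearMap.ker (re : A →ₗ[ℂ] ℂ)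

theorem mem_imag {x : A} : x ∈ Imag A ↔ re x = 0 := Iff.rfl

theorem conj_imag {x : A} (h : re x = 0) : conj x = -x := by
  rw [conj_eq, h]; simp

theorem smul_one_inj {c d : ℂ} (h : c • (1 : A) = d • 1) : c = d := by
  have := congrArg (re : A →ₗ[ℂ] ℂ) h
  simpa [re_one] using this

theorem re_conj (x : A) : re (conj x) = re x := by
  rw [conj_eq]; simp [re_one]; ring

theorem re_mul_comm (x y : A) : re (x * y) = re (y * x) := by
  have h : re (conj x * conj y) = re (x * y) := by
    simp [conj_eq, mul_sub, sub_mul]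
    rw [re_one]; ring
  rw [← h, ← conj_mul_rev, re_conj]

theorem imag_mul_add (x y : A) (hx : re x = 0) (hy : re y = 0) :
    x * y + y * x = (2 * re (x * y)) • (1 : A) := by
  rw [← add_conj, conj_mul_rev, conj_imag hx, conj_imag hy]; simp

theorem re_assoc_imag (x y z : A) (hx : re x = 0) (hy : re y = 0) (hz : re z = 0) :
    re (x * y * z) = re (x * (y * z)) := by
  have e1 := re_conj (x * y * z - x * (y * z))
  simp only [map_sub, conj_mul_rev, conj_imag hx, conj_imag hy, conj_imag hz] at e1
  have a1 := congrArg (re : A →ₗ[ℂ] ℂ) (alt_left x y z)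
  have a2 := congrArg (re : A →ₗ[ℂ] ℂ) (alt_right y x z)
  have a3 := congrArg (re : A →ₗ[ℂ] ℂ) (alt_left y z x)
  simp only [map_sub, map_add, map_zero] at a1 a2 a3
  simp at e1
  linear_combination (-1/2) * e1 + (1/2) * a1 - (1/2) * a2 + (1/2) * a3

theorem re_assoc (x y z : A) : re (x * y * z) = re (x * (y * z)) := by
  have d : ∀ u : A, ∃ v : A, re v = 0 ∧ u = (re u) • 1 + v := fun u =>
    ⟨u - re u • 1, by simp [re_one], by abel⟩
  obtain ⟨x', hx, ex⟩ := d x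
  obtain ⟨y', hy, ey⟩ := d y
  obtain ⟨z', hz, ez⟩ := d z
  have := re_assoc_imag x' y' z' hx hy hz
  rw [ex, ey, ez]
  simp only [add_mul, mul_add, smul_mul_assoc, mul_smul_comm, one_mul, mul_one, map_add,
    map_smul, this]

theorem commutator_mem_imag (x y : A) : x * y - y * x ∈ Imag A := by
  rw [mem_imag, map_sub, re_mul_comm, sub_self]

/-- Formula for inner derivations on imaginary elements. -/
theorem innerDerFun_imag (a b c : A) (ha : re a = 0) (hb : re b = 0) (hc : re c = 0) :
    innerDerFun a b c = (4 * re (b * c)) • a - (4 * re (c * a)) • b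
      - (a * b * c - a * (b * c)) := by
  have hbc := imag_mul_add b c hb hc
  have hca := imag_mul_add c a hc ha
  have e2 : (b * c + c * b) * a = (2 * re (b * c)) • a := by rw [hbc]; simp
  have e2' : a * (b * c + c * b) = (2 * re (b * c)) • a := by rw [hbc]; simp
  have e3 : (c * a + a * c) * b = (2 * re (c * a)) • b := by rw [hca]; simp
  have e3' : b * (c * a + a * c) = (2 * re (c * a)) • b := by rw [hca]; simp
  have q1 : (4 * re (b * c)) • a = (b * c + c * b) * a + a * (b * c + c * b) := by
    rw [e2, e2', ← add_smul]; ring_nf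
  have q2 : (4 * re (c * a)) • b = (c * a + a * c) * b + b * (c * a + a * c) := by
    rw [e3, e3', ← add_smul]; ring_nf
  rw [q1, q2]
  have h1 := alt_left a b c
  have h2 := alt_right b a c
  simp only [innerDerFun, add_mul, mul_add]
  linear_combination (norm := skip) h1 - h2
  abel

theorem innerDerFun_antisymm (a b c : A) : innerDerFun a b c = - innerDerFun b a c := by
  have h1 := alt_left a c b
  have h2 := alt_right c a b
  have h3 := alt_left b c a
  simp only [innerDerFun]
  linear_combination (norm := skip) -h1 + h2 - h3
  abel

theorem der_one (D : Der A) : D.1 1 = 0 := by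
  have h := D.2 1 1
  simpa using h

theorem re_der (D : Der A) (x : A) : re (D.1 x) = 0 := by
  have key : ∀ v : A, re v = 0 → re (D.1 v) = 0 := by
    intro v hv
    by_contra hs
    have h1 : v * v = re (v * v) • (1 : A) := by
      have h := imag_mul_add v v hv hv
      have h2 : (2 : ℂ) • (v * v) = (2 : ℂ) • (re (v * v) • (1 : A)) := by
        rw [two_smul, h, smul_smul]
      exact smul_right_injective A (two_ne_zero (α := ℂ)) h2
    have h2 : D.1 v * v + v * D.1 v = 0 := by
      rw [← D.2 v v, h1, map_smul, der_one, smul_zero]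
    set w := D.1 v - re (D.1 v) • (1 : A) with hw
    have hw0 : re w = 0 := by simp [hw, re_one]
    have e : D.1 v = re (D.1 v) • (1 : A) + w := by rw [hw]; abel
    have h3 := imag_mul_add w v hw0 hv
    have h4 : (2 * re (D.1 v)) • v = (-(2 * re (w * v))) • (1 : A) := by
      rw [neg_smul, ← h3, eq_neg_iff_add_eq_zero, ← h2]
      conv_rhs => rw [e]
      rw [mul_smul, two_smul]
      simp only [add_mul, mul_add, smul_mul_assoc, mul_smul_comm, one_mul, mul_one]
      abel
    have h5 : (2 * re (D.1 v)) * re v = -(2 * re (w * v)) := by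
      have := congrArg (re : A →ₗ[ℂ] ℂ) h4
      simpa [re_one] using this
    rw [hv, mul_zero] at h5
    rw [← h5, zero_smul] at h4
    have h6 : v = 0 := by
      rcases smul_eq_zero.1 h4 with h | h
      · exact absurd h (mul_ne_zero two_ne_zero hs)
      · exact h
    exact hs (by rw [h6]; simp)
  have h := key (x - re x • 1) (by simp [re_one])
  simpa [der_one] using h

/-- The action of derivations on imaginary elements. -/
def derImag : Der A →ₗ[ℂ] Module.End ℂ (Imag A) where
  toFun D := D.1.restrict (p := Imag A) (q := Imag A) (fun x _ => re_der D x)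
  map_add' _ _ := rfl
  map_smul' _ _ := rfl

theorem derImag_apply (D : Der A) (a : Imag A) : ((derImag D a : Imag A) : A) = D.1 a := rfl

/-- The derivation `[L_a, L_b] + [L_a, R_b] + [R_a, R_b]`. -/
def innerDer (a b : A) : Der A :=
  ⟨{ toFun := innerDerFun a b
     map_add' := fun x y => by simp only [innerDerFun, mul_add, add_mul]; abel
     map_smul' := fun c x => by
      simp only [innerDerFun, mul_smul_comm, smul_mul_assoc, smul_add, smul_sub, RingHom.id_apply] },
   fun x y => innerDer_leibniz a b x y⟩

theorem innerDer_apply (a b x : A) : (innerDer a b).1 x = innerDerFun a b x := rfl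

theorem innerDerFun_add_left (a a' b x : A) :
    innerDerFun (a + a') b x = innerDerFun a b x + innerDerFun a' b x := by
  simp only [innerDerFun, mul_add, add_mul]; abel
theorem innerDerFun_smul_left (c : ℂ) (a b x : A) :
    innerDerFun (c • a) b x = c • innerDerFun a b x := by
  simp only [innerDerFun, mul_smul_comm, smul_mul_assoc, smul_add, smul_sub]
theorem innerDerFun_add_right (a b b' x : A) :
    innerDerFun a (b + b') x = innerDerFun a b x + innerDerFun a b' x := by
  simp only [innerDerFun, mul_add, add_mul]; abel
theorem innerDerFun_smul_right (c : ℂ) (a b x : A) :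
    innerDerFun a (c • b) x = c • innerDerFun a b x := by
  simp only [innerDerFun, mul_smul_comm, smul_mul_assoc, smul_add, smul_sub]

theorem der_ext {D E : Der A} (h : ∀ x, D.1 x = E.1 x) : D = E :=
  Subtype.ext (LinearMap.ext h)

variable (A) in
/-- `(a, b) ↦ D_{a,b} = [L_a, L_b] + [L_a, R_b] + [R_a, R_b]` on imaginary elements. -/
def innerDerImag : Imag A →ₗ[ℂ] Imag A →ₗ[ℂ] Der A :=
  LinearMap.mk₂ ℂ (fun a b => innerDer (a : A) (b : A))
    (fun a a' b => der_ext fun x => innerDerFun_add_left (a : A) a' b x)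
    (fun c a b => der_ext fun x => innerDerFun_smul_left c (a : A) b x)
    (fun a b b' => der_ext fun x => innerDerFun_add_right (a : A) b b' x)
    (fun c a b => der_ext fun x => innerDerFun_smul_right c (a : A) b x)

variable (A) in
/-- `(a, b) ↦ ab - ba` on imaginary elements. -/
def commImag : Imag A →ₗ[ℂ] Imag A →ₗ[ℂ] Imag A :=
  LinearMap.mk₂ ℂ (fun a b => ⟨(a : A) * b - b * a, commutator_mem_imag _ _⟩)
    (fun a a' b => Subtype.ext (by
      change ((a : A) + a') * b - b * (a + a') = (a * b - b * a) + (a' * b - b * a')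
      rw [add_mul, mul_add]; abel))
    (fun c a b => Subtype.ext (by
      change (c • (a : A)) * b - b * (c • (a : A)) = c • (a * b - b * a : A)
      rw [smul_mul_assoc, mul_smul_comm, smul_sub]))
    (fun a b b' => Subtype.ext (by
      change (a : A) * (b + b') - (b + b') * a = (a * b - b * a) + (a * b' - b' * a)
      rw [add_mul, mul_add]; abel))
    (fun c a b => Subtype.ext (by
      change (a : A) * (c • (b : A)) - (c • (b : A)) * a = c • (a * b - b * a : A)
      rw [smul_mul_assoc, mul_smul_comm, smul_sub]))

variable (A) in
/-- `(a, b) ↦ re (ab)` on imaginary elements. -/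
def formImag : Imag A →ₗ[ℂ] Imag A →ₗ[ℂ] ℂ :=
  LinearMap.mk₂ ℂ (fun a b => re ((a : A) * b))
    (fun a a' b => by
      change re (((a : A) + a') * b) = re ((a : A) * b) + re ((a' : A) * b)
      rw [add_mul, map_add])
    (fun c a b => by
      change re ((c • (a : A)) * b) = c • re ((a : A) * b)
      rw [smul_mul_assoc, map_smul])
    (fun a b b' => by
      change re ((a : A) * (b + b')) = re ((a : A) * b) + re ((a : A) * b')
      rw [mul_add, map_add])
    (fun c a b => by
      change re ((a : A) * (c • (b : A))) = c • re ((a : A) * b)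
      rw [mul_smul_comm, map_smul])

theorem innerDerImag_apply (a b : Imag A) : innerDerImag A a b = innerDer (a : A) b := rfl
theorem commImag_apply (a b : Imag A) : (commImag A a b : A) = a * b - b * a := rfl
theorem formImag_apply (a b : Imag A) : formImag A a b = re ((a : A) * b) := rfl

theorem innerDerImag_swap (a b : Imag A) : innerDerImag A a b = - innerDerImag A b a :=
  der_ext fun x => innerDerFun_antisymm (a : A) b x
theorem commImag_swap (a b : Imag A) : commImag A a b = - commImag A b a :=
  Subtype.ext (by simp [commImag_apply])
theorem formImag_swap (a b : Imag A) : formImag A a b = formImag A b a := re_mul_comm _ _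

theorem lie_innerDerImag (D : Der A) (a b : Imag A) :
    ⁅D, innerDerImag A a b⁆ = innerDerImag A (derImag D a) b + innerDerImag A a (derImag D b) := by
  refine der_ext fun x => ?_
  change D.1 (innerDerFun _ _ x) - innerDerFun _ _ (D.1 x) =
    innerDerFun (D.1 a) _ x + innerDerFun _ (D.1 b) x
  have hD := D.2
  simp only [innerDerFun, map_sub, map_add, show ∀ x y, D.1 (x * y) = D.1 x * y + x * D.1 y from hD, mul_add, add_mul]
  abel

theorem derImag_commImag (D : Der A) (a b : Imag A) :
    derImag D (commImag A a b) = commImag A (derImag D a) b + commImag A a (derImag D b) := by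
  apply Subtype.ext
  simp only [derImag_apply, commImag_apply, Submodule.coe_add, map_sub, show ∀ x y, D.1 (x * y) = D.1 x * y + x * D.1 y from D.2]
  abel

theorem formImag_derImag (D : Der A) (a b : Imag A) :
    formImag A (derImag D a) b + formImag A a (derImag D b) = 0 := by
  simp only [formImag_apply, derImag_apply, ← map_add]
  rw [← D.2, re_der]

theorem innerDerImag_cyclic (a b c : Imag A) :
    innerDerImag A (commImag A a b) c + innerDerImag A (commImag A b c) a
      + innerDerImag A (commImag A c a) b = 0 :=
  der_ext fun x => innerDer_cyclic (a : A) b c x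

theorem formImag_comm (a b c : Imag A) :
    formImag A (commImag A a b) c = formImag A (commImag A b c) a := by
  simp only [formImag_apply, commImag_apply, sub_mul, map_sub, re_assoc]
  rw [re_mul_comm (a : A), re_assoc, ← re_assoc (b : A) a c, re_mul_comm ((b : A) * a), ← re_assoc (c : A)]

end

/- ## The Jordan algebra of Hermitian matrices -/

section
variable {A : Type} [NonAssocRing A] [Module ℂ A] [IsScalarTower ℂ A A] [SMulCommClass ℂ A A]
  [ConjAlgebra A] [IsAlternativeRing A]

variable (A) in
/-- The Hermitian `3 × 3` matrices with entries in `A`. -/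
def hermitian3 : Submodule ℂ (Matrix (Fin 3) (Fin 3) A) where
  carrier := {M | ∀ i j, M j i = conj (M i j)}
  add_mem' := fun {M N} hM hN i j => by
    rw [Matrix.add_apply, Matrix.add_apply, hM i j, hN i j, map_add]
  zero_mem' := fun i j => by simp
  smul_mem' := fun c M hM i j => by
    rw [Matrix.smul_apply, Matrix.smul_apply, hM i j, map_smul]

variable (A) in
/-- The Jordan algebra `J₃(A)`: Hermitian `3 × 3` matrices with the Jordan product. -/
def Herm3 : Type := hermitian3 A

namespace Herm3

theorem mul_mem (M N : hermitian3 A) :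
    ((1 / 2 : ℂ) • ((M : Matrix (Fin 3) (Fin 3) A) * N + N * M)) ∈ hermitian3 A := by
  refine (hermitian3 A).smul_mem _ fun i j => ?_
  have hM : ∀ i j, M.1 j i = conj (M.1 i j) := M.2
  have hN : ∀ i j, N.1 j i = conj (N.1 i j) := N.2
  simp only [Matrix.add_apply, Matrix.mul_apply, map_add, map_sum, conj_mul_rev, ← hM, ← hN]
  exact add_comm _ _

/-- The Jordan product `(xy + yx) / 2`. -/
noncomputable instance : Mul (Herm3 A) := ⟨fun M N => ⟨(1 / 2 : ℂ) • (M.1 * N.1 + N.1 * M.1), mul_mem M N⟩⟩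

instance : One (Herm3 A) := ⟨⟨1, fun i j => by
  by_cases h : i = j
  · subst h; simp [conj_one]
  · simp [Matrix.one_apply_ne h, Matrix.one_apply_ne (Ne.symm h)]⟩⟩

theorem coe_mul (M N : Herm3 A) :
    (M * N).1 = (1 / 2 : ℂ) • (M.1 * N.1 + N.1 * M.1) := rfl
theorem coe_one : (1 : Herm3 A).1 = 1 := rfl

noncomputable instance : NonAssocCommRing (Herm3 A) :=
  { (inferInstanceAs (AddCommGroup (hermitian3 A)) : AddCommGroup (Herm3 A)) with
    mul := (· * ·)
    one := 1
    mul_comm := fun x y => Subtype.ext (by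
      change (1 / 2 : ℂ) • (x.1 * y.1 + y.1 * x.1) = (1 / 2 : ℂ) • (y.1 * x.1 + x.1 * y.1)
      rw [add_comm])
    left_distrib := fun x y z => Subtype.ext (by
      change (1 / 2 : ℂ) • (x.1 * (y.1 + z.1) + (y.1 + z.1) * x.1) =
        (1 / 2 : ℂ) • (x.1 * y.1 + y.1 * x.1) + (1 / 2 : ℂ) • (x.1 * z.1 + z.1 * x.1)
      rw [← smul_add, mul_add, add_mul]; abel_nf)
    right_distrib := fun x y z => Subtype.ext (by
      change (1 / 2 : ℂ) • ((x.1 + y.1) * z.1 + z.1 * (x.1 + y.1)) =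
        (1 / 2 : ℂ) • (x.1 * z.1 + z.1 * x.1) + (1 / 2 : ℂ) • (y.1 * z.1 + z.1 * y.1)
      rw [← smul_add, mul_add, add_mul]; abel_nf)
    zero_mul := fun x => Subtype.ext (by
      change (1 / 2 : ℂ) • ((0 : Matrix (Fin 3) (Fin 3) A) * x.1 + x.1 * 0) = 0
      simp)
    mul_zero := fun x => Subtype.ext (by
      change (1 / 2 : ℂ) • (x.1 * (0 : Matrix (Fin 3) (Fin 3) A) + 0 * x.1) = 0
      simp)
    one_mul := fun x => Subtype.ext (by
      change (1 / 2 : ℂ) • ((1 : Matrix (Fin 3) (Fin 3) A) * x.1 + x.1 * 1) = x.1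
      rw [one_mul, mul_one, ← two_smul ℂ x.1, smul_smul]; norm_num)
    mul_one := fun x => Subtype.ext (by
      change (1 / 2 : ℂ) • (x.1 * (1 : Matrix (Fin 3) (Fin 3) A) + 1 * x.1) = x.1
      rw [one_mul, mul_one, ← two_smul ℂ x.1, smul_smul]; norm_num) }

noncomputable instance : Module ℂ (Herm3 A) := inferInstanceAs (Module ℂ (hermitian3 A))

@[simp] theorem coe_add (x y : Herm3 A) : (x + y).1 = x.1 + y.1 := rfl
@[simp] theorem coe_sub (x y : Herm3 A) : (x - y).1 = x.1 - y.1 := rfl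
@[simp] theorem coe_smul (c : ℂ) (x : Herm3 A) : (c • x).1 = c • x.1 := rfl

instance : IsScalarTower ℂ (Herm3 A) (Herm3 A) := ⟨fun c x y => Subtype.ext (by
  change (1 / 2 : ℂ) • ((c • x.1) * y.1 + y.1 * (c • x.1)) =
    c • (1 / 2 : ℂ) • (x.1 * y.1 + y.1 * x.1)
  rw [Matrix.smul_mul, Matrix.mul_smul, ← smul_add, smul_comm])⟩
instance : SMulCommClass ℂ (Herm3 A) (Herm3 A) := ⟨fun c x y => Subtype.ext (by
  change c • (1 / 2 : ℂ) • (x.1 * y.1 + y.1 * x.1) =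
    (1 / 2 : ℂ) • (x.1 * (c • y.1) + (c • y.1) * x.1)
  rw [Matrix.smul_mul, Matrix.mul_smul, ← smul_add, smul_comm])⟩

variable (A) in
/-- The trace, the sum of the (scalar) diagonal entries. -/
noncomputable def tr : Herm3 A →ₗ[ℂ] ℂ where
  toFun x := ∑ i, re (x.1 i i)
  map_add' x y := by simp [Finset.sum_add_distrib]
  map_smul' c x := by simp [Finset.mul_sum]

theorem tr_apply (x : Herm3 A) : tr A x = ∑ i, re (x.1 i i) := rfl

theorem tr_one : tr A 1 = 3 := by
  simp [tr_apply, coe_one, re_one]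

theorem tr_mul (x y : Herm3 A) : tr A (x * y) = ∑ i, ∑ j, re (x.1 i j * y.1 j i) := by
  simp only [tr_apply, coe_mul, Matrix.smul_apply, Matrix.add_apply, Matrix.mul_apply, map_smul,
    map_add, map_sum]
  have : ∑ i, ∑ j, re (y.1 i j * x.1 j i) = ∑ i, ∑ j, re (x.1 i j * y.1 j i) := by
    rw [Finset.sum_comm]
    simp only [re_mul_comm (y.1 _ _)]
  rw [← Finset.smul_sum, Finset.sum_add_distrib, this, smul_eq_mul]; ring

theorem tr_mul_assoc (x y z : Herm3 A) : tr A (x * y * z) = tr A (x * (y * z)) := by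
  rw [tr_mul, tr_mul]
  simp only [coe_mul, Matrix.smul_apply, Matrix.add_apply, Matrix.mul_apply, smul_mul_assoc,
    mul_smul_comm, map_smul, add_mul, mul_add, Finset.sum_mul, Finset.mul_sum, map_add, map_sum,
    re_assoc, Fin.sum_univ_three]
  have h : ∀ i j k, re (y.1 i j * (x.1 j k * z.1 k i)) = re (x.1 j k * (z.1 k i * y.1 i j)) := by
    intro i j k
    rw [re_mul_comm, re_assoc]
  simp only [h]
  ring

end Herm3
end

/- ## The characteristic equation and the Jordan identity -/

section
variable {A : Type} [NonAssocRing A] [Module ℂ A] [IsScalarTower ℂ A A] [SMulCommClass ℂ A A]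
  [ConjAlgebra A] [IsAlternativeRing A]

/-- The quadratic norm `a ↦ re (a conj a)`. -/
def nrm (a : A) : ℂ := re (a * conj a)

theorem mul_conj_self (a : A) : a * conj a = nrm a • (1 : A) := by
  have h : conj (a * conj a) = a * conj a := by rw [conj_mul_rev, conj_conj]
  have h2 := add_conj (a * conj a)
  rw [h, ← two_smul ℂ, mul_smul] at h2
  exact smul_right_injective A (two_ne_zero (α := ℂ)) h2

theorem conj_mul_self (a : A) : conj a * a = nrm a • (1 : A) := by
  rw [← mul_conj_self, conj_eq, mul_sub, sub_mul]; simp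

theorem conj_mul_mul (a x : A) : conj a * (a * x) = nrm a • x := by
  have h := conj_mul_self a
  rw [conj_eq, sub_mul] at h ⊢
  rw [← IsAlternativeRing.left_alt, smul_mul_assoc, one_mul, ← smul_mul_assoc, ← sub_mul]
  rw [smul_mul_assoc, one_mul] at h
  rw [h, smul_mul_assoc, one_mul]

theorem mul_conj_mul (a x : A) : a * (conj a * x) = nrm a • x := by
  have h := mul_conj_self a
  rw [conj_eq, mul_sub] at h
  rw [conj_eq, sub_mul, mul_sub]
  rw [← IsAlternativeRing.left_alt, smul_mul_assoc, one_mul, mul_smul_comm, ← smul_mul_assoc,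
    ← sub_mul]
  rw [mul_smul_comm, mul_one] at h
  rw [h, smul_mul_assoc, one_mul]

theorem mul_mul_conj (a x : A) : x * a * conj a = nrm a • x := by
  have h := mul_conj_self a
  rw [conj_eq, mul_sub] at h ⊢
  rw [IsAlternativeRing.right_alt, mul_smul_comm, mul_one, ← mul_smul_comm, ← mul_sub]
  rw [mul_smul_comm, mul_one] at h
  rw [h, mul_smul_comm, mul_one]

theorem mul_conj_mul' (a x : A) : x * conj a * a = nrm a • x := by
  have h := conj_mul_self a
  rw [conj_eq, sub_mul] at h
  rw [conj_eq, mul_sub, sub_mul]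
  rw [IsAlternativeRing.right_alt, mul_smul_comm, mul_one, smul_mul_assoc, ← mul_smul_comm,
    ← mul_sub]
  rw [smul_mul_assoc, one_mul] at h
  rw [h, mul_smul_comm, mul_one]

theorem self_conj_smul {a : A} (h : a = conj a) : a = re a • (1 : A) := by
  have h2 := add_conj a
  rw [← h, ← two_smul ℂ, mul_smul] at h2
  exact smul_right_injective A (two_ne_zero (α := ℂ)) h2

theorem nrm_conj (a : A) : nrm (conj a) = nrm a := by
  apply smul_one_inj (A := A)
  rw [← mul_conj_self, conj_conj, conj_mul_self]

namespace Herm3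

theorem exists_entries (x : Herm3 A) : ∃ (p q r : ℂ) (a b c : A),
    x.1 = !![p • 1, c, conj b; conj c, q • 1, a; b, conj a, r • 1] := by
  have hx : ∀ i j, x.1 j i = conj (x.1 i j) := x.2
  refine ⟨re (x.1 0 0), re (x.1 1 1), re (x.1 2 2), x.1 1 2, x.1 2 0, x.1 0 1, ?_⟩
  ext i j
  fin_cases i <;> fin_cases j <;> simp <;> first | exact self_conj_smul (hx _ _) | exact hx _ _

theorem sq_entries {x : Herm3 A} {p q r : ℂ} {a b c : A}
    (h : x.1 = !![p • 1, c, conj b; conj c, q • 1, a; b, conj a, r • 1]) :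
    (x * x).1 = !![(p ^ 2 + nrm b + nrm c) • 1, (p + q) • c + conj b * conj a,
        (p + r) • conj b + c * a;
      (p + q) • conj c + a * b, (q ^ 2 + nrm a + nrm c) • 1, (q + r) • a + conj c * conj b;
      (p + r) • b + conj a * conj c, (q + r) • conj a + b * c, (r ^ 2 + nrm a + nrm b) • 1] := by
  rw [coe_mul, ← two_smul ℂ, smul_smul, one_div, inv_mul_cancel₀ two_ne_zero, one_smul, h]
  ext i j
  fin_cases i <;> fin_cases j <;>
    simp [Matrix.mul_apply, Fin.sum_univ_three, mul_conj_self, conj_mul_self] <;> module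

theorem cube_entries {x : Herm3 A} {p q r : ℂ} {a b c : A}
    (h : x.1 = !![p • 1, c, conj b; conj c, q • 1, a; b, conj a, r • 1]) :
    (x * x * x).1 = (p + q + r) • (x * x).1
      - (p * q + q * r + r * p - nrm a - nrm b - nrm c) • x.1
      + (p * q * r - p * nrm a - q * nrm b - r * nrm c + 2 * re (a * (b * c))) • 1 := by
  have e1 : re (a * b * c) = re (a * (b * c)) := re_assoc a b c
  have k1 := add_conj (c * (a * b))
  have k2 := add_conj (c * a * b)
  have k3 := add_conj (a * (b * c))
  have k4 := add_conj (a * b * c)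
  have k5 := add_conj (b * (c * a))
  have k6 := add_conj (b * c * a)
  have r1 : re (c * (a * b)) = re (a * (b * c)) := by rw [re_mul_comm, re_assoc]
  have r2 : re (b * c * a) = re (a * (b * c)) := by rw [re_mul_comm]
  have r3 : re (b * (c * a)) = re (a * (b * c)) := by rw [← re_assoc, r2]
  rw [re_assoc, r1] at k2
  rw [r1] at k1
  rw [e1] at k4
  rw [r2] at k6
  rw [r3] at k5
  simp only [conj_mul_rev] at k1 k2 k3 k4 k5 k6
  rw [coe_mul, sq_entries h, h]
  ext i j
  fin_cases i <;> fin_cases j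
  all_goals
    simp [Matrix.mul_apply, Fin.sum_univ_three, mul_add, add_mul, mul_conj_self, conj_mul_self,
      conj_mul_mul, mul_conj_mul, mul_mul_conj, mul_conj_mul']
    try simp only [smul_mul_assoc, mul_smul_comm, mul_conj_self, conj_mul_self]
  · linear_combination (norm := module) (1 / 2 : ℂ) • k1 + (1 / 2 : ℂ) • k2
  · module
  · module
  · module
  · linear_combination (norm := module) (1 / 2 : ℂ) • k3 + (1 / 2 : ℂ) • k4
  · module
  · module
  · module
  · linear_combination (norm := module) (1 / 2 : ℂ) • k5 + (1 / 2 : ℂ) • k6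

theorem cayley_hamilton (x : Herm3 A) :
    x * x * x = tr A x • (x * x) - ((tr A x ^ 2 - tr A (x * x)) / 2) • x
      + (tr A x ^ 3 / 6 - tr A x * tr A (x * x) / 2 + tr A (x * x * x) / 3) • 1 := by
  obtain ⟨p, q, r, a, b, c, h⟩ := exists_entries x
  have hs := sq_entries h
  have hc := cube_entries h
  have t1 : tr A x = p + q + r := by
    simp [tr_apply, h, Fin.sum_univ_three, re_one]
  have t2 : tr A (x * x) = p ^ 2 + q ^ 2 + r ^ 2 + 2 * (nrm a + nrm b + nrm c) := by
    simp [tr_apply, hs, Fin.sum_univ_three, re_one]; ring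
  have hc' : x * x * x = (p + q + r) • (x * x)
      - (p * q + q * r + r * p - nrm a - nrm b - nrm c) • x
      + (p * q * r - p * nrm a - q * nrm b - r * nrm c + 2 * re (a * (b * c))) • 1 :=
    Subtype.ext hc
  have t3 := congrArg (tr A) hc'
  simp only [map_add, map_sub, map_smul, tr_one, t1, t2, smul_eq_mul] at t3
  rw [t3, hc', t1, t2]
  module

theorem cayley_hamilton_polar (x y z : Herm3 A) :
    (2 : ℂ) • (x * y * z + y * z * x + z * x * y)
      - (2 : ℂ) • (tr A x • (y * z) + tr A y • (z * x) + tr A z • (x * y))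
      + ((tr A x * tr A y - tr A (x * y)) • z + (tr A y * tr A z - tr A (y * z)) • x
        + (tr A z * tr A x - tr A (z * x)) • y)
      - (tr A x * tr A y * tr A z - tr A x * tr A (y * z) - tr A y * tr A (z * x)
        - tr A z * tr A (x * y) + 2 * tr A (x * y * z)) • (1 : Herm3 A) = 0 := by
  have h1 := cayley_hamilton (x + y + z)
  have h2 := cayley_hamilton (x + y)
  have h3 := cayley_hamilton (y + z)
  have h4 := cayley_hamilton (z + x)
  have h5 := cayley_hamilton x
  have h6 := cayley_hamilton y
  have h7 := cayley_hamilton z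
  have s1 : tr A (y * z * x) = tr A (x * y * z) := by rw [mul_comm, tr_mul_assoc]
  have s2 : tr A (z * x * y) = tr A (x * y * z) := by rw [tr_mul_assoc, mul_comm]
  have c1 := mul_comm y x
  have c2 := mul_comm z y
  have c3 := mul_comm x z
  simp only [add_mul, mul_add, map_add, c1, c2, c3, s1, s2] at h1 h2 h3 h4 h5 h6 h7 ⊢
  linear_combination (norm := module) h1 - h2 - h3 - h4 + h5 + h6 + h7

instance : IsCommJordan (Herm3 A) where
  lmul_comm_rmul_rmul x y := by
    have e1 := cayley_hamilton_polar x x y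
    have e2 := cayley_hamilton_polar x x (x * y)
    have e3 := congrArg (fun w => x * w) e1
    have h := cayley_hamilton x
    have s3 := congrArg (fun w => tr A (w * y)) h
    have c1 := mul_comm y x
    have c2 := mul_comm (x * y) x
    have c3 := mul_comm (x * (x * y)) x
    have c5 := mul_comm (x * x) x
    have c6 := mul_comm (x * x) y
    have c7 := mul_comm (x * x) (x * y)
    have s1 : tr A (x * (x * y)) = tr A (y * (x * x)) := by rw [← tr_mul_assoc, mul_comm]
    have s2 : tr A (x * (x * x) * y) = tr A (x * y * (x * x)) := by
      rw [← c5, tr_mul_assoc, mul_comm]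
    simp only [add_mul, mul_add, sub_mul, mul_sub, smul_mul_assoc, mul_smul_comm, one_mul, mul_one,
      mul_zero, map_add, map_sub, map_smul, smul_eq_mul, c1, c2, c3, c5, c6, c7, s1, s2]
      at e1 e2 e3 h s3
    rw [s3] at e2
    linear_combination (norm := module) (1 / 2 : ℂ) • e2 - (1 / 2 : ℂ) • e3 - tr A y • h

end Herm3
end

/- ## Derivations of the Jordan algebra and traceless elements -/

section
variable {A : Type} [NonAssocRing A] [Module ℂ A] [IsScalarTower ℂ A A] [SMulCommClass ℂ A A]
  [ConjAlgebra A] [IsAlternativeRing A]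

namespace Herm3

/-- The diagonal idempotents. -/
def idem (i : Fin 3) : Herm3 A := ⟨Matrix.diagonal (Pi.single i 1), fun j k => by
  by_cases h : j = k
  · subst h
    rw [Matrix.diagonal_apply_eq]
    by_cases h : j = i
    · subst h; simp [conj_one]
    · simp [Pi.single_eq_of_ne h]
  · rw [Matrix.diagonal_apply_ne _ h, Matrix.diagonal_apply_ne _ (Ne.symm h), map_zero]⟩

theorem idem_sum : idem 0 + idem 1 + idem 2 = (1 : Herm3 A) := by
  apply Subtype.ext
  change Matrix.diagonal _ + Matrix.diagonal _ + Matrix.diagonal _ = (1 : Matrix (Fin 3) (Fin 3) A)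
  ext i j
  fin_cases i <;> fin_cases j <;> simp

theorem idem_idem_mul (i : Fin 3) (x : Herm3 A) :
    idem i * (idem i * x) = (1 / 2 : ℂ) • (idem i * x) + (1 / 2 * re (x.1 i i)) • idem i := by
  have hx : x.1 i i = re (x.1 i i) • (1 : A) := self_conj_smul (x.2 i i)
  apply Subtype.ext
  change (1 / 2 : ℂ) • (Matrix.diagonal _ * ((1 / 2 : ℂ) • (Matrix.diagonal _ * x.1 + x.1 * Matrix.diagonal _))
    + ((1 / 2 : ℂ) • (Matrix.diagonal _ * x.1 + x.1 * Matrix.diagonal _)) * Matrix.diagonal _) =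
    (1 / 2 : ℂ) • ((1 / 2 : ℂ) • (Matrix.diagonal _ * x.1 + x.1 * Matrix.diagonal _)) +
      (1 / 2 * re (x.1 i i)) • Matrix.diagonal _
  rw [mul_smul, smul_comm (1 / 2 : ℂ)]
  ext j k
  simp only [Matrix.smul_apply, Matrix.add_apply, Matrix.diagonal_mul, Matrix.mul_diagonal]
  by_cases hj : j = i <;> by_cases hk : k = i
  · subst hj; subst hk
    simp only [Pi.single_eq_same, Matrix.diagonal_apply_eq, one_mul, mul_one, ← hx]
    module
  · subst hj
    simp only [Pi.single_eq_same, Pi.single_eq_of_ne hk, Matrix.diagonal_apply_ne _ (Ne.symm hk),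
      one_mul, mul_zero, smul_zero, add_zero]
  · subst hk
    simp only [Pi.single_eq_same, Pi.single_eq_of_ne hj, Matrix.diagonal_apply_ne _ hj,
      zero_mul, mul_one, smul_zero, zero_add, add_zero]
  · by_cases h : j = k
    · subst h
      simp [Pi.single_eq_of_ne hj]
    · simp [Pi.single_eq_of_ne hj, Pi.single_eq_of_ne hk, Matrix.diagonal_apply_ne _ h]

theorem idem_idem (i : Fin 3) : idem i * idem i = (idem i : Herm3 A) := by
  have h := idem_idem_mul (A := A) i 1
  simp only [mul_one, coe_one, Matrix.one_apply_eq, re_one] at h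
  rw [h]; module

theorem der_mul (E : Der (Herm3 A)) (x y : Herm3 A) : E.1 (x * y) = E.1 x * y + x * E.1 y :=
  E.2 x y

theorem tr_der_assoc (E : Der (Herm3 A)) (x y z : Herm3 A) :
    tr A (E.1 (x * y * z)) = tr A (E.1 (x * (y * z))) := by
  simp only [der_mul, add_mul, mul_add, map_add, tr_mul_assoc]
  ring

theorem tr_der_idem (E : Der (Herm3 A)) (i : Fin 3) : tr A (E.1 (idem i)) = 0 := by
  have h := der_mul E (idem i) (idem i)
  rw [idem_idem, mul_comm (E.1 _)] at h
  have h1 : tr A (E.1 (idem i)) = 2 * tr A (idem i * E.1 (idem i)) := by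
    conv_lhs => rw [h]
    rw [map_add]; ring
  have h2 : tr A (idem i * E.1 (idem i)) = 2 * tr A (idem i * E.1 (idem i)) := by
    conv_lhs => rw [h]
    rw [mul_add, map_add, ← tr_mul_assoc, idem_idem]; ring
  have h3 : tr A (idem i * E.1 (idem i)) = 0 := by linear_combination -h2
  rw [h1, h3, mul_zero]

theorem tr_der_idem_mul (E : Der (Herm3 A)) (i : Fin 3) (x : Herm3 A) :
    tr A (E.1 (idem i * x)) = 0 := by
  have h := tr_der_assoc E (idem i) (idem i) x
  rw [idem_idem, idem_idem_mul, map_add, map_smul, map_smul, map_add, map_smul, map_smul,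
    tr_der_idem, smul_zero, add_zero, smul_eq_mul] at h
  linear_combination 2 * h

theorem tr_der (E : Der (Herm3 A)) (x : Herm3 A) : tr A (E.1 x) = 0 := by
  rw [← one_mul x, ← idem_sum, add_mul, add_mul, map_add, map_add, map_add, map_add,
    tr_der_idem_mul, tr_der_idem_mul, tr_der_idem_mul]; simp

theorem jordan_linear (a b c d : Herm3 A) :
    a * (b * c * d) - b * c * (a * d) + (b * (c * a * d) - c * a * (b * d))
      + (c * (a * b * d) - a * b * (c * d)) = 0 := by
  have h := two_nsmul_lie_lmul_lmul_add_add_eq_zero a b c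
  have h2 := congrArg (fun f : AddMonoid.End (Herm3 A) => f d) h
  have h3 : (2 : ℂ) • (a * (b * c * d) - b * c * (a * d) + (b * (c * a * d) - c * a * (b * d))
      + (c * (a * b * d) - a * b * (c * d))) = 0 := by
    rw [two_smul]; rw [two_nsmul] at h2; exact h2
  exact (smul_eq_zero.1 h3).resolve_left two_ne_zero

/-- The derivation `[L_x, L_y]`. -/
noncomputable def jordanDer (x y : Herm3 A) : Der (Herm3 A) :=
  ⟨{ toFun := fun z => x * (y * z) - y * (x * z)
     map_add' := fun z w => by simp only [mul_add]; abel
     map_smul' := fun c z => by simp only [mul_smul_comm, smul_sub, RingHom.id_apply] },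
   fun z w => by
    change x * (y * (z * w)) - y * (x * (z * w)) =
      (x * (y * z) - y * (x * z)) * w + z * (x * (y * w) - y * (x * w))
    have h1 := jordan_linear x z w y
    have h2 := jordan_linear y z w x
    simp only [mul_sub, sub_mul]
    have c := fun u v : Herm3 A => mul_comm u v
    rw [c (x * (y * z)), c (y * (x * z))]
    rw [c (z * w) y, c w x, c (x * w) y, c (x * z) y, c (z * w) (x * y), c (x * w) (z * y), c (x * z) (w * y), c z y, c w y] at h1
    rw [c (z * w) x, c w y, c (y * w) x, c (y * z) x, c (z * w) (y * x), c (y * w) (z * x), c (y * z) (w * x), c z x, c w x, c y x] at h2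
    linear_combination (norm := skip) h1 - h2
    rw [c (x * w) (y * z), c (y * w) (x * z)]
    abel⟩

variable (A) in
/-- The subspace `J₃(A)₀` of traceless elements. -/
noncomputable def Traceless : Submodule ℂ (Herm3 A) := LinearMap.ker (tr A)

theorem mem_traceless {x : Herm3 A} : x ∈ Traceless A ↔ tr A x = 0 := Iff.rfl

/-- The action of derivations on traceless elements. -/
noncomputable def derTraceless : Der (Herm3 A) →ₗ[ℂ] Module.End ℂ (Traceless A) where
  toFun E := E.1.restrict (p := Traceless A) (q := Traceless A) (fun x _ => tr_der E x)
  map_add' _ _ := rfl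
  map_smul' _ _ := rfl

theorem derTraceless_apply (E : Der (Herm3 A)) (x : Traceless A) :
    ((derTraceless E x : Traceless A) : Herm3 A) = E.1 x := rfl

theorem der_ext {D E : Der (Herm3 A)} (h : ∀ x, D.1 x = E.1 x) : D = E :=
  Subtype.ext (LinearMap.ext h)

variable (A) in
/-- `[L_x, L_y]` as bilinear map. -/
noncomputable def jordanDerTraceless : Traceless A →ₗ[ℂ] Traceless A →ₗ[ℂ] Der (Herm3 A) :=
  LinearMap.mk₂ ℂ (fun x y => jordanDer (x : Herm3 A) (y : Herm3 A))
    (fun x x' y => der_ext fun z => by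
      change ((x : Herm3 A) + x') * (y * z) - y * (((x : Herm3 A) + x') * z) =
        (x * (y * z) - y * (x * z) : Herm3 A) + (x' * (y * z) - y * (x' * z))
      simp only [add_mul, mul_add]; abel)
    (fun c x y => der_ext fun z => by
      change (c • (x : Herm3 A)) * (y * z) - y * ((c • (x : Herm3 A)) * z) =
        c • (x * (y * z) - y * (x * z) : Herm3 A)
      simp only [smul_mul_assoc, mul_smul_comm, smul_sub])
    (fun x y y' => der_ext fun z => by
      change (x : Herm3 A) * ((y + y' : Herm3 A) * z) - (y + y' : Herm3 A) * (x * z) =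
        (x * (y * z) - y * (x * z) : Herm3 A) + (x * (y' * z) - y' * (x * z))
      simp only [add_mul, mul_add]; abel)
    (fun c x y => der_ext fun z => by
      change (x : Herm3 A) * ((c • (y : Herm3 A)) * z) - (c • (y : Herm3 A)) * (x * z) =
        c • (x * (y * z) - y * (x * z) : Herm3 A)
      simp only [smul_mul_assoc, mul_smul_comm, smul_sub])

variable (A) in
/-- The normalised trace form `(x, y) ↦ tr (x ∘ y) / 3`. -/
noncomputable def formTraceless : Traceless A →ₗ[ℂ] Traceless A →ₗ[ℂ] ℂ :=
  LinearMap.mk₂ ℂ (fun x y => tr A ((x : Herm3 A) * y) / 3)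
    (fun x x' y => by
      change tr A (((x : Herm3 A) + x') * y) / 3 = tr A ((x : Herm3 A) * y) / 3 + tr A ((x' : Herm3 A) * y) / 3
      rw [add_mul, map_add, add_div])
    (fun c x y => by
      change tr A ((c • (x : Herm3 A)) * y) / 3 = c • (tr A ((x : Herm3 A) * y) / 3)
      rw [smul_mul_assoc, map_smul, smul_eq_mul, smul_eq_mul, mul_div_assoc])
    (fun x y y' => by
      change tr A ((x : Herm3 A) * (y + y')) / 3 = tr A ((x : Herm3 A) * y) / 3 + tr A ((x : Herm3 A) * y') / 3
      rw [mul_add, map_add, add_div])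
    (fun c x y => by
      change tr A ((x : Herm3 A) * (c • (y : Herm3 A))) / 3 = c • (tr A ((x : Herm3 A) * y) / 3)
      rw [mul_smul_comm, map_smul, smul_eq_mul, smul_eq_mul, mul_div_assoc])

theorem starMul_mem (x y : Herm3 A) : x * y - (tr A (x * y) / 3) • 1 ∈ Traceless A := by
  rw [mem_traceless, map_sub, map_smul, tr_one]
  simp

variable (A) in
/-- `x * y = x ∘ y - (tr (x ∘ y) / 3) 1` -/
noncomputable def mulTraceless : Traceless A →ₗ[ℂ] Traceless A →ₗ[ℂ] Traceless A :=
  LinearMap.mk₂ ℂ (fun x y => ⟨(x : Herm3 A) * y - (tr A ((x : Herm3 A) * y) / 3) • 1, starMul_mem _ _⟩)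
    (fun x x' y => Subtype.ext (by
      change ((x : Herm3 A) + x') * y - (tr A (((x : Herm3 A) + x') * y) / 3) • (1 : Herm3 A) =
        (x * y - (tr A ((x : Herm3 A) * y) / 3) • 1) + (x' * y - (tr A ((x' : Herm3 A) * y) / 3) • 1)
      rw [add_mul, map_add]; module))
    (fun c x y => Subtype.ext (by
      change (c • (x : Herm3 A)) * y - (tr A ((c • (x : Herm3 A)) * y) / 3) • (1 : Herm3 A) =
        c • (x * y - (tr A ((x : Herm3 A) * y) / 3) • (1 : Herm3 A))
      rw [smul_mul_assoc, map_smul, smul_eq_mul]; module))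
    (fun x y y' => Subtype.ext (by
      change (x : Herm3 A) * (y + y') - (tr A ((x : Herm3 A) * (y + y')) / 3) • (1 : Herm3 A) =
        (x * y - (tr A ((x : Herm3 A) * y) / 3) • 1) + (x * y' - (tr A ((x : Herm3 A) * y') / 3) • 1)
      rw [mul_add, map_add]; module))
    (fun c x y => Subtype.ext (by
      change (x : Herm3 A) * (c • (y : Herm3 A)) - (tr A ((x : Herm3 A) * (c • (y : Herm3 A))) / 3) • (1 : Herm3 A) =
        c • (x * y - (tr A ((x : Herm3 A) * y) / 3) • (1 : Herm3 A))
      rw [mul_smul_comm, map_smul, smul_eq_mul]; module))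

theorem jordanDerTraceless_apply (x y : Traceless A) (z : Herm3 A) :
    (jordanDerTraceless A x y).1 z = x * (y * z) - y * (x * z) := rfl
theorem formTraceless_apply (x y : Traceless A) :
    formTraceless A x y = tr A ((x : Herm3 A) * y) / 3 := rfl
theorem mulTraceless_apply (x y : Traceless A) :
    ((mulTraceless A x y : Traceless A) : Herm3 A) =
      (x : Herm3 A) * y - (tr A ((x : Herm3 A) * y) / 3) • 1 := rfl

theorem jordanDerTraceless_swap (x y : Traceless A) :
    jordanDerTraceless A x y = - jordanDerTraceless A y x :=
  der_ext fun z => by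
    change (x * (y * z) - y * (x * z) : Herm3 A) = -(y * (x * z) - x * (y * z))
    abel

theorem formTraceless_swap (x y : Traceless A) : formTraceless A x y = formTraceless A y x := by
  rw [formTraceless_apply, formTraceless_apply, mul_comm]

theorem mulTraceless_swap (x y : Traceless A) : mulTraceless A x y = mulTraceless A y x := by
  apply Subtype.ext
  rw [mulTraceless_apply, mulTraceless_apply, mul_comm]

theorem der_one (E : Der (Herm3 A)) : E.1 1 = 0 := by
  have h := der_mul E 1 1
  simpa using h

theorem lie_jordanDerTraceless (E : Der (Herm3 A)) (x y : Traceless A) :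
    ⁅E, jordanDerTraceless A x y⁆ =
      jordanDerTraceless A (derTraceless E x) y + jordanDerTraceless A x (derTraceless E y) := by
  refine der_ext fun z => ?_
  change E.1 (x * (y * z) - y * (x * z) : Herm3 A) - (x * (y * E.1 z) - y * (x * E.1 z) : Herm3 A) =
    (E.1 x * (y * z) - y * (E.1 x * z)) + (x * (E.1 y * z) - E.1 y * (x * z))
  simp only [map_sub, der_mul, mul_add]
  abel

theorem derTraceless_mulTraceless (E : Der (Herm3 A)) (x y : Traceless A) :
    derTraceless E (mulTraceless A x y) =
      mulTraceless A (derTraceless E x) y + mulTraceless A x (derTraceless E y) := by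
  apply Subtype.ext
  have h := tr_der E ((x : Herm3 A) * y)
  rw [der_mul, map_add] at h
  simp only [derTraceless_apply, mulTraceless_apply, Submodule.coe_add, map_sub, map_smul, der_mul,
    der_one, smul_zero, sub_zero]
  linear_combination (norm := module) congrArg (fun t : ℂ => (t / 3) • (1 : Herm3 A)) h

theorem formTraceless_der (E : Der (Herm3 A)) (x y : Traceless A) :
    formTraceless A (derTraceless E x) y + formTraceless A x (derTraceless E y) = 0 := by
  have h := tr_der E ((x : Herm3 A) * y)
  rw [der_mul, map_add] at h
  rw [formTraceless_apply, formTraceless_apply, derTraceless_apply, derTraceless_apply, ← add_div, h,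
    zero_div]

theorem formTraceless_mul (x y z : Traceless A) :
    formTraceless A (mulTraceless A x y) z = formTraceless A (mulTraceless A y z) x := by
  have hx : tr A x = 0 := x.2
  have hz : tr A z = 0 := z.2
  simp only [formTraceless_apply, mulTraceless_apply, sub_mul, smul_mul_assoc, one_mul, map_sub,
    map_smul, hx, hz, smul_zero, sub_zero]
  rw [tr_mul_assoc, mul_comm (x : Herm3 A)]

theorem jordanDerTraceless_cyclic (x y z : Traceless A) :
    jordanDerTraceless A (mulTraceless A x y) z + jordanDerTraceless A (mulTraceless A y z) x
      + jordanDerTraceless A (mulTraceless A z x) y = 0 := by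
  refine der_ext fun w => ?_
  have h := jordan_linear (x : Herm3 A) y z w
  change ((mulTraceless A x y : Herm3 A) * (z * w) - z * ((mulTraceless A x y : Herm3 A) * w)) +
    ((mulTraceless A y z : Herm3 A) * (x * w) - x * ((mulTraceless A y z : Herm3 A) * w)) +
    ((mulTraceless A z x : Herm3 A) * (y * w) - y * ((mulTraceless A z x : Herm3 A) * w)) = 0
  simp only [mulTraceless_apply, sub_mul, mul_sub, smul_mul_assoc, mul_smul_comm, one_mul]
  linear_combination (norm := module) -h

theorem polar_traceless (x y z : Traceless A) :
    (2 : ℂ) • (mulTraceless A (mulTraceless A x y) z + mulTraceless A (mulTraceless A y z) x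
      + mulTraceless A (mulTraceless A z x) y) =
    formTraceless A x y • z + formTraceless A y z • x + formTraceless A z x • y := by
  have h := cayley_hamilton_polar (x : Herm3 A) y z
  have hx : tr A x = 0 := x.2
  have hy : tr A y = 0 := y.2
  have hz : tr A z = 0 := z.2
  have s1 : tr A ((y : Herm3 A) * z * x) = tr A (x * y * z : Herm3 A) := by
    rw [mul_comm, tr_mul_assoc]
  have s2 : tr A ((z : Herm3 A) * x * y) = tr A (x * y * z : Herm3 A) := by
    rw [tr_mul_assoc, mul_comm]
  apply Subtype.ext
  simp only [Submodule.coe_add, Submodule.coe_smul, mulTraceless_apply, formTraceless_apply, sub_mul, smul_mul_assoc, one_mul,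
    map_sub, map_smul, hx, hy, hz, s1, s2, smul_zero, sub_zero, smul_eq_mul, mul_zero, zero_mul, zero_sub, zero_smul, add_zero] at h ⊢
  linear_combination (norm := module) h

end Herm3
end

/- ## The Tits construction -/

section
variable (A B : Type) [NonAssocRing A] [Module ℂ A] [IsScalarTower ℂ A A] [SMulCommClass ℂ A A]
  [ConjAlgebra A] [IsAlternativeRing A]
  [NonAssocRing B] [Module ℂ B] [IsScalarTower ℂ B B] [SMulCommClass ℂ B B]
  [ConjAlgebra B] [IsAlternativeRing B]

open Herm3

/-- The Lie algebra of the Tits construction, on the vector space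
`Der A × Der J₃(B) ⊕ Im A ⊗ J₃(B)₀`. The bracket makes `Der A × Der J₃(B)` a subalgebra acting
in the natural way on `Im A ⊗ J₃(B)₀`, and
`[a ⊗ x, b ⊗ y] = (tr (x ∘ y) / 3) D_{a,b} + 4 re (ab) [L_x, L_y] + (ab - ba) ⊗ (x * y)`
with `x * y = x ∘ y - (tr (x ∘ y) / 3) 1`. -/
def Tits : Type := Der A × Der (Herm3 B) × (Imag A ⊗[ℂ] Traceless B)

namespace Tits

noncomputable instance : AddCommGroup (Tits A B) :=
  inferInstanceAs (AddCommGroup (Der A × Der (Herm3 B) × (Imag A ⊗[ℂ] Traceless B)))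
noncomputable instance : Module ℂ (Tits A B) :=
  inferInstanceAs (Module ℂ (Der A × Der (Herm3 B) × (Imag A ⊗[ℂ] Traceless B)))

variable {A B}

/-- `(D, E) ∈ Der A × Der J` acts by `D ⊗ 1 + 1 ⊗ E`. -/
noncomputable def act (D : Der A) (E : Der (Herm3 B)) :
    Module.End ℂ (Imag A ⊗[ℂ] Traceless B) :=
  (derImag D).rTensor (Traceless B) + (derTraceless E).lTensor (Imag A)

variable (A B)

/-- `(a ⊗ x, b ⊗ y) ↦ (tr (x ∘ y) / 3) D_{a,b}`. -/
noncomputable def oddDer :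
    (Imag A ⊗[ℂ] Traceless B) →ₗ[ℂ] (Imag A ⊗[ℂ] Traceless B) →ₗ[ℂ] Der A :=
  (TensorProduct.map₂ (innerDerImag A) (formTraceless B)).compr₂
    (TensorProduct.rid ℂ (Der A)).toLinearMap

/-- `(a ⊗ x, b ⊗ y) ↦ 4 Re (ab) [L_x, L_y]`. -/
noncomputable def oddJordanDer :
    (Imag A ⊗[ℂ] Traceless B) →ₗ[ℂ] (Imag A ⊗[ℂ] Traceless B) →ₗ[ℂ] Der (Herm3 B) :=
  (4 : ℂ) • (TensorProduct.map₂ (formImag A) (jordanDerTraceless B)).compr₂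
    (TensorProduct.lid ℂ (Der (Herm3 B))).toLinearMap

/-- `(a ⊗ x, b ⊗ y) ↦ [a, b] ⊗ (x * y)`. -/
noncomputable def oddOdd :
    (Imag A ⊗[ℂ] Traceless B) →ₗ[ℂ] (Imag A ⊗[ℂ] Traceless B) →ₗ[ℂ]
      (Imag A ⊗[ℂ] Traceless B) :=
  TensorProduct.map₂ (commImag A) (mulTraceless B)

variable {A B}

theorem oddDer_tmul (a b : Imag A) (x y : Traceless B) :
    oddDer A B (a ⊗ₜ x) (b ⊗ₜ y) = formTraceless B x y • innerDerImag A a b := by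
  simp [oddDer]
theorem oddJordanDer_tmul (a b : Imag A) (x y : Traceless B) :
    oddJordanDer A B (a ⊗ₜ x) (b ⊗ₜ y) =
      (4 * formImag A a b) • jordanDerTraceless B x y := by
  simp [oddJordanDer, mul_smul]
theorem oddOdd_tmul (a b : Imag A) (x y : Traceless B) :
    oddOdd A B (a ⊗ₜ x) (b ⊗ₜ y) = commImag A a b ⊗ₜ mulTraceless B x y := by
  simp [oddOdd]
theorem act_tmul (D : Der A) (E : Der (Herm3 B)) (a : Imag A) (x : Traceless B) :
    act D E (a ⊗ₜ x) = derImag D a ⊗ₜ x + a ⊗ₜ derTraceless E x := by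
  simp [act]

noncomputable instance : Bracket (Tits A B) (Tits A B) where
  bracket u v :=
    (⁅u.1, v.1⁆ + oddDer A B u.2.2 v.2.2,
     ⁅u.2.1, v.2.1⁆ + oddJordanDer A B u.2.2 v.2.2,
     act u.1 u.2.1 v.2.2 - act v.1 v.2.1 u.2.2 + oddOdd A B u.2.2 v.2.2)

theorem lie_def (u v : Tits A B) : ⁅u, v⁆ =
    ((⁅u.1, v.1⁆ + oddDer A B u.2.2 v.2.2,
     ⁅u.2.1, v.2.1⁆ + oddJordanDer A B u.2.2 v.2.2,
     act u.1 u.2.1 v.2.2 - act v.1 v.2.1 u.2.2 + oddOdd A B u.2.2 v.2.2) : Tits A B) := rfl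

theorem swap_ext {M : Type} [AddCommGroup M] [Module ℂ M]
    (β : (Imag A ⊗[ℂ] Traceless B) →ₗ[ℂ] (Imag A ⊗[ℂ] Traceless B) →ₗ[ℂ] M)
    (h : ∀ a b x y, β (a ⊗ₜ x) (b ⊗ₜ y) = - β (b ⊗ₜ y) (a ⊗ₜ x))
    (v w : Imag A ⊗[ℂ] Traceless B) : β v w = - β w v := by
  induction v with
  | zero => simp
  | add v v' h h' => rw [map_add, LinearMap.add_apply, h, h', map_add, neg_add]
  | tmul a x =>
    induction w with
    | zero => simp
    | add w w' h h' => rw [map_add, h, h', map_add, LinearMap.add_apply, neg_add]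
    | tmul b y => exact h a b x y

theorem equivariant_ext {M : Type} [AddCommGroup M] [Module ℂ M]
    (β : (Imag A ⊗[ℂ] Traceless B) →ₗ[ℂ] (Imag A ⊗[ℂ] Traceless B) →ₗ[ℂ] M)
    (S : M →ₗ[ℂ] M) (T : Module.End ℂ (Imag A ⊗[ℂ] Traceless B))
    (h : ∀ a b x y, S (β (a ⊗ₜ x) (b ⊗ₜ y)) =
      β (T (a ⊗ₜ x)) (b ⊗ₜ y) + β (a ⊗ₜ x) (T (b ⊗ₜ y)))
    (v w : Imag A ⊗[ℂ] Traceless B) : S (β v w) = β (T v) w + β v (T w) := by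
  induction v with
  | zero => simp
  | add v v' h h' => simp only [map_add, LinearMap.add_apply, h, h']; abel
  | tmul a x =>
    induction w with
    | zero => simp
    | add w w' h h' => simp only [map_add, h, h']; abel
    | tmul b y => exact h a b x y

theorem cyclic_ext {M : Type} [AddCommGroup M] [Module ℂ M]
    (β : (Imag A ⊗[ℂ] Traceless B) →ₗ[ℂ] (Imag A ⊗[ℂ] Traceless B) →ₗ[ℂ]
      (Imag A ⊗[ℂ] Traceless B) →ₗ[ℂ] M)
    (h : ∀ a b c x y z, β (a ⊗ₜ x) (b ⊗ₜ y) (c ⊗ₜ z) + β (b ⊗ₜ y) (c ⊗ₜ z) (a ⊗ₜ x)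
      + β (c ⊗ₜ z) (a ⊗ₜ x) (b ⊗ₜ y) = 0)
    (u v w : Imag A ⊗[ℂ] Traceless B) : β u v w + β v w u + β w u v = 0 := by
  induction u with
  | zero => simp
  | add u u' hu hu' =>
    simp only [map_add, LinearMap.add_apply]
    linear_combination (norm := abel) hu + hu'
  | tmul a x =>
    induction v with
    | zero => simp
    | add v v' hv hv' =>
      simp only [map_add, LinearMap.add_apply]
      linear_combination (norm := abel) hv + hv'
    | tmul b y =>
      induction w with
      | zero => simp
      | add w w' hw hw' =>
        simp only [map_add, LinearMap.add_apply]
        linear_combination (norm := abel) hw + hw'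
      | tmul c z => exact h a b c x y z

theorem oddDer_swap (v w : Imag A ⊗[ℂ] Traceless B) : oddDer A B v w = - oddDer A B w v :=
  swap_ext (oddDer A B) (fun a b x y => by
    rw [oddDer_tmul, oddDer_tmul, innerDerImag_swap, formTraceless_swap]
    exact smul_neg _ _) v w

theorem oddJordanDer_swap (v w : Imag A ⊗[ℂ] Traceless B) :
    oddJordanDer A B v w = - oddJordanDer A B w v :=
  swap_ext (oddJordanDer A B) (fun a b x y => by
    rw [oddJordanDer_tmul, oddJordanDer_tmul, formImag_swap, jordanDerTraceless_swap]
    exact smul_neg _ _) v w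

theorem oddOdd_swap (v w : Imag A ⊗[ℂ] Traceless B) : oddOdd A B v w = - oddOdd A B w v :=
  swap_ext (oddOdd A B) (fun a b x y => by
    rw [oddOdd_tmul, oddOdd_tmul, commImag_swap, mulTraceless_swap]
    exact TensorProduct.neg_tmul _ _) v w

theorem act_add (D D' : Der A) (E E' : Der (Herm3 B)) (w : Imag A ⊗[ℂ] Traceless B) :
    act (D + D') (E + E') w = act D E w + act D' E' w := by
  simp only [act, map_add, LinearMap.rTensor_add, LinearMap.lTensor_add, LinearMap.add_apply]
  abel

theorem act_smul (c : ℂ) (D : Der A) (E : Der (Herm3 B)) (w : Imag A ⊗[ℂ] Traceless B) :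
    act (c • D) (c • E) w = c • act D E w := by
  simp only [act, map_smul, LinearMap.rTensor_smul, LinearMap.lTensor_smul, LinearMap.add_apply,
    LinearMap.smul_apply, smul_add]

theorem derImag_lie (D D' : Der A) (a : Imag A) :
    derImag ⁅D, D'⁆ a = derImag D (derImag D' a) - derImag D' (derImag D a) := rfl

theorem derTraceless_lie (E E' : Der (Herm3 B)) (x : Traceless B) :
    derTraceless ⁅E, E'⁆ x =
      derTraceless E (derTraceless E' x) - derTraceless E' (derTraceless E x) := rfl

theorem act_neg (D : Der A) (E : Der (Herm3 B)) (w : Imag A ⊗[ℂ] Traceless B) :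
    act (-D) (-E) w = -act D E w := by
  have h : act (-D + D) (-E + E) w = act (-D) (-E) w + act D E w := act_add _ _ _ _ _
  rw [neg_add_cancel, neg_add_cancel] at h
  have h0 : act (0 : Der A) (0 : Der (Herm3 B)) w = 0 := by simp [act]
  exact eq_neg_of_add_eq_zero_left (h.symm.trans h0)

theorem act_lie (D D' : Der A) (E E' : Der (Herm3 B)) (w : Imag A ⊗[ℂ] Traceless B) :
    act ⁅D, D'⁆ ⁅E, E'⁆ w = act D E (act D' E' w) - act D' E' (act D E w) := by
  induction w with
  | zero => simp
  | add v v' h h' => simp only [map_add, h, h']; abel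
  | tmul a x =>
    simp only [act_tmul, map_add, derImag_lie, derTraceless_lie, TensorProduct.sub_tmul,
      TensorProduct.tmul_sub]
    abel

theorem lie_oddDer (D : Der A) (E : Der (Herm3 B)) (v w : Imag A ⊗[ℂ] Traceless B) :
    ⁅D, oddDer A B v w⁆ = oddDer A B (act D E v) w + oddDer A B v (act D E w) := by
  refine equivariant_ext (oddDer A B) (LieAlgebra.ad ℂ (Der A) D) (act D E) (fun a b x y => ?_) v w
  have hE := formTraceless_der E x y
  rw [LieAlgebra.ad_apply, oddDer_tmul, lie_smul, lie_innerDerImag]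
  simp only [act_tmul, map_add, LinearMap.add_apply, oddDer_tmul]
  linear_combination (norm := module) -(congrArg (fun t : ℂ => t • innerDerImag A a b) hE)

theorem lie_oddJordanDer (D : Der A) (E : Der (Herm3 B)) (v w : Imag A ⊗[ℂ] Traceless B) :
    ⁅E, oddJordanDer A B v w⁆ =
      oddJordanDer A B (act D E v) w + oddJordanDer A B v (act D E w) := by
  refine equivariant_ext (oddJordanDer A B) (LieAlgebra.ad ℂ (Der (Herm3 B)) E) (act D E)
    (fun a b x y => ?_) v w
  have hD := formImag_derImag D a b
  rw [LieAlgebra.ad_apply, oddJordanDer_tmul, lie_smul, lie_jordanDerTraceless]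
  simp only [act_tmul, map_add, LinearMap.add_apply, oddJordanDer_tmul]
  generalize jordanDerTraceless B x y = d
  generalize jordanDerTraceless B (derTraceless E x) y = d'
  generalize jordanDerTraceless B x (derTraceless E y) = d''
  linear_combination (norm := module) -(congrArg (fun t : ℂ => (4 * t) • d) hD)

theorem act_oddOdd (D : Der A) (E : Der (Herm3 B)) (v w : Imag A ⊗[ℂ] Traceless B) :
    act D E (oddOdd A B v w) = oddOdd A B (act D E v) w + oddOdd A B v (act D E w) := by
  refine equivariant_ext (oddOdd A B) (act D E) (act D E) (fun a b x y => ?_) v w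
  simp only [act_tmul, map_add, LinearMap.add_apply, oddOdd_tmul, derImag_commImag,
    derTraceless_mulTraceless, TensorProduct.add_tmul, TensorProduct.tmul_add]
  abel

theorem oddDer_cyclic (u v w : Imag A ⊗[ℂ] Traceless B) :
    oddDer A B (oddOdd A B u v) w + oddDer A B (oddOdd A B v w) u
      + oddDer A B (oddOdd A B w u) v = 0 := by
  refine cyclic_ext ((oddOdd A B).compr₂ (oddDer A B)) (fun a b c x y z => ?_) u v w
  have h := innerDerImag_cyclic a b c
  simp only [LinearMap.compr₂_apply, oddOdd_tmul, oddDer_tmul]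
  rw [formTraceless_mul z x y, formTraceless_mul x y z, ← smul_add, ← smul_add, h]
  exact smul_zero _

theorem oddJordanDer_cyclic (u v w : Imag A ⊗[ℂ] Traceless B) :
    oddJordanDer A B (oddOdd A B u v) w + oddJordanDer A B (oddOdd A B v w) u
      + oddJordanDer A B (oddOdd A B w u) v = 0 := by
  refine cyclic_ext ((oddOdd A B).compr₂ (oddJordanDer A B)) (fun a b c x y z => ?_) u v w
  have h := jordanDerTraceless_cyclic x y z
  simp only [LinearMap.compr₂_apply, oddOdd_tmul, oddJordanDer_tmul]
  rw [formImag_comm c a b, formImag_comm a b c, ← smul_add, ← smul_add, h]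
  exact smul_zero _

/-- The associator of three imaginary elements. -/
theorem re_associator (a b c : Imag A) :
    (a : A) * b * c - a * (b * c) ∈ Imag A := by
  rw [mem_imag, map_sub, re_assoc, sub_self]

theorem derImag_innerDerImag (a b c : Imag A) :
    derImag (innerDerImag A a b) c = (4 * formImag A b c) • a - (4 * formImag A c a) • b
      - ⟨_, re_associator a b c⟩ :=
  Subtype.ext (innerDerFun_imag (a : A) b c a.2 b.2 c.2)

theorem commImag_commImag (a b c : Imag A) :
    commImag A (commImag A a b) c = (4 * formImag A b c) • a - (4 * formImag A c a) • b
      + (2 : ℂ) • ⟨_, re_associator a b c⟩ := by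
  apply Subtype.ext
  have h := innerDerFun_imag (a : A) b c a.2 b.2 c.2
  have h1 := alt_left (a : A) b c
  have h2 := alt_right (a : A) b c
  have h3 := alt_left (a : A) c b
  have h5 := alt_right (c : A) a b
  change ((a : A) * b - b * a) * c - c * (a * b - b * a) =
    (4 * re ((b : A) * c)) • (a : A) - (4 * re ((c : A) * a)) • (b : A)
      + (2 : ℂ) • ((a : A) * b * c - a * (b * c))
  rw [two_smul]
  simp only [innerDerFun] at h
  simp only [mul_sub, sub_mul]
  linear_combination (norm := skip) h - h1 - h5 + h3 + h3 - h2
  abel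

theorem associator_cyclic (a b c : Imag A) :
    (⟨_, re_associator b c a⟩ : Imag A) = ⟨_, re_associator a b c⟩ := by
  apply Subtype.ext
  change (b : A) * c * a - b * (c * a) = a * b * c - a * (b * c)
  have h1 := alt_left (a : A) b c
  have h2 := alt_right (b : A) a c
  linear_combination (norm := skip) h2 - h1
  abel

theorem derTraceless_jordanDer (x y z : Traceless A) :
    derTraceless (jordanDerTraceless A x y) z =
      mulTraceless A (mulTraceless A y z) x - mulTraceless A (mulTraceless A z x) y
        + formTraceless A y z • x - formTraceless A z x • y := by
  have h := formTraceless_mul y z x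
  apply Subtype.ext
  rw [formTraceless_apply, formTraceless_apply] at h
  change (x : Herm3 A) * (y * z) - y * (x * z) =
    ((mulTraceless A y z : Herm3 A) * x - (tr A ((mulTraceless A y z : Herm3 A) * x) / 3) • 1)
    - ((mulTraceless A z x : Herm3 A) * y - (tr A ((mulTraceless A z x : Herm3 A) * y) / 3) • 1)
    + (tr A (y * z : Herm3 A) / 3) • (x : Herm3 A) - (tr A (z * x : Herm3 A) / 3) • (y : Herm3 A)
  rw [h, mulTraceless_apply, mulTraceless_apply, sub_mul, sub_mul, smul_mul_assoc, smul_mul_assoc,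
    one_mul, one_mul, mul_comm (x : Herm3 A) (y * z), mul_comm (x : Herm3 A) z,
    mul_comm (y : Herm3 A) (z * x)]
  abel

theorem odd_cyclic (u v w : Imag A ⊗[ℂ] Traceless B) :
    (act (oddDer A B u v) (oddJordanDer A B u v) w + oddOdd A B (oddOdd A B u v) w)
      + (act (oddDer A B v w) (oddJordanDer A B v w) u + oddOdd A B (oddOdd A B v w) u)
      + (act (oddDer A B w u) (oddJordanDer A B w u) v + oddOdd A B (oddOdd A B w u) v) = 0 := by
  have hact : ∀ (D : Der A) (E : Der (Herm3 B)), act D E =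
      (LinearMap.rTensorHom (Traceless B)).comp (derImag (A := A)) D
        + (LinearMap.lTensorHom (Imag A)).comp (derTraceless (A := B)) E := fun _ _ => rfl
  have hodd := cyclic_ext
    ((oddDer A B).compr₂ ((LinearMap.rTensorHom (Traceless B)).comp derImag)
      + (oddJordanDer A B).compr₂ ((LinearMap.lTensorHom (Imag A)).comp derTraceless)
      + (oddOdd A B).compr₂ (oddOdd A B)) (fun a b c x y z => ?_) u v w
  · simp only [LinearMap.add_apply, LinearMap.compr₂_apply, ← hact] at hodd
    exact hodd
  · simp only [LinearMap.add_apply, LinearMap.compr₂_apply]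
    rw [← LinearMap.add_apply, ← LinearMap.add_apply _ _ (a ⊗ₜ[ℂ] x), ← LinearMap.add_apply _ _ (b ⊗ₜ[ℂ] y),
      ← hact, ← hact, ← hact]
    have hp := polar_traceless x y z
    have hd := derTraceless_jordanDer (A := B)
    simp only [oddOdd_tmul, oddDer_tmul, oddJordanDer_tmul, act_tmul, commImag_commImag, map_smul,
      LinearMap.smul_apply, derImag_innerDerImag, associator_cyclic a b c,
      associator_cyclic b c a, hd]
    set f : Imag A := ⟨_, re_associator a b c⟩ with hf
    have hp2 := congrArg (fun t => f ⊗ₜ[ℂ] t) hp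
    simp only [TensorProduct.tmul_add, TensorProduct.tmul_sub, TensorProduct.add_tmul,
      TensorProduct.sub_tmul, ← TensorProduct.smul_tmul', TensorProduct.tmul_smul] at hp2 ⊢
    linear_combination (norm := module) hp2

theorem lie_eq (u v : Tits A B) : ⁅u, v⁆ =
    ((⁅u.1, v.1⁆ + oddDer A B u.2.2 v.2.2,
     ⁅u.2.1, v.2.1⁆ + oddJordanDer A B u.2.2 v.2.2,
     act u.1 u.2.1 v.2.2 - act v.1 v.2.1 u.2.2 + oddOdd A B u.2.2 v.2.2) : Tits A B) := rfl

theorem lie_add_aux {L M : Type} [LieRing L] [AddCommGroup M] [Module ℂ M]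
    [Module ℂ L] (β : M →ₗ[ℂ] M →ₗ[ℂ] L) (x y z : L) (u v w : M) :
    ⁅x + y, z⁆ + β (u + v) w = (⁅x, z⁆ + β u w) + (⁅y, z⁆ + β v w) := by
  rw [add_lie, map_add, LinearMap.add_apply]; abel

theorem add_lie_aux {L M : Type} [LieRing L] [AddCommGroup M] [Module ℂ M]
    [Module ℂ L] (β : M →ₗ[ℂ] M →ₗ[ℂ] L) (x y z : L) (u v w : M) :
    ⁅z, x + y⁆ + β w (u + v) = (⁅z, x⁆ + β w u) + (⁅z, y⁆ + β w v) := by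
  rw [lie_add, map_add]; abel

theorem leibniz_even_aux {L M : Type} [LieRing L] [AddCommGroup M] [Module ℂ M] [Module ℂ L]
    (β : M →ₗ[ℂ] M →ₗ[ℂ] L) (γ : M →ₗ[ℂ] M →ₗ[ℂ] M) (hβ : ∀ x y, β x y = - β y x)
    (hγ : ∀ x y, γ x y = - γ y x)
    (hc : ∀ x y z, β (γ x y) z + β (γ y z) x + β (γ z x) y = 0)
    (T1 T2 T3 : Module.End ℂ M) (D1 D2 D3 : L)
    (e1 : ∀ x y, ⁅D1, β x y⁆ = β (T1 x) y + β x (T1 y))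
    (e2 : ∀ x y, ⁅D2, β x y⁆ = β (T2 x) y + β x (T2 y))
    (e3 : ∀ x y, ⁅D3, β x y⁆ = β (T3 x) y + β x (T3 y)) (x y z : M) :
    ⁅D1, ⁅D2, D3⁆ + β y z⁆ + β x (T2 z - T3 y + γ y z) =
      (⁅⁅D1, D2⁆ + β x y, D3⁆ + β (T1 y - T2 x + γ x y) z)
        + (⁅D2, ⁅D1, D3⁆ + β x z⁆ + β y (T1 z - T3 x + γ x z)) := by
  have h := hc x y z
  have s1 := hβ (γ y z) x
  have s2 := hβ (γ z x) y
  have s3 := congrArg (β y) (hγ z x)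
  have s4 := hβ (T3 x) y
  have j := leibniz_lie D1 D2 D3
  have a3 := lie_skew (β x y) D3
  simp only [map_add, map_sub, map_neg, LinearMap.add_apply, LinearMap.sub_apply, lie_add, add_lie,
    e1, e2, e3] at j a3 s3 ⊢
  linear_combination (norm := skip) j - h + s1 + s2 - s3 + s4 + a3
  abel

noncomputable instance : LieRing (Tits A B) where
  add_lie u v w := by
    refine Prod.ext ?_ (Prod.ext ?_ ?_)
    · exact lie_add_aux (oddDer A B) _ _ _ _ _ _
    · exact lie_add_aux (oddJordanDer A B) _ _ _ _ _ _
    · change act (u.1 + v.1) (u.2.1 + v.2.1) w.2.2 - act w.1 w.2.1 (u.2.2 + v.2.2)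
          + oddOdd A B (u.2.2 + v.2.2) w.2.2 =
        (act u.1 u.2.1 w.2.2 - act w.1 w.2.1 u.2.2 + oddOdd A B u.2.2 w.2.2)
          + (act v.1 v.2.1 w.2.2 - act w.1 w.2.1 v.2.2 + oddOdd A B v.2.2 w.2.2)
      rw [act_add, map_add, map_add, LinearMap.add_apply]; abel
  lie_add w u v := by
    refine Prod.ext ?_ (Prod.ext ?_ ?_)
    · exact add_lie_aux (oddDer A B) _ _ _ _ _ _
    · exact add_lie_aux (oddJordanDer A B) _ _ _ _ _ _
    · change act w.1 w.2.1 (u.2.2 + v.2.2) - act (u.1 + v.1) (u.2.1 + v.2.1) w.2.2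
          + oddOdd A B w.2.2 (u.2.2 + v.2.2) =
        (act w.1 w.2.1 u.2.2 - act u.1 u.2.1 w.2.2 + oddOdd A B w.2.2 u.2.2)
          + (act w.1 w.2.1 v.2.2 - act v.1 v.2.1 w.2.2 + oddOdd A B w.2.2 v.2.2)
      rw [act_add, map_add, map_add]; abel
  lie_self u := by
    have self_zero : ∀ {M : Type} [AddCommGroup M] [Module ℂ M] {m : M}, m = -m → m = 0 := by
      intro M _ _ m h
      have h2 : (2 : ℂ) • m = 0 := by rw [two_smul]; nth_rewrite 1 [h]; exact neg_add_cancel m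
      exact (smul_eq_zero.1 h2).resolve_left two_ne_zero
    refine Prod.ext ?_ (Prod.ext ?_ ?_)
    · change ⁅u.1, u.1⁆ + oddDer A B u.2.2 u.2.2 = 0
      rw [lie_self, self_zero (oddDer_swap u.2.2 u.2.2), add_zero]
    · change ⁅u.2.1, u.2.1⁆ + oddJordanDer A B u.2.2 u.2.2 = 0
      rw [lie_self, self_zero (oddJordanDer_swap u.2.2 u.2.2), add_zero]
    · change act u.1 u.2.1 u.2.2 - act u.1 u.2.1 u.2.2 + oddOdd A B u.2.2 u.2.2 = 0
      rw [sub_self, self_zero (oddOdd_swap u.2.2 u.2.2), add_zero]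
  leibniz_lie u v w := by
    obtain ⟨D1, E1, x⟩ := u
    obtain ⟨D2, E2, y⟩ := v
    obtain ⟨D3, E3, z⟩ := w
    refine Prod.ext ?_ (Prod.ext ?_ ?_)
    · change ⁅D1, ⁅D2, D3⁆ + oddDer A B y z⁆
          + oddDer A B x (act D2 E2 z - act D3 E3 y + oddOdd A B y z) =
        (⁅⁅D1, D2⁆ + oddDer A B x y, D3⁆
          + oddDer A B (act D1 E1 y - act D2 E2 x + oddOdd A B x y) z)
        + (⁅D2, ⁅D1, D3⁆ + oddDer A B x z⁆
          + oddDer A B y (act D1 E1 z - act D3 E3 x + oddOdd A B x z))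
      exact leibniz_even_aux (oddDer A B) (oddOdd A B) oddDer_swap oddOdd_swap oddDer_cyclic
        (act D1 E1) (act D2 E2) (act D3 E3) D1 D2 D3 (lie_oddDer D1 E1) (lie_oddDer D2 E2)
        (lie_oddDer D3 E3) x y z
    · change ⁅E1, ⁅E2, E3⁆ + oddJordanDer A B y z⁆
          + oddJordanDer A B x (act D2 E2 z - act D3 E3 y + oddOdd A B y z) =
        (⁅⁅E1, E2⁆ + oddJordanDer A B x y, E3⁆
          + oddJordanDer A B (act D1 E1 y - act D2 E2 x + oddOdd A B x y) z)
        + (⁅E2, ⁅E1, E3⁆ + oddJordanDer A B x z⁆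
          + oddJordanDer A B y (act D1 E1 z - act D3 E3 x + oddOdd A B x z))
      exact leibniz_even_aux (oddJordanDer A B) (oddOdd A B) oddJordanDer_swap oddOdd_swap
        oddJordanDer_cyclic (act D1 E1) (act D2 E2) (act D3 E3) E1 E2 E3 (lie_oddJordanDer D1 E1)
        (lie_oddJordanDer D2 E2) (lie_oddJordanDer D3 E3) x y z
    · change act D1 E1 (act D2 E2 z - act D3 E3 y + oddOdd A B y z)
          - act (⁅D2, D3⁆ + oddDer A B y z) (⁅E2, E3⁆ + oddJordanDer A B y z) x
          + oddOdd A B x (act D2 E2 z - act D3 E3 y + oddOdd A B y z) =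
        (act (⁅D1, D2⁆ + oddDer A B x y) (⁅E1, E2⁆ + oddJordanDer A B x y) z
          - act D3 E3 (act D1 E1 y - act D2 E2 x + oddOdd A B x y)
          + oddOdd A B (act D1 E1 y - act D2 E2 x + oddOdd A B x y) z)
        + (act D2 E2 (act D1 E1 z - act D3 E3 x + oddOdd A B x z)
          - act (⁅D1, D3⁆ + oddDer A B x z) (⁅E1, E3⁆ + oddJordanDer A B x z) y
          + oddOdd A B y (act D1 E1 z - act D3 E3 x + oddOdd A B x z))
      have h := odd_cyclic x y z
      have s0 : act (oddDer A B x z) (oddJordanDer A B x z) y =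
          - act (oddDer A B z x) (oddJordanDer A B z x) y := by
        rw [oddDer_swap, oddJordanDer_swap, act_neg]
      have s1 := oddOdd_swap (oddOdd A B y z) x
      have s2 := oddOdd_swap (oddOdd A B z x) y
      have s3 := congrArg (oddOdd A B y) (oddOdd_swap z x)
      have s4 := oddOdd_swap (act D3 E3 x) y
      simp only [act_add, act_lie, map_add, map_sub, map_neg, LinearMap.add_apply,
        LinearMap.sub_apply, act_oddOdd, s0] at s3 ⊢
      linear_combination (norm := skip) -h + s1 + s2 - s3 + s4
      abel

noncomputable instance : LieAlgebra ℂ (Tits A B) where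
  lie_smul c u v := by
    refine Prod.ext ?_ (Prod.ext ?_ ?_)
    · change ⁅u.1, c • v.1⁆ + oddDer A B u.2.2 (c • v.2.2) =
        c • (⁅u.1, v.1⁆ + oddDer A B u.2.2 v.2.2)
      rw [lie_smul, map_smul, smul_add]
    · change ⁅u.2.1, c • v.2.1⁆ + oddJordanDer A B u.2.2 (c • v.2.2) =
        c • (⁅u.2.1, v.2.1⁆ + oddJordanDer A B u.2.2 v.2.2)
      rw [lie_smul, map_smul, smul_add]
    · change act u.1 u.2.1 (c • v.2.2) - act (c • v.1) (c • v.2.1) u.2.2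
          + oddOdd A B u.2.2 (c • v.2.2) =
        c • (act u.1 u.2.1 v.2.2 - act v.1 v.2.1 u.2.2 + oddOdd A B u.2.2 v.2.2)
      rw [act_smul, map_smul, map_smul, smul_add, smul_sub]

variable (A B) in
/-- The embedding of `Der J₃(B)` in the Tits algebra. -/
noncomputable def ofDer : Der (Herm3 B) →ₗ⁅ℂ⁆ Tits A B where
  toFun E := ((0, E, 0) : Der A × Der (Herm3 B) × (Imag A ⊗[ℂ] Traceless B))
  map_add' E E' := by
    refine Prod.ext ?_ (Prod.ext ?_ ?_)
    · exact (add_zero 0).symm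
    · rfl
    · exact (add_zero 0).symm
  map_smul' c E := by
    refine Prod.ext ?_ (Prod.ext ?_ ?_)
    · exact (smul_zero c).symm
    · rfl
    · exact (smul_zero c).symm
  map_lie' {E E'} := by
    refine Prod.ext ?_ (Prod.ext ?_ ?_)
    · change (0 : Der A) = ⁅(0 : Der A), (0 : Der A)⁆ + oddDer A B 0 0
      simp
    · change ⁅E, E'⁆ = ⁅E, E'⁆ + oddJordanDer A B 0 0
      rw [map_zero, add_zero]
    · change 0 = act 0 E 0 - act 0 E' 0 + oddOdd A B 0 0
      simp

end Tits
end

/- ## Nilpotent orbits, stabilizers, gradings -/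

section
variable (L : Type) [LieRing L] [LieAlgebra ℂ L]

/-- The stabilizer of `Z` under the adjoint action, that is the centralizer of `Z`. -/
def stabilizer (Z : L) : LieSubalgebra ℂ L where
  carrier := {W | ⁅W, Z⁆ = 0}
  add_mem' := fun {W W'} h h' => by
    change ⁅W + W', Z⁆ = 0
    rw [add_lie, show ⁅W, Z⁆ = 0 from h, show ⁅W', Z⁆ = 0 from h', add_zero]
  zero_mem' := zero_lie Z
  smul_mem' := fun c W h => by
    change ⁅c • W, Z⁆ = 0
    rw [smul_lie, show ⁅W, Z⁆ = 0 from h, smul_zero]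
  lie_mem' := fun {W W'} h h' => by
    change ⁅⁅W, W'⁆, Z⁆ = 0
    rw [lie_lie, show ⁅W, Z⁆ = 0 from h, show ⁅W', Z⁆ = 0 from h', lie_zero, lie_zero, sub_zero]

/-- The nilpotent radical: the largest ideal which is nilpotent as a Lie algebra (in finite
dimension the sum of all nilpotent ideals is nilpotent). -/
def nilpotentRadical : LieIdeal ℂ L := sSup {I : LieIdeal ℂ L | LieRing.IsNilpotent I}

/-- `φ = exp D = ∑ Dⁿ / n!`, convergence being tested against linear forms, as is legitimate on a
finite-dimensional space. -/
def IsExp {V : Type} [AddCommGroup V] [Module ℂ V] (D φ : Module.End ℂ V) : Prop :=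
  ∀ (v : V) (f : Module.Dual ℂ V),
    HasSum (fun n : ℕ => ((n.factorial : ℂ)⁻¹) * f ((D ^ n) v)) (f (φ v))

/-- The adjoint group, generated by the automorphisms `exp (ad z)`. In finite dimension the first
condition is a consequence of the second one. -/
def adjointGroup : Subgroup (L ≃ₗ[ℂ] L) :=
  Subgroup.closure {φ | (∀ x y : L, φ ⁅x, y⁆ = ⁅φ x, φ y⁆) ∧
    ∃ z : L, IsExp (LieAlgebra.ad ℂ L z) (φ : L →ₗ[ℂ] L)}

variable {L}

/-- The orbit of `X` under the adjoint group. -/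
def adjointOrbit (X : L) : Set L := {Y | ∃ φ ∈ adjointGroup L, φ X = Y}

/-- The orbits of the elements `X` with `ad X` nilpotent. -/
def IsNilpotentOrbit (O : Set L) : Prop :=
  ∃ X : L, IsNilpotent (LieAlgebra.ad ℂ L X) ∧ O = adjointOrbit X

/-- The relations of an `sl₂`-triple `(X, Y, H)`. The zero triple is allowed, for the zero orbit. -/
structure IsTriple (X Y H : L) : Prop where
  lie_H_X : ⁅H, X⁆ = (2 : ℂ) • X
  lie_H_Y : ⁅H, Y⁆ = -((2 : ℂ) • Y)
  lie_X_Y : ⁅X, Y⁆ = H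

/-- The eigenspace of `ad H` for the eigenvalue `i`. -/
def gradedPiece (H : L) (i : ℤ) : Submodule ℂ L :=
  Module.End.eigenspace (LieAlgebra.ad ℂ L H) (i : ℂ)

end

/-- The Lie algebra `f₄ = Der J₃(𝕆)`. -/
abbrev F4 : Type := Der (Herm3 AlgO)

section
variable (A : Type) [NonAssocRing A] [Module ℂ A] [IsScalarTower ℂ A A] [SMulCommClass ℂ A A]
  [ConjAlgebra A] [IsAlternativeRing A]

/-- The Lie algebra `g(A, 𝕆)`: of type `F₄, E₆, E₇, E₈` for `A = ℝ, ℂ, ℍ, 𝕆` (complexified). -/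
abbrev Exc : Type := Tits A AlgO

/-- The inclusion of `f₄ = Der J₃(𝕆)` in `g(A, 𝕆)`. -/
noncomputable abbrev inclF4 : F4 →ₗ⁅ℂ⁆ Exc A := Tits.ofDer A AlgO

/-- The orbit in `g(A, 𝕆)` induced by an orbit in `f₄`. -/
def seriesOrbit (O₁ : Set F4) : Set (Exc A) :=
  {Z | ∃ X ∈ O₁, Z ∈ adjointOrbit (inclF4 A X)}

end

end MagicSquare

open MagicSquare

/-! As a module over `f₄ = Der J₃(𝕆)`, the algebra `g(𝔸,𝕆)` is `Der 𝔸` (trivial action) plus `f₄`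
(adjoint action) plus `a - 1` copies of `J₃(𝕆)₀`. Any dimension attached additively to the action of
an element of `f₄` is therefore affine in `a`, provided that the trivial summand, whose dimension 0,
0, 3, 14 is not affine in `a`, does not contribute. Both claims reduce to such dimensions.

For the radical, let `X` be nilpotent in a Lie algebra with nondegenerate Killing form. The
nilpotent radical of its centralizer is `ker (ad X) ∩ im (ad X)`. That intersection is a nilpotent
ideal: an element `[X,v]` commuting with `X` is ad-nilpotent by Jacobson's lemma, and Engel's
theorem applies. It contains every nilpotent ideal `N`: by invariance `im (ad X)` is the Killing
orthogonal of `ker (ad X)`, and for `n ∈ N` and `y` centralizing `X` the operator `ad n ad y` is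
nilpotent on the centralizer and commutes with the nilpotent `ad X`, so it is nilpotent and has
trace zero. Hence the radical has dimension `dim ker (ad X)² - dim ker (ad X)`
(`finrank_nilpotentRadical`), and `Der 𝔸` cancels in the difference.

For the grading, an eigenspace of `ad H` with eigenvalue `i ≠ 0` misses `Der 𝔸`. It remains to see
that its dimension does not depend on the triple. For any `sl₂`-triple of endomorphisms, the
dimensions of the integral eigenspaces of `h` are determined by those of `ker xᵏ`
(`IsEndTriple.finrank_eigenspace_int_eq`). The latter are constant along an orbit in every
representation, because `exp (ad z)` acts there as conjugation by `exp (ρ z)`. Complete reducibility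
and the Jacobson-Morozov theorem are not needed.

Nondegeneracy of the Killing form comes from a compact real form. The algebra carries a
conjugate-linear involution and an invariant form, a weighted sum of trace forms and of the product
form on `Im 𝔸 ⊗ J₃(𝕆)₀`, which is negative definite on the real points. Then `ad z` has adjoint `-ad
(bar z)`, so a `z` in the Killing kernel has `ad z = 0`, and the center is trivial. -/

namespace MagicSquare
open scoped TensorProduct
set_option linter.unusedSectionVars false
set_option linter.unusedSimpArgs false

/-! ### Jacobson's lemma on nilpotent commutators -/

section
open Polynomial in
/-- Jacobson's lemma: a commutator `ab - ba` commuting with `a` is nilpotent. -/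
theorem isNilpotent_commutator {V : Type*} [AddCommGroup V] [Module ℂ V] [FiniteDimensional ℂ V]
    (a b c : Module.End ℂ V) (hc : c = a * b - b * a) (hac : a * c = c * a) : IsNilpotent c := by
  -- `a` commutes with every polynomial in `c`, so `c r(c) = [a, b r(c)]` is a commutator.
  have htr : ∀ r : ℂ[X], LinearMap.trace ℂ V (c * aeval c r) = 0 := by
    intro r
    have hcomm : Commute a (aeval c r) := by
      have h : Commute a c := hac
      exact Algebra.commute_of_mem_adjoin_singleton_of_commute
        (aeval_mem_adjoin_singleton ℂ c) h
    have e : c * aeval c r = a * (b * aeval c r) - (b * aeval c r) * a := by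
      rw [mul_assoc b, ← hcomm.eq, ← mul_assoc, ← mul_assoc, ← sub_mul, ← hc]
    rw [e, map_sub, LinearMap.trace_mul_comm, sub_self]
  obtain ⟨q, hq, hnd⟩ := exists_eq_pow_rootMultiplicity_mul_and_not_dvd (minpoly ℂ c)
    (minpoly.ne_zero (Algebra.IsIntegral.isIntegral c)) 0
  set k := rootMultiplicity 0 (minpoly ℂ c)
  rw [C_0, sub_zero] at hq hnd
  -- The minimal polynomial is `X ^ k * q` with `q` prime to `X`; `e` below is the projector onto
  -- the part where `c` is invertible. The exponent `k + 1` makes `e` a multiple of `c` even if `k =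
  -- 0`, so that `htr` gives it trace zero; an idempotent of trace zero vanishes in characteristic
  -- zero.
  have hcop : IsCoprime (X ^ (k + 1)) q :=
    ((irreducible_X (R := ℂ)).coprime_iff_not_dvd.2 hnd).pow_left
  obtain ⟨u, v, huv⟩ := hcop
  have hz : aeval c (X ^ k * q) = 0 := by rw [← hq, minpoly.aeval]
  set e := aeval c (u * X ^ (k + 1)) with he
  have he1 : e = 1 - aeval c (v * q) := by
    rw [he, eq_sub_iff_add_eq, ← map_add, huv, map_one]
  have hid : IsIdempotentElem e := by
    have : aeval c (u * X ^ (k + 1)) * aeval c (v * q) = 0 := by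
      rw [← map_mul, show u * X ^ (k + 1) * (v * q) = (u * v * X) * (X ^ k * q) by ring, map_mul,
        hz, mul_zero]
    change e * e = e
    nth_rewrite 2 [he1]
    rw [mul_sub, mul_one, this, sub_zero]
  have h0 : e = 0 := by
    apply LinearMap.IsIdempotentElem.eq_zero_of_trace_eq_zero hid
    rw [he, show u * X ^ (k + 1) = X * (u * X ^ k) by ring, map_mul, aeval_X, htr]
  refine ⟨k, ?_⟩
  have h1 : aeval c (v * q) = 1 := by rw [h0] at he1; exact (sub_eq_zero.1 he1.symm).symm
  have h2 : aeval c (X ^ k * (v * q)) = 0 := by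
    rw [show X ^ k * (v * q) = v * (X ^ k * q) by ring, map_mul, hz, mul_zero]
  rwa [map_mul, h1, mul_one, aeval_X_pow] at h2

/-! ### The nilpotent radical of the centralizer of a nilpotent element -/

section
variable {L : Type} [LieRing L] [LieAlgebra ℂ L]

theorem mem_stabilizer {Z W : L} : W ∈ stabilizer L Z ↔ ⁅W, Z⁆ = 0 := Iff.rfl

theorem mem_ker_ad {Z W : L} : W ∈ LinearMap.ker (LieAlgebra.ad ℂ L Z) ↔ ⁅W, Z⁆ = 0 := by
  rw [LinearMap.mem_ker, LieAlgebra.ad_apply, ← lie_skew, neg_eq_zero]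

theorem ad_lie (x y : L) : LieAlgebra.ad ℂ L ⁅x, y⁆ =
    LieAlgebra.ad ℂ L x * LieAlgebra.ad ℂ L y - LieAlgebra.ad ℂ L y * LieAlgebra.ad ℂ L x :=
  LinearMap.ext fun z => lie_lie x y z

theorem commute_ad {x y : L} (h : ⁅x, y⁆ = 0) :
    Commute (LieAlgebra.ad ℂ L x) (LieAlgebra.ad ℂ L y) := by
  have h' := ad_lie x y
  rw [h, map_zero] at h'
  exact sub_eq_zero.1 h'.symm

/-- The elements of the stabilizer of `Z` lying in `[Z, L]`. -/
def stabilizerInfRange (Z : L) : LieIdeal ℂ (stabilizer L Z) where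
  carrier := {w | ∃ v : L, ⁅Z, v⁆ = w}
  add_mem' := by
    rintro _ _ ⟨v, hv⟩ ⟨w, hw⟩
    exact ⟨v + w, by rw [lie_add, hv, hw]; rfl⟩
  zero_mem' := ⟨0, lie_zero Z⟩
  smul_mem' := by
    rintro c _ ⟨v, hv⟩
    exact ⟨c • v, by rw [lie_smul, hv]; rfl⟩
  lie_mem := by
    rintro ⟨x, hx⟩ ⟨w, hw'⟩ ⟨v, hv⟩
    refine ⟨⁅x, v⁆, ?_⟩
    change ⁅Z, v⁆ = w at hv
    change ⁅Z, ⁅x, v⁆⁆ = ⁅x, w⁆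
    have hZx : ⁅Z, x⁆ = 0 := by rw [← lie_skew, mem_stabilizer.1 hx, neg_zero]
    rw [leibniz_lie, hZx, zero_lie, zero_add, hv]

theorem mem_stabilizerInfRange {Z : L} {w : stabilizer L Z} :
    w ∈ stabilizerInfRange Z ↔ ∃ v : L, ⁅Z, v⁆ = w := Iff.rfl

variable [FiniteDimensional ℂ L]

/-- An element `w = [Z,v]` that commutes with `Z` has `ad w = [ad Z, ad v]` commuting with `ad Z`,
so `ad w` is nilpotent by Jacobson's lemma; Engel's theorem then applies to the ideal. -/
theorem isNilpotent_stabilizerInfRange (Z : L) : LieRing.IsNilpotent (stabilizerInfRange Z) := by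
  rw [LieAlgebra.isNilpotent_iff_forall (R := ℂ)]
  rintro ⟨⟨w, hw⟩, v, hv⟩
  change ⁅Z, v⁆ = w at hv
  have hn : IsNilpotent (LieAlgebra.ad ℂ L w) := by
    refine isNilpotent_commutator (LieAlgebra.ad ℂ L Z) (LieAlgebra.ad ℂ L v) _ ?_ ?_
    · rw [← hv, ad_lie]
    · exact (commute_ad (mem_stabilizer.1 hw)).symm
  obtain ⟨k, hk⟩ := hn
  refine ⟨k, LinearMap.ext fun y => ?_⟩
  have key : ∀ n (y : stabilizerInfRange Z),
      ((((LieAlgebra.ad ℂ (stabilizerInfRange Z) ⟨⟨w, hw⟩, v, hv⟩) ^ n) y :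
        stabilizer L Z) : L) = ((LieAlgebra.ad ℂ L w) ^ n) y := by
    intro n
    induction n with
    | zero => intro y; rfl
    | succ n ih =>
      intro y
      rw [pow_succ, pow_succ, Module.End.mul_apply, Module.End.mul_apply, ih]
      rfl
  apply Subtype.ext
  apply Subtype.ext
  rw [key, hk]
  rfl

/-- `ad y` preserves each ideal `N.lcs C j` and `ad n` moves it into the next one, so the `j`-th
power of the product lands in `N.lcs C j`. This series dies out because `N` is nilpotent. -/
theorem exists_pow_ad_comp_ad_eq_zero {C : Type} [LieRing C] [LieAlgebra ℂ C]
    (N : LieIdeal ℂ C) (hN : LieRing.IsNilpotent N) {n : C} (hn : n ∈ N) (y : C) :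
    ∃ k, ((LieAlgebra.ad ℂ C n) * (LieAlgebra.ad ℂ C y)) ^ k = 0 := by
  obtain ⟨k, hk⟩ := (LieModule.isNilpotent_iff ℂ N N).1 hN
  -- The index is shifted because `N.lcs C` starts from all of `C`: one bracket with `N` is needed
  -- to land in `N`, after which the lower central series of `N` bounds it.
  have hle : ∀ k, N.lcs C (k + 1) ≤ N ∧
      ∀ w : N, (w : C) ∈ N.lcs C (k + 1) → w ∈ LieModule.lowerCentralSeries ℂ N N k := by
    intro k
    have h1 : N.lcs C 1 ≤ N := by
      rw [LieIdeal.lcs_succ]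
      exact LieSubmodule.lie_le_left _ _
    induction k with
    | zero => exact ⟨h1, fun w _ => by simp⟩
    | succ k ih =>
      have h2 : N.lcs C (k + 2) ≤ N := by
        rw [LieIdeal.lcs_succ]
        exact LieSubmodule.lie_le_left _ _
      refine ⟨h2, fun w hw => ?_⟩
      rw [LieIdeal.lcs_succ] at hw
      have hw' : (w : C) ∈ (LieSubmodule.toSubmodule ⁅N, N.lcs C (k + 1)⁆) := hw
      rw [LieSubmodule.lieIdeal_oper_eq_linear_span'] at hw'
      suffices h : (w : C) ∈ (LieModule.lowerCentralSeries ℂ N N (k + 1)).toSubmodule.map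
          N.toSubmodule.subtype by
        obtain ⟨w', hw', e⟩ := h
        have : w' = w := Subtype.ext e
        exact this ▸ hw'
      refine Submodule.span_le.2 ?_ hw'
      rintro _ ⟨a, ha, b, hb, rfl⟩
      have hbN := ih.1 hb
      refine ⟨⁅(⟨a, ha⟩ : N), (⟨b, hbN⟩ : N)⁆, ?_, rfl⟩
      change _ ∈ LieModule.lowerCentralSeries ℂ N N (k + 1)
      rw [LieModule.lowerCentralSeries_succ]
      exact LieSubmodule.lie_mem_lie (LieSubmodule.mem_top _) (ih.2 ⟨b, hbN⟩ hb)
  have hpow : ∀ j (v : C), (((LieAlgebra.ad ℂ C n) * (LieAlgebra.ad ℂ C y)) ^ j) v ∈ N.lcs C j := by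
    intro j
    induction j with
    | zero => intro v; simp
    | succ j ih =>
      intro v
      rw [pow_succ', Module.End.mul_apply, Module.End.mul_apply, LieIdeal.lcs_succ]
      exact LieSubmodule.lie_mem_lie hn (LieSubmodule.lie_mem _ (ih v))
  refine ⟨k + 1, LinearMap.ext fun v => ?_⟩
  have h := hpow (k + 1) v
  have h3 := (hle k).2 ⟨_, (hle k).1 h⟩ h
  have h4 := (le_of_eq hk) h3
  exact congrArg Subtype.val ((LieSubmodule.mem_bot _).1 h4)

/-- `xᵏ` embeds `ker xᵏ⁺¹ / ker xᵏ` in `ker x` compatibly with `f`, so `f ^ m` lowers the kernel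
filtration of `x` by one step. That filtration exhausts the space when `x` is nilpotent. -/
theorem isNilpotent_of_isNilpotent_on_ker {V : Type*} [AddCommGroup V] [Module ℂ V]
    (x f : Module.End ℂ V) (hx : IsNilpotent x) (hcomm : Commute x f) (m : ℕ)
    (hm : ∀ v, x v = 0 → (f ^ m) v = 0) : IsNilpotent f := by
  obtain ⟨n, hn⟩ := hx
  have key : ∀ k v, (x ^ k) v = 0 → (f ^ (m * k)) v = 0 := by
    intro k
    induction k with
    | zero => intro v hv; simpa using hv
    | succ k ih =>
      intro v hv
      rw [mul_add, mul_one, pow_add, Module.End.mul_apply]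
      apply ih
      rw [← Module.End.mul_apply, (hcomm.pow_pow k m).eq, Module.End.mul_apply]
      apply hm
      rw [← Module.End.mul_apply, ← pow_succ', hv]
  exact ⟨m * n, LinearMap.ext fun v => key n v (by rw [hn]; rfl)⟩

variable [LieAlgebra.IsKilling ℂ L]

/-- Invariance and nondegeneracy of the Killing form show that the kernel is the orthogonal of the
range; taking orthogonals once more gives the claim. -/
theorem range_ad_eq_orthogonal (X : L) : LinearMap.range (LieAlgebra.ad ℂ L X) =
    (killingForm ℂ L).orthogonal (LinearMap.ker (LieAlgebra.ad ℂ L X)) := by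
  have hnd := LieAlgebra.IsKilling.killingForm_nondegenerate ℂ L
  have hrefl : (killingForm ℂ L).IsRefl := (LieModule.traceForm_isSymm ℂ L L).isRefl
  have h : LinearMap.ker (LieAlgebra.ad ℂ L X) =
      (killingForm ℂ L).orthogonal (LinearMap.range (LieAlgebra.ad ℂ L X)) := by
    ext v
    rw [mem_ker_ad, LinearMap.BilinForm.mem_orthogonal_iff]
    have hinv : ∀ y, killingForm ℂ L ⁅X, y⁆ v = killingForm ℂ L y ⁅v, X⁆ := by
      intro y
      have h := LieModule.traceForm_apply_lie_apply ℂ L L y X v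
      rw [← lie_skew, map_neg, LinearMap.neg_apply, ← lie_skew v X, map_neg]
      exact congrArg Neg.neg h
    constructor
    · rintro hv _ ⟨y, rfl⟩
      change killingForm ℂ L ⁅X, y⁆ v = 0
      rw [hinv, hv, map_zero]
    · intro hv
      apply hnd.2
      intro y
      rw [← hinv]
      exact hv _ ⟨y, rfl⟩
  rw [h, LinearMap.BilinForm.orthogonal_orthogonal hnd hrefl]

theorem mem_range_ad_iff {X v : L} : (∃ w, ⁅X, w⁆ = v) ↔
    ∀ y, ⁅y, X⁆ = 0 → LinearMap.trace ℂ L (LieAlgebra.ad ℂ L y * LieAlgebra.ad ℂ L v) = 0 := by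
  have h := range_ad_eq_orthogonal X
  have h2 : (∃ w, ⁅X, w⁆ = v) ↔ v ∈ LinearMap.range (LieAlgebra.ad ℂ L X) := Iff.rfl
  rw [h2, h, LinearMap.BilinForm.mem_orthogonal_iff]
  simp only [mem_ker_ad]
  rfl

/-- A nilpotent element `X` of a Killing Lie algebra lies in `[X, L]`. -/
theorem mem_range_ad_self {X : L} (hX : IsNilpotent (LieAlgebra.ad ℂ L X)) :
    ∃ h, ⁅X, h⁆ = X := by
  rw [mem_range_ad_iff]
  intro y hy
  have hc := commute_ad hy
  exact (LinearMap.isNilpotent_trace_of_isNilpotent (hc.isNilpotent_mul_left hX)).eq_zero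

/-- By the trace criterion for the range of `ad X`, it suffices that `ad n ad y` be nilpotent on `L`
for `y` in the centralizer. It is nilpotent on the centralizer, which is `ker (ad X)`, and it
commutes with the nilpotent `ad X`. -/
theorem le_stabilizerInfRange {X : L} (hX : IsNilpotent (LieAlgebra.ad ℂ L X))
    (N : LieIdeal ℂ (stabilizer L X)) (hN : LieRing.IsNilpotent N) : N ≤ stabilizerInfRange X := by
  intro n hn
  rw [mem_stabilizerInfRange, mem_range_ad_iff]
  intro y hy
  rw [LinearMap.trace_mul_comm]
  obtain ⟨m, hm⟩ := exists_pow_ad_comp_ad_eq_zero N hN hn ⟨y, hy⟩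
  have key : ∀ k (v : stabilizer L X),
      ((((LieAlgebra.ad ℂ (stabilizer L X) n) * (LieAlgebra.ad ℂ (stabilizer L X) ⟨y, hy⟩)) ^ k)
        v : L) = ((LieAlgebra.ad ℂ L n * LieAlgebra.ad ℂ L y) ^ k) v := by
    intro k
    induction k with
    | zero => intro v; rfl
    | succ k ih =>
      intro v
      rw [pow_succ, pow_succ, Module.End.mul_apply, Module.End.mul_apply, ih]
      rfl
  have hnil : IsNilpotent (LieAlgebra.ad ℂ L n * LieAlgebra.ad ℂ L y) := by
    refine isNilpotent_of_isNilpotent_on_ker _ _ hX 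
      ((commute_ad n.2).symm.mul_right (commute_ad hy).symm) m ?_
    intro v hv
    have hv' : v ∈ stabilizer L X := by
      rw [mem_stabilizer, ← lie_skew, neg_eq_zero]; exact hv
    have h := key m ⟨v, hv'⟩
    rw [hm] at h
    exact h.symm
  exact (LinearMap.isNilpotent_trace_of_isNilpotent hnil).eq_zero

theorem nilpotentRadical_stabilizer {X : L} (hX : IsNilpotent (LieAlgebra.ad ℂ L X)) :
    nilpotentRadical (stabilizer L X) = stabilizerInfRange X :=
  le_antisymm (sSup_le fun N hN => le_stabilizerInfRange hX N hN)
    (le_sSup (isNilpotent_stabilizerInfRange X))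

/-- Rank-nullity for `xᵏ`, which maps `ker xᵏ⁺¹` onto `ker x ∩ im xᵏ` with kernel `ker xᵏ`. -/
theorem finrank_ker_inf_range {V : Type*} [AddCommGroup V] [Module ℂ V] [FiniteDimensional ℂ V]
    (x : Module.End ℂ V) (k : ℕ) :
    Module.finrank ℂ (LinearMap.ker (x ^ (k + 1))) =
      Module.finrank ℂ (LinearMap.ker x ⊓ LinearMap.range (x ^ k) : Submodule ℂ V)
        + Module.finrank ℂ (LinearMap.ker (x ^ k)) := by
  have hmaps : ∀ v ∈ LinearMap.ker (x ^ (k + 1)), (x ^ k) v ∈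
      (LinearMap.ker x ⊓ LinearMap.range (x ^ k) : Submodule ℂ V) := by
    intro v hv
    refine ⟨?_, v, rfl⟩
    rw [SetLike.mem_coe, LinearMap.mem_ker, ← Module.End.mul_apply, ← pow_succ']
    exact hv
  let f := (x ^ k).restrict hmaps
  have h := LinearMap.finrank_range_add_finrank_ker f
  have h1 : LinearMap.range f = ⊤ := by
    rw [LinearMap.range_eq_top]
    rintro ⟨_, hw, v, rfl⟩
    refine ⟨⟨v, ?_⟩, rfl⟩
    rw [LinearMap.mem_ker, pow_succ', Module.End.mul_apply]
    exact hw
  have h2 : LinearMap.ker f = (LinearMap.ker (x ^ k)).comap (LinearMap.ker (x ^ (k + 1))).subtype := by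
    ext v
    rw [LinearMap.mem_ker, ← Subtype.coe_inj]
    rfl
  have h3 : LinearMap.ker (x ^ k) ≤ LinearMap.ker (x ^ (k + 1)) := by
    intro v hv
    rw [LinearMap.mem_ker, pow_succ', Module.End.mul_apply, LinearMap.mem_ker.1 hv, map_zero]
  rw [h1, finrank_top, h2, (Submodule.comapSubtypeEquivOfLe h3).finrank_eq] at h
  exact h.symm

/-- The case `k = 1` of `finrank_ker_inf_range`. It trades the radical for kernels of powers of `ad
X`, which are orbit invariants and additive over direct sums. -/
theorem finrank_nilpotentRadical {X : L} (hX : IsNilpotent (LieAlgebra.ad ℂ L X)) :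
    Module.finrank ℂ (LinearMap.ker (LieAlgebra.ad ℂ L X ^ 2)) =
      Module.finrank ℂ (nilpotentRadical (stabilizer L X))
        + Module.finrank ℂ (LinearMap.ker (LieAlgebra.ad ℂ L X)) := by
  have h := finrank_ker_inf_range (LieAlgebra.ad ℂ L X) 1
  rw [nilpotentRadical_stabilizer hX]
  rw [pow_one] at h
  rw [h]
  congr 1
  have hS : (stabilizerInfRange X).toSubmodule.map (stabilizer L X).toSubmodule.subtype =
      LinearMap.ker (LieAlgebra.ad ℂ L X) ⊓ LinearMap.range (LieAlgebra.ad ℂ L X) := by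
    ext v
    constructor
    · rintro ⟨⟨w, hw⟩, ⟨u, hu⟩, rfl⟩
      exact ⟨mem_ker_ad.2 hw, u, hu⟩
    · rintro ⟨h1, u, hu⟩
      exact ⟨⟨v, mem_ker_ad.1 h1⟩, ⟨u, hu⟩, rfl⟩
  rw [← hS]
  exact (LinearEquiv.finrank_eq (Submodule.equivMapOfInjective _
    (Submodule.injective_subtype _) _)).symm

end

end

/-! ### Weights of `sl₂`-triples determined by the kernels of the powers of `x` -/

section
/-- The relations of an `sl₂`-triple for endomorphisms; the zero triple is allowed. -/
structure IsEndTriple {V : Type*} [AddCommGroup V] [Module ℂ V] (x y h : Module.End ℂ V) :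
    Prop where
  lie_h_x : h * x - x * h = (2 : ℂ) • x
  lie_h_y : h * y - y * h = -((2 : ℂ) • y)
  lie_x_y : x * y - y * x = h

namespace IsEndTriple

open Module

variable {V : Type*} [AddCommGroup V] [Module ℂ V] {x y h : End ℂ V}

theorem h_x (t : IsEndTriple x y h) (v : V) : h (x v) = x (h v) + (2 : ℂ) • x v := by
  have := congrArg (fun f : End ℂ V => f v) t.lie_h_x
  exact eq_add_of_sub_eq' this

theorem h_y (t : IsEndTriple x y h) (v : V) : h (y v) = y (h v) - (2 : ℂ) • y v := by
  have := congrArg (fun f : End ℂ V => f v) t.lie_h_y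
  rw [sub_eq_add_neg]
  exact eq_add_of_sub_eq' this

theorem x_y (t : IsEndTriple x y h) (v : V) : x (y v) = y (x v) + h v := by
  have := congrArg (fun f : End ℂ V => f v) t.lie_x_y
  exact eq_add_of_sub_eq' this

/-- The standard relation `[xᵏ⁺¹, y] = (k + 1)(h - k) xᵏ`, from which all the facts on weights below
follow. -/
theorem x_pow_succ_y (t : IsEndTriple x y h) (k : ℕ) (v : V) :
    (x ^ (k + 1)) (y v) = y ((x ^ (k + 1)) v) + ((k : ℂ) + 1) • (h ((x ^ k) v) - (k : ℂ) • (x ^ k) v) := by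
  induction k with
  | zero => simp [t.x_y]
  | succ k ih =>
    have pw : ∀ (k : ℕ) (v : V), (x ^ (k + 1)) v = x ((x ^ k) v) := fun k v => by
      rw [pow_succ', Module.End.mul_apply]
    have e := t.h_x ((x ^ k) v)
    rw [pw (k + 1), ih, map_add, map_smul, map_sub, map_smul, t.x_y, pw (k + 1) v, pw k v, e]
    push_cast
    module

/-- Transposition reverses products, hence the sign on `h`. Passing to the dual space negates the
weights, so that the negative ones reduce to the positive ones. -/
theorem dualMap (t : IsEndTriple x y h) :
    IsEndTriple (V := Dual ℂ V) x.dualMap y.dualMap (-h.dualMap) where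
  lie_h_x := by
    ext f v
    have := congrArg f (t.h_x v)
    simp at this ⊢
    rw [this]; ring
  lie_h_y := by
    ext f v
    have := congrArg f (t.h_y v)
    simp at this ⊢
    rw [this]; ring
  lie_x_y := by
    ext f v
    have := congrArg f (t.x_y v)
    simp at this ⊢
    rw [this]; ring

variable [FiniteDimensional ℂ V]

/-- `x = [x, -h/2]` is a commutator that commutes with `x`. -/
theorem isNilpotent (t : IsEndTriple x y h) : IsNilpotent x := by
  refine isNilpotent_commutator x (-((1 / 2 : ℂ) • h)) x ?_ rfl
  have e := t.lie_h_x
  rw [mul_neg, neg_mul, mul_smul_comm, smul_mul_assoc, sub_neg_eq_add, add_comm,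
    ← sub_eq_add_neg, ← smul_sub, e, smul_smul]
  norm_num

/-- If `v = xᵏ u` is killed by `x`, then `xᵏ⁺¹ y u = (k + 1)(h - k) v`. Thus `h` acts as the scalar
`k` on the `k`-th step of the filtration of `ker x` by the `im xᵏ`. -/
theorem sub_mem_range (t : IsEndTriple x y h) {k : ℕ} {v : V} (hv : x v = 0)
    (hk : v ∈ LinearMap.range (x ^ k)) : h v - (k : ℂ) • v ∈ LinearMap.range (x ^ (k + 1)) := by
  obtain ⟨u, rfl⟩ := hk
  have e := t.x_pow_succ_y k u
  rw [show (x ^ (k + 1)) u = 0 by rw [pow_succ', Module.End.mul_apply, hv], map_zero, zero_add] at e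
  refine ⟨((k : ℂ) + 1)⁻¹ • y u, ?_⟩
  rw [map_smul, e, smul_smul, inv_mul_cancel₀ (Nat.cast_add_one_ne_zero k), one_smul]

theorem x_h_of_ker (t : IsEndTriple x y h) {v : V} (hv : x v = 0) : x (h v) = 0 := by
  have e := t.h_x v
  rw [hv, map_zero, smul_zero, add_zero] at e
  exact e.symm

theorem range_pow_succ_le (k : ℕ) : LinearMap.range (x ^ (k + 1)) ≤ LinearMap.range (x ^ k) := by
  rintro _ ⟨u, rfl⟩
  exact ⟨x u, by rw [pow_succ, Module.End.mul_apply]⟩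

/-- By `sub_mem_range`, `(μ - j) v` lies one range deeper than `v`, so `v` goes down the filtration
as long as `μ ≠ j`. -/
theorem mem_range_pow_of_eigen (t : IsEndTriple x y h) {μ : ℂ} {v : V} (hv : x v = 0)
    (hμ : h v = μ • v) (k : ℕ) (hk : ∀ j : ℕ, j < k → μ ≠ j) : v ∈ LinearMap.range (x ^ k) := by
  induction k with
  | zero => exact ⟨v, rfl⟩
  | succ k ih =>
    have e := t.sub_mem_range hv (ih fun j hj => hk j (hj.trans (Nat.lt_succ_self k)))
    rw [hμ, ← sub_smul] at e
    have hne : μ - k ≠ 0 := sub_ne_zero.2 (hk k (Nat.lt_succ_self k))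
    exact (Submodule.smul_mem_iff _ hne).1 e

/-- Beyond index `i` the scalars `i - (i + 1 + k)` never vanish, so `v` lies in the range of every
power of the nilpotent `x`. -/
theorem eq_zero_of_eigen (t : IsEndTriple x y h) {i : ℕ} {v : V} (hv : x v = 0)
    (hi : h v = (i : ℂ) • v) (hr : v ∈ LinearMap.range (x ^ (i + 1))) : v = 0 := by
  have key : ∀ k, v ∈ LinearMap.range (x ^ (i + 1 + k)) := by
    intro k
    induction k with
    | zero => exact hr
    | succ k ih =>
      have e := t.sub_mem_range hv ih
      rw [hi, ← sub_smul] at e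
      refine (Submodule.smul_mem_iff _ (sub_ne_zero.2 fun hne => ?_)).1 e
      have := Nat.cast_injective hne
      omega
  obtain ⟨n, hn⟩ := t.isNilpotent
  obtain ⟨u, hu⟩ := key n
  rw [pow_add, hn, mul_zero] at hu
  exact hu.symm

/-- `h - i` maps `F` into `F'` and is injective, hence bijective, on `F'`; its kernel `E` in `ker x`
is therefore a complement of `F'` in `F`. -/
theorem finrank_ker_inf_eigenspace (t : IsEndTriple x y h) (i : ℕ) :
    finrank ℂ (LinearMap.ker x ⊓ LinearMap.range (x ^ i) : Submodule ℂ V) =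
      finrank ℂ (LinearMap.ker x ⊓ End.eigenspace h (i : ℂ) : Submodule ℂ V)
      + finrank ℂ (LinearMap.ker x ⊓ LinearMap.range (x ^ (i + 1)) : Submodule ℂ V) := by
  set F := (LinearMap.ker x ⊓ LinearMap.range (x ^ i) : Submodule ℂ V)
  set F' := (LinearMap.ker x ⊓ LinearMap.range (x ^ (i + 1)) : Submodule ℂ V)
  set E := (LinearMap.ker x ⊓ End.eigenspace h (i : ℂ) : Submodule ℂ V)
  have hinf : E ⊓ F' = ⊥ := by
    rw [eq_bot_iff]
    rintro v ⟨⟨hv, he⟩, -, hr⟩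
    exact t.eq_zero_of_eigen hv (End.mem_eigenspace_iff.1 he) hr
  have hmaps : ∀ v ∈ F', (h - algebraMap ℂ (End ℂ V) i) v ∈ F' := by
    rintro v ⟨hv, hr⟩
    have hx := t.x_h_of_ker hv
    rw [LinearMap.sub_apply, Module.algebraMap_end_apply]
    refine ⟨?_, ?_⟩
    · rw [SetLike.mem_coe, LinearMap.mem_ker, map_sub, map_smul, LinearMap.mem_ker.1 hv, hx,
        smul_zero, sub_zero]
    · have e := range_pow_succ_le _ (t.sub_mem_range hv hr)
      -- `h - i = (h - (i + 1)) + 1`, and `h - (i + 1)` sends `F'` into the range of `x ^ (i + 2)`.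
      have e2 := Submodule.add_mem _ e (Submodule.smul_mem _ (((i + 1 : ℕ) : ℂ) - i) hr)
      convert! e2 using 1
      module
  have hsup : E ⊔ F' = F := by
    apply le_antisymm
    · refine sup_le ?_ ?_
      · rintro v ⟨hv, he⟩
        refine ⟨hv, t.mem_range_pow_of_eigen hv (End.mem_eigenspace_iff.1 he) i ?_⟩
        intro j hj hij
        exact hj.ne' (Nat.cast_injective hij)
      · rintro v ⟨hv, hr⟩
        exact ⟨hv, range_pow_succ_le _ hr⟩
    · rintro v ⟨hv, hr⟩
      let f := (h - algebraMap ℂ (End ℂ V) i).restrict hmaps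
      have hinj : Function.Injective f := by
        rw [← LinearMap.ker_eq_bot, eq_bot_iff]
        intro u hu
        have hu' := congrArg Subtype.val (LinearMap.mem_ker.1 hu)
        change h u - (i : ℂ) • (u : V) = 0 at hu'
        exact Subtype.ext (t.eq_zero_of_eigen u.2.1 (sub_eq_zero.1 hu') u.2.2)
      have hsurj := LinearMap.surjective_of_injective hinj
      have hx := t.x_h_of_ker hv
      -- Choose `u ∈ F'` with `(h - i) u = (h - i) v`; then `v - u` is the component in `E`.
      obtain ⟨u, hu⟩ := hsurj ⟨h v - (i : ℂ) • v, by
        rw [SetLike.mem_coe, LinearMap.mem_ker, map_sub, map_smul, LinearMap.mem_ker.1 hv, hx, smul_zero, sub_zero],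
        t.sub_mem_range hv hr⟩
      have hu' := congrArg Subtype.val hu
      change h u - (i : ℂ) • (u : V) = h v - (i : ℂ) • v at hu'
      refine Submodule.mem_sup.2 ⟨v - u, ⟨?_, ?_⟩, u, u.2, sub_add_cancel _ _⟩
      · exact Submodule.sub_mem _ hv u.2.1
      · rw [SetLike.mem_coe, End.mem_eigenspace_iff, map_sub, smul_sub]
        rw [sub_eq_sub_iff_add_eq_add] at hu' ⊢
        rw [add_comm, add_comm _ (h (u : V))]; exact (add_comm _ _).trans hu'.symm
  have e := Submodule.finrank_sup_add_finrank_inf_eq E F'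
  rw [hinf, hsup, finrank_bot, add_zero] at e
  exact e

/-- Surjectivity of `x` onto positive weight spaces, by induction on the power of `x` killing `w`:
up to a nonzero scalar, `y w` is a preimage of `w` modulo an element killed by one power less. -/
theorem exists_x_eq (t : IsEndTriple x y h) (j : ℕ) (hj : 1 ≤ j) (w : V)
    (hw : h w = (j : ℂ) • w) : ∃ u, h u = ((j : ℂ) - 2) • u ∧ x u = w := by
  have h_xpow : ∀ (k : ℕ) (w : V), h w = (j : ℂ) • w →
      h ((x ^ k) w) = ((j : ℂ) + 2 * k) • (x ^ k) w := by
    intro k w hw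
    induction k with
    | zero => simpa using hw
    | succ k ih =>
      rw [pow_succ', Module.End.mul_apply, t.h_x, ih, map_smul]
      push_cast
      module
  have key : ∀ (k : ℕ) (w : V), h w = (j : ℂ) • w → (x ^ k) w = 0 →
      ∃ u, h u = ((j : ℂ) - 2) • u ∧ x u = w := by
    intro k
    induction k with
    | zero => intro w _ h0; exact ⟨0, by simp, by rw [map_zero]; exact h0.symm⟩
    | succ k ih =>
      intro w hw h0
      -- `xᵏ w` has weight `j + 2k`, so `xᵏ⁺¹ y w = (k + 1)(j + 2k - k) xᵏ w` when `xᵏ⁺¹ w = 0`. The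
      -- factor is nonzero because `j ≥ 1`.
      set l : ℂ := ((k : ℂ) + 1) * ((j : ℂ) + k) with hl
      have hl0 : l ≠ 0 := by
        rw [hl]
        refine mul_ne_zero (Nat.cast_add_one_ne_zero k) ?_
        rw [← Nat.cast_add, Nat.cast_ne_zero]
        omega
      have hyw : h (y w) = ((j : ℂ) - 2) • y w := by
        rw [t.h_y, hw, map_smul]; module
      have e : (x ^ k) (x (y w) - l • w) = 0 := by
        have e1 := t.x_pow_succ_y k w
        rw [h0, map_zero, zero_add, h_xpow k w hw, pow_succ, Module.End.mul_apply] at e1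
        rw [map_sub, map_smul, e1, hl]
        module
      obtain ⟨u, hu, hxu⟩ := ih (x (y w) - l • w)
        (by rw [map_sub, map_smul, t.h_x, hyw, map_smul, hw]; module) e
      refine ⟨l⁻¹ • (y w - u), ?_, ?_⟩
      · rw [map_smul, map_sub, hyw, hu]; module
      · rw [map_smul, map_sub, hxu, sub_sub_cancel, smul_smul, inv_mul_cancel₀ hl0, one_smul]
  obtain ⟨n, hn⟩ := t.isNilpotent
  exact key n w hw (by rw [hn]; rfl)

/-- Rank-nullity for `x` from weight `i` to weight `i + 2`, which is onto because `i + 2 ≥ 1`. -/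
theorem finrank_eigenspace (t : IsEndTriple x y h) (i : ℕ) :
    finrank ℂ (End.eigenspace h (i : ℂ)) =
      finrank ℂ (LinearMap.ker x ⊓ End.eigenspace h (i : ℂ) : Submodule ℂ V)
      + finrank ℂ (End.eigenspace h ((i + 2 : ℕ) : ℂ)) := by
  have hmaps : ∀ v ∈ End.eigenspace h (i : ℂ), x v ∈ End.eigenspace h ((i + 2 : ℕ) : ℂ) := by
    intro v hv
    rw [End.mem_eigenspace_iff] at hv ⊢
    rw [t.h_x, hv, map_smul]
    push_cast
    module
  let f := x.restrict hmaps
  have e := LinearMap.finrank_range_add_finrank_ker f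
  have h1 : LinearMap.range f = ⊤ := by
    rw [LinearMap.range_eq_top]
    rintro ⟨w, hw⟩
    obtain ⟨u, hu, hxu⟩ := t.exists_x_eq (i + 2) (by omega) w (End.mem_eigenspace_iff.1 hw)
    refine ⟨⟨u, End.mem_eigenspace_iff.2 ?_⟩, Subtype.ext hxu⟩
    rw [hu]; push_cast; congr 1; ring
  have h2 : (LinearMap.ker f).map (End.eigenspace h (i : ℂ)).subtype =
      (LinearMap.ker x ⊓ End.eigenspace h (i : ℂ) : Submodule ℂ V) := by
    ext v
    constructor
    · rintro ⟨u, hu, rfl⟩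
      exact ⟨congrArg Subtype.val hu, u.2⟩
    · rintro ⟨hv, he⟩
      exact ⟨⟨v, he⟩, Subtype.ext hv, rfl⟩
  rw [h1, finrank_top, (Submodule.equivMapOfInjective _
    (Submodule.injective_subtype _) (LinearMap.ker f)).finrank_eq, h2] at e
  rw [← e, add_comm]

variable {V' : Type*} [AddCommGroup V'] [Module ℂ V'] [FiniteDimensional ℂ V']
  {x' y' h' : End ℂ V'}

theorem exists_eigenspace_nat_eq_bot (h : End ℂ V) :
    ∃ M : ℕ, ∀ i : ℕ, M ≤ i → End.eigenspace h (i : ℂ) = ⊥ := by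
  have hf : (Nat.cast ⁻¹' {μ : ℂ | h.HasEigenvalue μ}).Finite :=
    Set.Finite.preimage Nat.cast_injective.injOn (End.finite_hasEigenvalue h)
  obtain ⟨M, hM⟩ := hf.bddAbove
  refine ⟨M + 1, fun i hi => ?_⟩
  by_contra hne
  have : i ≤ M := hM (End.hasEigenvalue_iff.2 hne)
  omega

/-- The dimensions of the eigenspaces of `h` for nonnegative eigenvalues are determined by the
dimensions of the kernels of the powers of `x`. -/
theorem finrank_eigenspace_nat_eq (t : IsEndTriple x y h) (t' : IsEndTriple x' y' h')
    (hk : ∀ k, finrank ℂ (LinearMap.ker (x ^ k)) = finrank ℂ (LinearMap.ker (x' ^ k))) (i : ℕ) :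
    finrank ℂ (End.eigenspace h (i : ℂ)) = finrank ℂ (End.eigenspace h' (i : ℂ)) := by
  have hF : ∀ k, finrank ℂ (LinearMap.ker x ⊓ LinearMap.range (x ^ k) : Submodule ℂ V) =
      finrank ℂ (LinearMap.ker x' ⊓ LinearMap.range (x' ^ k) : Submodule ℂ V') := by
    intro k
    have e := finrank_ker_inf_range x k
    have e' := finrank_ker_inf_range x' k
    rw [hk, hk] at e
    omega
  have hK : ∀ k : ℕ, finrank ℂ (LinearMap.ker x ⊓ End.eigenspace h (k : ℂ) : Submodule ℂ V) =
      finrank ℂ (LinearMap.ker x' ⊓ End.eigenspace h' (k : ℂ) : Submodule ℂ V') := by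
    intro k
    have e := t.finrank_ker_inf_eigenspace k
    have e' := t'.finrank_ker_inf_eigenspace k
    rw [hF, hF] at e
    omega
  obtain ⟨M, hM⟩ := exists_eigenspace_nat_eq_bot h
  obtain ⟨M', hM'⟩ := exists_eigenspace_nat_eq_bot h'
  -- Descending induction on the weight: above `M + M'` both eigenspaces vanish, and `m` bounds the
  -- distance from there.
  have key : ∀ m i : ℕ, M + M' ≤ i + m →
      finrank ℂ (End.eigenspace h (i : ℂ)) = finrank ℂ (End.eigenspace h' (i : ℂ)) := by
    intro m
    induction m with
    | zero =>
      intro i hi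
      rw [hM i (by omega), hM' i (by omega), finrank_bot, finrank_bot]
    | succ m ih =>
      intro i hi
      rw [t.finrank_eigenspace, t'.finrank_eigenspace, hK, ih (i + 2) (by omega)]
  exact key (M + M') i (by omega)

theorem finrank_ker_dualMap (f : End ℂ V) :
    finrank ℂ (LinearMap.ker f.dualMap) = finrank ℂ (LinearMap.ker f) := by
  have e := LinearMap.finrank_range_add_finrank_ker f
  have e' := LinearMap.finrank_range_add_finrank_ker f.dualMap
  rw [LinearMap.finrank_range_dualMap_eq_finrank_range, Subspace.dual_finrank_eq] at e'
  omega

theorem dualMap_pow (f : End ℂ V) (k : ℕ) :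
    (f ^ k).dualMap = (f.dualMap : End ℂ (Dual ℂ V)) ^ k := by
  induction k with
  | zero => exact LinearMap.dualMap_id
  | succ k ih =>
    rw [pow_succ, pow_succ', ← ih]
    exact (LinearMap.dualMap_comp_dualMap _ _).symm

/-- `-fᵗ - μ` is minus the transpose of `f + μ`, and a transpose has a kernel of the same dimension.
-/
theorem finrank_eigenspace_neg_dualMap (f : End ℂ V) (μ : ℂ) :
    finrank ℂ (End.eigenspace (-f.dualMap : End ℂ (Dual ℂ V)) μ) =
      finrank ℂ (End.eigenspace f (-μ)) := by
  have : (-f.dualMap : End ℂ (Dual ℂ V)) - algebraMap ℂ _ μ =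
      -(f - algebraMap ℂ (End ℂ V) (-μ)).dualMap := by
    ext g v
    simp
    ring
  rw [End.eigenspace_def, End.eigenspace_def, ← Algebra.algebraMap_eq_smul_one,
    ← Algebra.algebraMap_eq_smul_one, this, ← finrank_ker_dualMap (f - _), LinearMap.ker_neg]

/-- The dimensions of the integral eigenspaces of `h` are determined by the dimensions of the
kernels of the powers of `x`. -/
theorem finrank_eigenspace_int_eq (t : IsEndTriple x y h) (t' : IsEndTriple x' y' h')
    (hk : ∀ k, finrank ℂ (LinearMap.ker (x ^ k)) = finrank ℂ (LinearMap.ker (x' ^ k))) (i : ℤ) :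
    finrank ℂ (End.eigenspace h (i : ℂ)) = finrank ℂ (End.eigenspace h' (i : ℂ)) := by
  obtain ⟨n, rfl | rfl⟩ := i.eq_nat_or_neg
  · exact_mod_cast t.finrank_eigenspace_nat_eq t' hk n
  · have e := t.dualMap.finrank_eigenspace_nat_eq t'.dualMap (fun k => by
      rw [← dualMap_pow, ← dualMap_pow, finrank_ker_dualMap, finrank_ker_dualMap, hk]) n
    rw [finrank_eigenspace_neg_dualMap, finrank_eigenspace_neg_dualMap] at e
    rwa [Int.cast_neg, Int.cast_natCast]

end IsEndTriple

end

/-! ### Exponentials act by conjugation; invariants of orbits -/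

section
section
variable {𝔸 : Type*} [NormedRing 𝔸] [NormedAlgebra ℂ 𝔸] [CompleteSpace 𝔸]

theorem exp_mulLeft_apply (a b : 𝔸) :
    NormedSpace.exp (ContinuousLinearMap.mul ℂ 𝔸 a) b = NormedSpace.exp a * b := by
  have h1 := (NormedSpace.exp_series_hasSum_exp' (𝕂 := ℂ) (ContinuousLinearMap.mul ℂ 𝔸 a)).mapL
    (ContinuousLinearMap.apply ℂ 𝔸 b)
  have h2 := (NormedSpace.exp_series_hasSum_exp' (𝕂 := ℂ) a).mul_right b
  refine h1.unique (h2.congr_fun ?_)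
  intro n
  have e : ∀ n, ((ContinuousLinearMap.mul ℂ 𝔸 a) ^ n) b = a ^ n * b := by
    intro n
    induction n with
    | zero => simp
    | succ n ih => rw [pow_succ', pow_succ', mul_apply_eq_comp, ih]; simp [mul_assoc]
  simp [e]

theorem exp_mulRight_apply (a b : 𝔸) :
    NormedSpace.exp ((ContinuousLinearMap.mul ℂ 𝔸).flip a) b = b * NormedSpace.exp a := by
  have h1 := (NormedSpace.exp_series_hasSum_exp' (𝕂 := ℂ)
    ((ContinuousLinearMap.mul ℂ 𝔸).flip a)).mapL (ContinuousLinearMap.apply ℂ 𝔸 b)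
  have h2 := (NormedSpace.exp_series_hasSum_exp' (𝕂 := ℂ) a).mul_left b
  refine h1.unique (h2.congr_fun ?_)
  intro n
  have e : ∀ n, (((ContinuousLinearMap.mul ℂ 𝔸).flip a) ^ n) b = b * a ^ n := by
    intro n
    induction n with
    | zero => simp
    | succ n ih =>
      rw [pow_succ', pow_succ, mul_apply_eq_comp, ih]; simp [mul_assoc]
  simp [e]

/-- `exp (ad a) b = exp(a) b exp(-a)`. -/
theorem hasSum_exp_conj (a b : 𝔸) :
    HasSum (fun n : ℕ => ((n.factorial : ℂ)⁻¹) •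
      ((LinearMap.mulLeft ℂ a - LinearMap.mulRight ℂ a : Module.End ℂ 𝔸) ^ n) b)
      (NormedSpace.exp a * b * NormedSpace.exp (-a)) := by
  set D := ContinuousLinearMap.mul ℂ 𝔸 a + (ContinuousLinearMap.mul ℂ 𝔸).flip (-a) with hD
  have h1 := (NormedSpace.exp_series_hasSum_exp' (𝕂 := ℂ) D).mapL
    (ContinuousLinearMap.apply ℂ 𝔸 b)
  -- Left and right multiplications commute by associativity, so the exponential of their sum
  -- factors.
  have hc : Commute (ContinuousLinearMap.mul ℂ 𝔸 a) ((ContinuousLinearMap.mul ℂ 𝔸).flip (-a)) := by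
    ext v
    simp [mul_assoc]
  have h2 : NormedSpace.exp D b = NormedSpace.exp a * b * NormedSpace.exp (-a) := by
    let _ : NormedAlgebra ℚ (𝔸 →L[ℂ] 𝔸) := NormedAlgebra.restrictScalars ℚ ℂ (𝔸 →L[ℂ] 𝔸)
    rw [hD, NormedSpace.exp_add_of_commute hc, mul_apply_eq_comp, exp_mulLeft_apply,
      exp_mulRight_apply, mul_assoc]
  have e : ∀ n, ((LinearMap.mulLeft ℂ a - LinearMap.mulRight ℂ a : Module.End ℂ 𝔸) ^ n) b =
      (D ^ n) b := by
    intro n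
    induction n with
    | zero => rfl
    | succ n ih =>
      rw [pow_succ', pow_succ', Module.End.mul_apply, ih, mul_apply_eq_comp]
      simp [hD, sub_eq_add_neg]
  simp only [e]
  rw [← h2]
  exact h1
end

section
variable {L : Type} [LieRing L] [LieAlgebra ℂ L] {V : Type*} [AddCommGroup V] [Module ℂ V]
  [FiniteDimensional ℂ V]

open scoped Matrix.Norms.Operator in
-- `ρ` intertwines `ad z` with the commutator with `ρ z`, hence `ρ (φ X) = exp (ρ z) ρ X exp (-ρ z)`
-- and `g = exp (ρ z)`. Matrices provide the norm in which the series converges.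
theorem IsExp.exists_conj {ρ : L →ₗ[ℂ] Module.End ℂ V}
    (hρ : ∀ x y, ρ ⁅x, y⁆ = ρ x * ρ y - ρ y * ρ x) {z : L} {φ : Module.End ℂ L}
    (h : IsExp (LieAlgebra.ad ℂ L z) φ) :
    ∃ g : V ≃ₗ[ℂ] V, ∀ X v, ρ (φ X) (g v) = g (ρ X v) := by
  classical
  let b := Module.finBasis ℂ V
  let n := Module.finrank ℂ V
  let e : Module.End ℂ V ≃ₐ[ℂ] Matrix (Fin n) (Fin n) ℂ := LinearMap.toMatrixAlgEquiv b
  let a := e (ρ z)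
  have hpow : ∀ k X, e (ρ ((LieAlgebra.ad ℂ L z ^ k) X)) =
      ((LinearMap.mulLeft ℂ a - LinearMap.mulRight ℂ a : Module.End ℂ _) ^ k) (e (ρ X)) := by
    intro k X
    induction k with
    | zero => rfl
    | succ k ih =>
      rw [pow_succ', pow_succ', Module.End.mul_apply, Module.End.mul_apply, ← ih,
        LieAlgebra.ad_apply, hρ, map_sub, map_mul, map_mul]
      rfl
  have hφ : ∀ X, e (ρ (φ X)) = NormedSpace.exp a * e (ρ X) * NormedSpace.exp (-a) := by
    intro X
    have h1 := hasSum_exp_conj a (e (ρ X))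
    ext i j
    -- `IsExp` gives convergence against linear forms only; the matrix entries of `ρ` are such
    -- forms.
    have h2 := h X ((Matrix.entryLinearMap ℂ ℂ i j) ∘ₗ e.toLinearMap ∘ₗ ρ)
    refine h2.unique ?_
    have h3 := (Pi.hasSum.1 ((Pi.hasSum.1 h1) i)) j
    refine h3.congr_fun fun k => ?_
    rw [← hpow]
    rfl
  have hinv : NormedSpace.exp (-a) * NormedSpace.exp a = 1 := by
    rw [← Matrix.exp_add_of_commute (-a) a (Commute.refl a).neg_left, neg_add_cancel, NormedSpace.exp_zero]
  have hinv' : NormedSpace.exp a * NormedSpace.exp (-a) = 1 := by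
    rw [← Matrix.exp_add_of_commute a (-a) (Commute.refl a).neg_right, add_neg_cancel,
      NormedSpace.exp_zero]
  let g := e.symm (NormedSpace.exp a)
  let g' := e.symm (NormedSpace.exp (-a))
  have hg : g' * g = 1 := by rw [← map_mul, hinv, map_one]
  have hg' : g * g' = 1 := by rw [← map_mul, hinv', map_one]
  refine ⟨LinearEquiv.ofLinearMap g g' hg' hg, fun X v => ?_⟩
  have hX : ρ (φ X) * g = g * ρ X := by
    apply e.injective
    rw [map_mul, map_mul, hφ, e.apply_symm_apply, mul_assoc, hinv, mul_one]
  exact congrArg (fun f : Module.End ℂ V => f v) hX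

theorem exists_conj_of_mem_adjointGroup {ρ : L →ₗ[ℂ] Module.End ℂ V}
    (hρ : ∀ x y, ρ ⁅x, y⁆ = ρ x * ρ y - ρ y * ρ x) {φ : L ≃ₗ[ℂ] L} (h : φ ∈ adjointGroup L) :
    ∃ g : V ≃ₗ[ℂ] V, ∀ X v, ρ (φ X) (g v) = g (ρ X v) := by
  induction h using Subgroup.closure_induction with
  | mem φ hφ =>
    obtain ⟨-, z, hz⟩ := hφ
    exact hz.exists_conj hρ
  | one => exact ⟨LinearEquiv.refl ℂ V, fun X v => rfl⟩
  | mul φ ψ _ _ h1 h2 =>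
    obtain ⟨g, hg⟩ := h1
    obtain ⟨g', hg'⟩ := h2
    exact ⟨g'.trans g, fun X v => (hg _ _).trans (congrArg g (hg' X v))⟩
  | inv φ _ h1 =>
    obtain ⟨g, hg⟩ := h1
    refine ⟨g.symm, fun X v => ?_⟩
    apply g.injective
    rw [← hg, g.apply_symm_apply, g.apply_symm_apply]
    congr 1
    exact congrArg ρ (φ.apply_symm_apply X)

theorem map_lie_of_mem_adjointGroup {φ : L ≃ₗ[ℂ] L} (h : φ ∈ adjointGroup L) (x y : L) :
    φ ⁅x, y⁆ = ⁅φ x, φ y⁆ := by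
  induction h using Subgroup.closure_induction generalizing x y with
  | mem φ hφ => exact hφ.1 x y
  | one => rfl
  | mul φ ψ _ _ h1 h2 => exact (congrArg φ (h2 x y)).trans (h1 _ _)
  | inv φ _ h1 =>
    apply φ.injective
    rw [h1]
    exact (φ.apply_symm_apply _).trans
      (congrArg₂ Bracket.bracket (φ.apply_symm_apply x) (φ.apply_symm_apply y)).symm

theorem ker_pow_conj {V : Type*} [AddCommGroup V] [Module ℂ V] {f f' : Module.End ℂ V}
    (g : V ≃ₗ[ℂ] V) (h : ∀ v, f' (g v) = g (f v)) (k : ℕ) :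
    Module.finrank ℂ (LinearMap.ker (f' ^ k)) = Module.finrank ℂ (LinearMap.ker (f ^ k)) := by
  have hk : ∀ v, (f' ^ k) (g v) = g ((f ^ k) v) := by
    induction k with
    | zero => intro v; rfl
    | succ k ih => intro v; rw [pow_succ, pow_succ, Module.End.mul_apply, h, ih]; rfl
  have : LinearMap.ker (f' ^ k) = (LinearMap.ker (f ^ k)).map (g : V →ₗ[ℂ] V) := by
    ext v
    constructor
    · intro hv
      refine ⟨g.symm v, ?_, g.apply_symm_apply v⟩
      apply g.injective
      rw [← hk, g.apply_symm_apply, hv, map_zero]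
    · rintro ⟨u, hu, rfl⟩
      exact (hk u).trans (by rw [hu, map_zero])
  rw [this]
  exact LinearEquiv.finrank_map_eq g _

/-- Elements of one orbit have conjugate images in every representation. -/
theorem finrank_ker_pow_of_mem_adjointOrbit {ρ : L →ₗ[ℂ] Module.End ℂ V}
    (hρ : ∀ x y, ρ ⁅x, y⁆ = ρ x * ρ y - ρ y * ρ x) {X X' : L} (h : X' ∈ adjointOrbit X) (k : ℕ) :
    Module.finrank ℂ (LinearMap.ker (ρ X' ^ k)) = Module.finrank ℂ (LinearMap.ker (ρ X ^ k)) := by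
  obtain ⟨φ, hφ, rfl⟩ := h
  obtain ⟨g, hg⟩ := exists_conj_of_mem_adjointGroup hρ hφ
  exact ker_pow_conj g (hg X) k

theorem isNilpotent_ad_of_mem_adjointOrbit {X X' : L} (h : X' ∈ adjointOrbit X)
    (hX : IsNilpotent (LieAlgebra.ad ℂ L X)) : IsNilpotent (LieAlgebra.ad ℂ L X') := by
  obtain ⟨φ, hφ, rfl⟩ := h
  obtain ⟨n, hn⟩ := hX
  have hk : ∀ k v, (LieAlgebra.ad ℂ L (φ X) ^ k) (φ v) = φ ((LieAlgebra.ad ℂ L X ^ k) v) := by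
    intro k
    induction k with
    | zero => intro v; rfl
    | succ k ih =>
      intro v
      rw [pow_succ, pow_succ, Module.End.mul_apply, LieAlgebra.ad_apply,
        ← map_lie_of_mem_adjointGroup hφ, ih]
      rfl
  refine ⟨n, LinearMap.ext fun v => ?_⟩
  rw [← φ.apply_symm_apply v, hk, hn]
  exact map_zero φ

/-- For the adjoint representation the conjugating map is the automorphism `φ` itself. -/
theorem finrank_ker_ad_pow_of_mem_adjointOrbit {X X' : L} (h : X' ∈ adjointOrbit X) (k : ℕ) :
    Module.finrank ℂ (LinearMap.ker (LieAlgebra.ad ℂ L X' ^ k)) =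
      Module.finrank ℂ (LinearMap.ker (LieAlgebra.ad ℂ L X ^ k)) := by
  obtain ⟨φ, hφ, rfl⟩ := h
  refine ker_pow_conj φ (fun v => ?_) k
  exact (map_lie_of_mem_adjointGroup hφ X v).symm
end

end

/-! ### Positive Hermitian forms and nondegeneracy of the Killing form -/

section
open Module

/-- Positive definite Hermitian forms. -/
structure IsPosHerm {V : Type*} [AddCommGroup V] [Module ℂ V] (h : V →ₗ⋆[ℂ] V →ₗ[ℂ] ℂ) :
    Prop where
  symm : ∀ u v, star (h u v) = h v u
  pos : ∀ v, v ≠ 0 → 0 < (h v v).re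

namespace IsPosHerm

variable {V : Type*} [AddCommGroup V] [Module ℂ V] {h : V →ₗ⋆[ℂ] V →ₗ[ℂ] ℂ}

theorem nonneg (H : IsPosHerm h) (v : V) : 0 ≤ (h v v).re := by
  by_cases hv : v = 0
  · simp [hv]
  · exact (H.pos v hv).le

theorem eq_zero (H : IsPosHerm h) {v : V} (hv : h v v = 0) : v = 0 := by
  by_contra hne
  have := H.pos v hne
  rw [hv] at this
  exact lt_irrefl _ this

variable [FiniteDimensional ℂ V]

theorem exists_orthonormal (H : IsPosHerm h) :
    ∃ (n : ℕ) (b : Basis (Fin n) ℂ V), ∀ i j, h (b i) (b j) = if i = j then 1 else 0 := by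
  let core : InnerProductSpace.Core ℂ V :=
    { inner := fun u v => h u v
      conj_inner_symm := fun u v => H.symm v u
      re_inner_nonneg := fun v => H.nonneg v
      add_left := fun u v w => by simp
      smul_left := fun u v c => by simp
      definite := fun v hv => H.eq_zero hv }
  let _ : NormedAddCommGroup V := core.toNormedAddCommGroup
  let _ : InnerProductSpace ℂ V := InnerProductSpace.ofCore core.toCore
  let b := stdOrthonormalBasis ℂ V
  refine ⟨_, b.toBasis, fun i j => ?_⟩
  have := orthonormal_iff_ite.1 b.orthonormal i j
  rw [b.coe_toBasis]
  exact this

/-- In an orthonormal basis the diagonal entries of `S T'` are `h (bᵢ) (S T' bᵢ) = h (T bᵢ) (T'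
bᵢ)`, as `S` is the adjoint of `T`. -/
theorem trace_mul_eq (H : IsPosHerm h) : ∃ (n : ℕ) (b : Basis (Fin n) ℂ V),
    ∀ T S T' : End ℂ V, (∀ u v, h (T u) v = h u (S v)) →
      LinearMap.trace ℂ V (S * T') = ∑ i, h (T (b i)) (T' (b i)) := by
  obtain ⟨n, b, hb⟩ := H.exists_orthonormal
  have hrepr : ∀ v i, b.repr v i = h (b i) v := by
    intro v i
    have e : h (b i) (∑ j, b.repr v j • b j) = b.repr v i := by
      rw [map_sum]
      simp [hb]
    rw [← e, b.sum_repr]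
  refine ⟨n, b, fun T S T' hTS => ?_⟩
  rw [LinearMap.trace_eq_matrix_trace ℂ b, Matrix.trace]
  refine Finset.sum_congr rfl fun i _ => ?_
  rw [Matrix.diag_apply, LinearMap.toMatrix_apply, hrepr, hTS, Module.End.mul_apply]

theorem trace_adjoint_pos (H : IsPosHerm h) {T S : End ℂ V} (hTS : ∀ u v, h (T u) v = h u (S v))
    (hT : T ≠ 0) : 0 < (LinearMap.trace ℂ V (S * T)).re := by
  obtain ⟨n, b, hb⟩ := H.trace_mul_eq
  rw [hb T S T hTS, Complex.re_sum]
  obtain ⟨i, hi⟩ : ∃ i, T (b i) ≠ 0 := by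
    by_contra! hne
    exact hT (b.ext hne)
  exact Finset.sum_pos' (fun i _ => H.nonneg _) ⟨i, Finset.mem_univ i, H.pos _ hi⟩

theorem star_trace (H : IsPosHerm h) {T S T' S' : End ℂ V} (hTS : ∀ u v, h (T u) v = h u (S v))
    (hTS' : ∀ u v, h (T' u) v = h u (S' v)) :
    star (LinearMap.trace ℂ V (S * T')) = LinearMap.trace ℂ V (S' * T) := by
  obtain ⟨n, b, hb⟩ := H.trace_mul_eq
  rw [hb T S T' hTS, hb T' S' T hTS', star_sum]
  exact Finset.sum_congr rfl fun i _ => H.symm _ _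

/-- Writing `w = ∑ cᵢ ⊗ bᵢ` with `bᵢ` orthonormal in the second factor gives `F w w = ∑ h cᵢ cᵢ`. -/
theorem tensor {W : Type*} [AddCommGroup W] [Module ℂ W] [FiniteDimensional ℂ W]
    {k : W →ₗ⋆[ℂ] W →ₗ[ℂ] ℂ} (H : IsPosHerm h) (K : IsPosHerm k)
    {F : (V ⊗[ℂ] W) →ₗ⋆[ℂ] (V ⊗[ℂ] W) →ₗ[ℂ] ℂ}
    (hF : ∀ a b x y, F (a ⊗ₜ x) (b ⊗ₜ y) = h a b * k x y) : IsPosHerm F where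
  symm u v := by
    induction u with
    | zero => simp
    | add u u' hu hu' => rw [map_add, LinearMap.add_apply, star_add, hu, hu', map_add]
    | tmul a x =>
      induction v with
      | zero => simp
      | add v v' hv hv' => rw [map_add, star_add, hv, hv', map_add, LinearMap.add_apply]
      | tmul b y => rw [hF, hF, star_mul', H.symm, K.symm]
  pos w hw := by
    obtain ⟨n, b, hb⟩ := K.exists_orthonormal
    obtain ⟨c, rfl⟩ := (TensorProduct.equivFinsuppOfBasisRight b (M := V)).symm.surjective w
    rw [TensorProduct.equivFinsuppOfBasisRight_symm_apply,
      Finsupp.sum_fintype c (fun i m => m ⊗ₜ[ℂ] b i) (fun i => TensorProduct.zero_tmul _ _)] at hw ⊢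
    have e : F (∑ i, c i ⊗ₜ[ℂ] b i) (∑ i, c i ⊗ₜ[ℂ] b i) = ∑ i, h (c i) (c i) := by
      simp only [map_sum, LinearMap.sum_apply, hF, hb]
      simp
    rw [e, Complex.re_sum]
    obtain ⟨i, hi⟩ : ∃ i, c i ≠ 0 := by
      by_contra! hne
      exact hw (Finset.sum_eq_zero fun i _ => by rw [hne, TensorProduct.zero_tmul])
    exact Finset.sum_pos' (fun i _ => H.nonneg _) ⟨i, Finset.mem_univ i, H.pos _ hi⟩

end IsPosHerm

/-- A Lie algebra with trivial center and an invariant form which is definite on a real form has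
non-degenerate Killing form. -/
theorem isKilling_of_isPosHerm {L : Type} [LieRing L] [LieAlgebra ℂ L] [FiniteDimensional ℂ L]
    (B : L →ₗ[ℂ] L →ₗ[ℂ] ℂ) (bar : L →ₗ⋆[ℂ] L) (hbar : ∀ x y : L, bar ⁅x, y⁆ = ⁅bar x, bar y⁆)
    (hB : ∀ x y z : L, B ⁅x, y⁆ z = -B y ⁅x, z⁆) (H : IsPosHerm (-(B.comp bar)))
    (hZ : ∀ z : L, (∀ y : L, ⁅z, y⁆ = 0) → z = 0) : LieAlgebra.IsKilling ℂ L := by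
  have hker : LinearMap.ker (killingForm ℂ L) = ⊥ := by
    rw [eq_bot_iff]
    intro z hz
    apply hZ
    by_contra! hne
    obtain ⟨y, hy⟩ := hne
    have hT : LieAlgebra.ad ℂ L z ≠ 0 := fun h => hy (congrArg (fun f : End ℂ L => f y) h)
    -- Invariance of `B` makes `-ad (bar z)` the adjoint of `ad z`, so `-tr (ad (bar z) ad z)` is
    -- positive, whereas it vanishes for `z` in the kernel of the Killing form.
    have hpos := H.trace_adjoint_pos (T := LieAlgebra.ad ℂ L z) (S := -LieAlgebra.ad ℂ L (bar z))
      (fun u v => by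
        simp only [LinearMap.neg_apply, LinearMap.comp_apply, LieAlgebra.ad_apply, hbar, hB,
          map_neg]) hT
    have h0 : LinearMap.trace ℂ L (LieAlgebra.ad ℂ L z * LieAlgebra.ad ℂ L (bar z)) = 0 :=
      congrArg (fun f : L →ₗ[ℂ] ℂ => f (bar z)) (LinearMap.mem_ker.1 hz)
    rw [neg_mul, map_neg, LinearMap.trace_mul_comm, h0] at hpos
    simp at hpos
  exact ⟨(LieSubmodule.toSubmodule_eq_bot _).1 ((LieIdeal.coe_killingCompl_top ℂ L).trans hker)⟩

end

/-! ### Real structures on the normed algebras and on the Jordan algebra -/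

section
open ConjAlgebra CayleyDickson

/-- A real structure on a complex algebra: a conjugate-linear involutive ring homomorphism. -/
class BarAlgebra (U : Type) [NonUnitalNonAssocRing U] [Module ℂ U] where
  bar : U →ₗ⋆[ℂ] U
  bar_mul : ∀ x y : U, bar (x * y) = bar x * bar y
  bar_bar : ∀ x : U, bar (bar x) = x

open BarAlgebra

section
variable (U : Type) [NonUnitalNonAssocRing U] [Module ℂ U] [IsScalarTower ℂ U U]
    [SMulCommClass ℂ U U]

/-- The underlying endomorphism of a derivation, as a linear map. -/
def derVal : Der U →ₗ[ℂ] Module.End ℂ U where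
  toFun D := D.1
  map_add' _ _ := rfl
  map_smul' _ _ := rfl

/-- The trace form `(D, E) ↦ tr (D E)` on derivations. -/
noncomputable def traceDer : Der U →ₗ[ℂ] Der U →ₗ[ℂ] ℂ :=
  ((LinearMap.mul ℂ (Module.End ℂ U)).compr₂ (LinearMap.trace ℂ U)).compl₁₂
    (derVal U) (derVal U)

variable {U}

theorem traceDer_apply (D E : Der U) : traceDer U D E = LinearMap.trace ℂ U (D.1 * E.1) := rfl

theorem coe_lie_der (D E : Der U) : (⁅D, E⁆).1 = D.1 * E.1 - E.1 * D.1 := rfl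

theorem traceDer_lie (D E E' : Der U) : traceDer U ⁅D, E⁆ E' = -traceDer U E ⁅D, E'⁆ := by
  simp only [traceDer_apply, coe_lie_der, sub_mul, mul_sub, map_sub, neg_sub]
  rw [mul_assoc D.1, LinearMap.trace_mul_comm ℂ D.1, mul_assoc, mul_assoc]

variable [BarAlgebra U]

/-- The action `D ↦ bar D bar` of the real structure on derivations. -/
def barDer : Der U →ₗ⋆[ℂ] Der U where
  toFun D := ⟨(bar.comp D.1).comp bar, fun x y => by
    change bar (D.1 (bar (x * y))) = bar (D.1 (bar x)) * y + x * bar (D.1 (bar y))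
    rw [bar_mul, D.2, map_add, bar_mul, bar_mul, bar_bar, bar_bar]⟩
  map_add' D E := Subtype.ext (LinearMap.ext fun x => map_add bar (D.1 (bar x)) (E.1 (bar x)))
  map_smul' c D := Subtype.ext (LinearMap.ext fun x => map_smulₛₗ bar c (D.1 (bar x)))

theorem barDer_apply (D : Der U) (x : U) : (barDer D).1 x = bar (D.1 (bar x)) := rfl

theorem barDer_bar (D : Der U) (x : U) : (barDer D).1 (bar x) = bar (D.1 x) := by
  rw [barDer_apply, bar_bar]

theorem barDer_lie (D E : Der U) : barDer ⁅D, E⁆ = ⁅barDer D, barDer E⁆ := by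
  refine Subtype.ext (LinearMap.ext fun x => ?_)
  change bar (D.1 (E.1 (bar x)) - E.1 (D.1 (bar x))) =
    bar (D.1 (bar (bar (E.1 (bar x))))) - bar (E.1 (bar (bar (D.1 (bar x)))))
  rw [bar_bar, bar_bar, map_sub]

/-- The hypothesis says that `D` has adjoint `-barDer D`, so the form is `(D, E) ↦ tr (D* E)`. -/
theorem isPosHerm_traceDer [FiniteDimensional ℂ U] {h : U →ₗ⋆[ℂ] U →ₗ[ℂ] ℂ} (H : IsPosHerm h)
    (hD : ∀ (D : Der U) u v, h (D.1 u) v = -h u ((barDer D).1 v)) :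
    IsPosHerm (-((traceDer U).comp barDer)) := by
  have hadj : ∀ (D : Der U) u v, h (D.1 u) v = h u ((-(barDer D).1 : Module.End ℂ U) v) := by
    intro D u v
    rw [hD, LinearMap.neg_apply, map_neg]
  have e : ∀ D E : Der U, (-((traceDer U).comp barDer)) D E =
      LinearMap.trace ℂ U (-(barDer D).1 * E.1) := by
    intro D E
    rw [neg_mul, map_neg]
    rfl
  refine ⟨fun D E => ?_, fun D hne => ?_⟩
  · rw [e, e]
    exact H.star_trace (hadj D) (hadj E)
  · rw [e]
    exact H.trace_adjoint_pos (hadj D) (fun h0 => hne (Subtype.ext h0))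
end

/-- A real structure compatible with conjugation, for which `re (conj (bar x) * y)` is a positive
definite Hermitian form. -/
class PosConjAlgebra (A : Type) [NonAssocRing A] [Module ℂ A] [ConjAlgebra A] extends
    BarAlgebra A where
  re_bar : ∀ x : A, re (bar x) = star (re x : ℂ)
  re_pos : ∀ x : A, x ≠ 0 → 0 < (re (conj (bar x) * x) : ℂ).re

open PosConjAlgebra

section
variable {A : Type} [NonAssocRing A] [Module ℂ A] [IsScalarTower ℂ A A] [SMulCommClass ℂ A A]
  [ConjAlgebra A]

noncomputable instance : PosConjAlgebra ℂ where
  bar := (starLinearEquiv ℂ : ℂ ≃ₗ⋆[ℂ] ℂ).toLinearMap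
  bar_mul x y := star_mul' x y
  bar_bar x := star_star x
  re_bar _ := rfl
  re_pos x hx := by
    change 0 < ((starRingEnd ℂ) x * x).re
    rw [← Complex.normSq_eq_conj_mul_self, Complex.ofReal_re]
    exact Complex.normSq_pos.2 hx

variable [PosConjAlgebra A]

theorem bar_one : bar (1 : A) = 1 := by
  have h := bar_mul (bar (1 : A)) 1
  rw [mul_one, bar_bar, one_mul] at h
  exact h.symm

theorem bar_conj (x : A) : bar (conj x) = conj (bar x) := by
  rw [conj_eq, conj_eq, map_sub, map_smulₛₗ, bar_one, re_bar, map_mul, Complex.conj_ofNat]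
  rfl

theorem re_conj_mul_bar (x y : A) : star (re (conj (bar x) * y) : ℂ) = re (conj x * bar y) := by
  rw [← re_bar, bar_mul, bar_conj, bar_bar]

/-- The sign in the doubled product cancels the one in the doubled conjugation, so the real part of
the norm form is the sum of those of the two halves. -/
instance : PosConjAlgebra (CayleyDickson A) where
  bar :=
    { toFun := fun x => (bar x.1, bar x.2)
      map_add' := fun x y => ext' (map_add bar x.1 y.1) (map_add bar x.2 y.2)
      map_smul' := fun c x => ext' (map_smulₛₗ bar c x.1) (map_smulₛₗ bar c x.2) }
  bar_mul x y := by
    apply ext'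
    · change bar (x.1 * y.1 - conj y.2 * x.2) = bar x.1 * bar y.1 - conj (bar y.2) * bar x.2
      rw [map_sub, bar_mul, bar_mul, bar_conj]
    · change bar (y.2 * x.1 + x.2 * conj y.1) = bar y.2 * bar x.1 + bar x.2 * conj (bar y.1)
      rw [map_add, bar_mul, bar_mul, bar_conj]
  bar_bar x := ext' (bar_bar x.1) (bar_bar x.2)
  re_bar x := re_bar x.1
  re_pos x hx := by
    change 0 < (re (conj (bar x.1) * x.1 - conj x.2 * (-bar x.2)) : ℂ).re
    rw [mul_neg, sub_neg_eq_add, map_add, Complex.add_re]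
    have h2 : (re (conj x.2 * bar x.2) : ℂ).re = (re (conj (bar x.2) * x.2) : ℂ).re := by
      rw [← re_conj_mul_bar]
      exact Complex.conj_re _
    have nn : ∀ y : A, 0 ≤ (re (conj (bar y) * y) : ℂ).re := by
      intro y
      by_cases hy : y = 0
      · simp [hy]
      · exact (re_pos y hy).le
    rw [h2]
    by_cases h1 : x.1 = 0
    · have h3 : x.2 ≠ 0 := fun h3 => hx (ext' h1 h3)
      exact add_pos_of_nonneg_of_pos (nn _) (re_pos _ h3)
    · exact add_pos_of_pos_of_nonneg (re_pos _ h1) (nn _)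

variable [IsAlternativeRing A]

variable (A) in
/-- The form `(x, y) ↦ re (conj (bar x) y)`. -/
noncomputable def hermForm : A →ₗ⋆[ℂ] A →ₗ[ℂ] ℂ :=
  (((LinearMap.mul ℂ A).compr₂ re).comp conj).comp bar

theorem hermForm_apply (x y : A) : hermForm A x y = re (conj (bar x) * y) := rfl

theorem isPosHerm_hermForm : IsPosHerm (hermForm A) where
  symm x y := by
    rw [hermForm_apply, hermForm_apply, re_conj_mul_bar, ← re_conj, conj_mul_rev, conj_conj]
  pos x hx := re_pos x hx

/-- Values of derivations are imaginary, so conjugation only changes their sign, and `re` vanishes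
on the derivative of `bar x * y`. -/
theorem hermForm_der (D : Der A) (x y : A) :
    hermForm A (D.1 x) y = -hermForm A x ((barDer D).1 y) := by
  rw [hermForm_apply, hermForm_apply, ← barDer_bar, conj_eq ((barDer D).1 _), re_der, conj_eq]
  have h := re_der (barDer D) (bar x * y)
  rw [(barDer D).2, map_add] at h
  have h1 := re_der (barDer D) y
  simp only [mul_zero, zero_smul, zero_sub, sub_mul, map_sub, smul_mul_assoc, one_mul, map_smul,
    h1, smul_zero, neg_neg, neg_mul, map_neg]
  linear_combination -h

variable (A) in
theorem isPosHerm_traceDer_conjAlgebra [FiniteDimensional ℂ A] :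
    IsPosHerm (-((traceDer A).comp barDer)) :=
  isPosHerm_traceDer isPosHerm_hermForm hermForm_der

/-- The real structure on imaginary elements. -/
def barImag : Imag A →ₗ⋆[ℂ] Imag A where
  toFun a := ⟨bar a, by rw [mem_imag, re_bar, mem_imag.1 a.2, star_zero]⟩
  map_add' a b := Subtype.ext (map_add bar (a : A) b)
  map_smul' c a := Subtype.ext (map_smulₛₗ bar c (a : A))

theorem coe_barImag (a : Imag A) : (barImag a : A) = bar (a : A) := rfl

variable (A) in
theorem isPosHerm_imag : IsPosHerm (-((formImag A).comp (barImag (A := A)))) := by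
  have e : ∀ a b : Imag A, (-((formImag A).comp (barImag (A := A)))) a b = hermForm A a b := by
    intro a b
    rw [hermForm_apply, ← coe_barImag, conj_imag (barImag a).2, neg_mul, map_neg]
    rfl
  refine ⟨fun a b => ?_, fun a ha => ?_⟩
  · rw [e, e]; exact isPosHerm_hermForm.symm _ _
  · rw [e]; exact isPosHerm_hermForm.pos _ fun h => ha (Subtype.ext h)

namespace Herm3

noncomputable instance : BarAlgebra (Herm3 A) where
  bar :=
    { toFun := fun x => ⟨fun i j => bar (x.1 i j), fun i j => by
        rw [← bar_conj, ← x.2 i j]⟩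
      map_add' := fun x y => Subtype.ext (by
        ext i j; exact map_add bar (x.1 i j) (y.1 i j))
      map_smul' := fun c x => Subtype.ext (by
        ext i j; exact map_smulₛₗ bar c (x.1 i j)) }
  bar_mul x y := Subtype.ext (by
    ext i j
    change bar ((1 / 2 : ℂ) • (x.1 * y.1 + y.1 * x.1) i j) =
      (1 / 2 : ℂ) • (∑ k, bar (x.1 i k) * bar (y.1 k j) + ∑ k, bar (y.1 i k) * bar (x.1 k j))
    rw [map_smulₛₗ, Matrix.add_apply, map_add, Matrix.mul_apply, Matrix.mul_apply, map_sum, map_sum]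
    simp only [bar_mul]
    congr 1
    rw [map_div₀, map_one, Complex.conj_ofNat])
  bar_bar x := Subtype.ext (by ext i j; exact bar_bar _)

theorem bar_apply (x : Herm3 A) (i j : Fin 3) : (bar x).1 i j = bar (x.1 i j) := rfl

theorem tr_bar (x : Herm3 A) : tr A (bar x) = star (tr A x) := by
  simp only [tr_apply, bar_apply, re_bar, star_sum]

variable (A) in
/-- The form `(x, y) ↦ tr (bar x ∘ y)`. -/
noncomputable def hermFormJordan : Herm3 A →ₗ⋆[ℂ] Herm3 A →ₗ[ℂ] ℂ :=
  ((LinearMap.mul ℂ (Herm3 A)).compr₂ (tr A)).comp bar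

theorem hermFormJordan_apply (x y : Herm3 A) : hermFormJordan A x y = tr A (bar x * y) := rfl

variable (A) in
-- By hermiticity `tr (bar x ∘ x)` is the sum of the norm forms of all nine entries.
theorem isPosHerm_hermFormJordan : IsPosHerm (hermFormJordan A) where
  symm x y := by
    rw [hermFormJordan_apply, hermFormJordan_apply, ← tr_bar, bar_mul, bar_bar, mul_comm]
  pos x hx := by
    have e : ∀ i j, re ((bar x).1 i j * x.1 j i) = re (conj (bar (x.1 j i)) * x.1 j i) := by
      intro i j
      rw [bar_apply, ← bar_conj, ← x.2]
    rw [hermFormJordan_apply, tr_mul, Complex.re_sum]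
    have nn : ∀ y : A, 0 ≤ (re (conj (bar y) * y) : ℂ).re := isPosHerm_hermForm.nonneg
    simp only [e, Complex.re_sum]
    obtain ⟨j, i, hne⟩ : ∃ j i, x.1 j i ≠ 0 := by
      by_contra! h0
      exact hx (Subtype.ext (by ext j i; exact h0 j i))
    refine Finset.sum_pos' (fun i _ => Finset.sum_nonneg fun j _ => nn _) ⟨i, Finset.mem_univ i, ?_⟩
    exact Finset.sum_pos' (fun j _ => nn _) ⟨j, Finset.mem_univ j, re_pos _ hne⟩

theorem hermFormJordan_der (E : Der (Herm3 A)) (x y : Herm3 A) :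
    hermFormJordan A (E.1 x) y = -hermFormJordan A x ((barDer E).1 y) := by
  rw [hermFormJordan_apply, hermFormJordan_apply, ← barDer_bar, eq_neg_iff_add_eq_zero, ← map_add,
    ← der_mul, tr_der]

variable (A) in
theorem isPosHerm_traceDer_jordan [FiniteDimensional ℂ (Herm3 A)] :
    IsPosHerm (-((traceDer (Herm3 A)).comp barDer)) :=
  isPosHerm_traceDer (isPosHerm_hermFormJordan A) hermFormJordan_der

/-- The real structure on traceless elements. -/
noncomputable def barTraceless : Traceless A →ₗ⋆[ℂ] Traceless A where
  toFun x := ⟨bar (x : Herm3 A), by rw [mem_traceless, tr_bar, mem_traceless.1 x.2, star_zero]⟩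
  map_add' x y := Subtype.ext (map_add bar (x : Herm3 A) y)
  map_smul' c x := Subtype.ext (map_smulₛₗ bar c (x : Herm3 A))

theorem coe_barTraceless (x : Traceless A) : (barTraceless x : Herm3 A) = bar (x : Herm3 A) := rfl

variable (A) in
theorem isPosHerm_traceless : IsPosHerm ((formTraceless A).comp (barTraceless (A := A))) := by
  have e : ∀ x y : Traceless A, ((formTraceless A).comp (barTraceless (A := A))) x y =
      hermFormJordan A x y / 3 := fun x y => rfl
  refine ⟨fun x y => ?_, fun x hx => ?_⟩
  · rw [e, e, ← (isPosHerm_hermFormJordan A).symm, star_div₀]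
    simp
  · rw [e]
    have h := (isPosHerm_hermFormJordan A).pos (x : Herm3 A) fun h => hx (Subtype.ext h)
    rw [show (3 : ℂ) = ((3 : ℝ) : ℂ) by norm_num, Complex.div_ofReal_re]
    positivity

end Herm3
end

end

/-! ### Traces of multiplication operators; invariant linear forms on `J₃` -/

section
open ConjAlgebra CayleyDickson BarAlgebra

theorem trace_smulRight {V : Type*} [AddCommGroup V] [Module ℂ V] [FiniteDimensional ℂ V]
    (f : V →ₗ[ℂ] ℂ) (w : V) : LinearMap.trace ℂ V (f.smulRight w) = f w := by
  rw [LinearMap.trace_smulRight]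

theorem der_mul_mulLeft {U : Type} [NonUnitalNonAssocRing U] [Module ℂ U] [IsScalarTower ℂ U U]
    [SMulCommClass ℂ U U] (D : Der U) (x : U) :
    D.1 * LinearMap.mulLeft ℂ x = LinearMap.mulLeft ℂ x * D.1 + LinearMap.mulLeft ℂ (D.1 x) :=
  LinearMap.ext fun y => (D.2 x y).trans (add_comm _ _)

theorem der_mul_mulRight {U : Type} [NonUnitalNonAssocRing U] [Module ℂ U] [IsScalarTower ℂ U U]
    [SMulCommClass ℂ U U] (D : Der U) (x : U) :
    D.1 * LinearMap.mulRight ℂ x = LinearMap.mulRight ℂ x * D.1 + LinearMap.mulRight ℂ (D.1 x) :=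
  LinearMap.ext fun y => D.2 y x

section
variable {A : Type} [NonAssocRing A] [Module ℂ A] [IsScalarTower ℂ A A] [SMulCommClass ℂ A A]
  [ConjAlgebra A] [IsAlternativeRing A] [FiniteDimensional ℂ A]

theorem trace_smul_id (c : ℂ) : LinearMap.trace ℂ A (c • (1 : Module.End ℂ A)) =
    c * Module.finrank ℂ A := by
  rw [map_smul, LinearMap.trace_one, smul_eq_mul]

/-- Linearized alternativity gives `L_u L_v + L_v L_u = L_{uv+vu}`, the scalar `2 re (uv)`. -/
theorem trace_mulLeft_mulLeft (u v : A) (hu : re u = 0) (hv : re v = 0) :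
    LinearMap.trace ℂ A (LinearMap.mulLeft ℂ u * LinearMap.mulLeft ℂ v) =
      Module.finrank ℂ A * re (u * v) := by
  have e : LinearMap.mulLeft ℂ u * LinearMap.mulLeft ℂ v
      + LinearMap.mulLeft ℂ v * LinearMap.mulLeft ℂ u = (2 * re (u * v)) • (1 : Module.End ℂ A) := by
    ext x
    have h := alt_left u v x
    have h2 := congrArg (fun t => t * x) (imag_mul_add u v hu hv)
    simp only [add_mul, smul_mul_assoc, one_mul] at h2
    change u * (v * x) + v * (u * x) = (2 * re (u * v)) • x
    rw [← h2]
    linear_combination (norm := abel) -h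
  have e2 := congrArg (LinearMap.trace ℂ A) e
  rw [map_add, LinearMap.trace_mul_comm ℂ (LinearMap.mulLeft ℂ v), trace_smul_id] at e2
  linear_combination (1 / 2) * e2

theorem trace_mulRight_mulRight (u v : A) (hu : re u = 0) (hv : re v = 0) :
    LinearMap.trace ℂ A (LinearMap.mulRight ℂ u * LinearMap.mulRight ℂ v) =
      Module.finrank ℂ A * re (u * v) := by
  have e : LinearMap.mulRight ℂ u * LinearMap.mulRight ℂ v
      + LinearMap.mulRight ℂ v * LinearMap.mulRight ℂ u =
        (2 * re (u * v)) • (1 : Module.End ℂ A) := by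
    ext x
    have h := alt_right x u v
    have h2 := congrArg (fun t => x * t) (imag_mul_add u v hu hv)
    simp only [mul_add, mul_smul_comm, mul_one] at h2
    change x * v * u + x * u * v = (2 * re (u * v)) • x
    rw [← h2]
    linear_combination (norm := abel) h
  have e2 := congrArg (LinearMap.trace ℂ A) e
  rw [map_add, LinearMap.trace_mul_comm ℂ (LinearMap.mulRight ℂ v), trace_smul_id] at e2
  linear_combination (1 / 2) * e2

theorem imag_mul_add_mul (v z : A) (hv : re v = 0) :
    v * z + z * v = (2 * re (v * z)) • (1 : A) + (2 * re z) • v := by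
  have h := imag_mul_add v (z - re z • 1) hv (by simp [re_one])
  simp only [mul_sub, sub_mul, mul_smul_comm, smul_mul_assoc, mul_one, one_mul, map_sub, map_smul,
    hv, smul_zero, sub_zero] at h
  linear_combination (norm := module) h

/-- Since `x v = -v x + 2 re (v x) + 2 re (x) v`, `L_u R_v` is `-L_u L_v` plus two operators of rank
at most one, each of trace `2 re (uv)`; hence the 4. -/
theorem trace_mulLeft_mulRight (u v : A) (hu : re u = 0) (hv : re v = 0) :
    LinearMap.trace ℂ A (LinearMap.mulLeft ℂ u * LinearMap.mulRight ℂ v) =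
      (4 - Module.finrank ℂ A) * re (u * v) := by
  have e : LinearMap.mulLeft ℂ u * LinearMap.mulRight ℂ v =
      -(LinearMap.mulLeft ℂ u * LinearMap.mulLeft ℂ v)
      + (((2 : ℂ) • (re ∘ₗ LinearMap.mulLeft ℂ v)).smulRight u
        + ((2 : ℂ) • (re : A →ₗ[ℂ] ℂ)).smulRight (u * v)) := by
    ext x
    have h := congrArg (fun t => u * t) (imag_mul_add_mul v x hv)
    simp only [mul_add, mul_smul_comm, mul_one] at h
    change u * (x * v) = -(u * (v * x)) + ((2 * re (v * x)) • u + (2 * re x) • (u * v))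
    linear_combination (norm := module) h
  rw [e, map_add, map_add, map_neg, trace_mulLeft_mulLeft u v hu hv, trace_smulRight,
    trace_smulRight]
  simp only [LinearMap.smul_apply, LinearMap.comp_apply, LinearMap.mulLeft_apply, smul_eq_mul,
    re_mul_comm v u]
  ring

/-- The trace form of a derivation with an inner derivation. -/
theorem traceDer_innerDer (D : Der A) (a b : Imag A) :
    traceDer A D (innerDerImag A a b) =
      (Module.finrank ℂ A + 4) * formImag A (derImag D a) b := by
  have e : (innerDerImag A a b).1 =
      (LinearMap.mulLeft ℂ (a : A) * LinearMap.mulLeft ℂ (b : A)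
        - LinearMap.mulLeft ℂ (b : A) * LinearMap.mulLeft ℂ (a : A))
      + (LinearMap.mulLeft ℂ (a : A) * LinearMap.mulRight ℂ (b : A)
        - LinearMap.mulRight ℂ (b : A) * LinearMap.mulLeft ℂ (a : A))
      + (LinearMap.mulRight ℂ (a : A) * LinearMap.mulRight ℂ (b : A)
        - LinearMap.mulRight ℂ (b : A) * LinearMap.mulRight ℂ (a : A)) := rfl
  -- `tr (D [P, Q]) = tr ([D, P] Q)`, and `[D, L_a] = L_{D a}`, likewise for `R_a`. With `n = dim A`
  -- the three terms contribute `n + (4 - n) + n = n + 4`.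
  have key : ∀ P P' Q : Module.End ℂ A, D.1 * P = P * D.1 + P' →
      LinearMap.trace ℂ A (D.1 * (P * Q - Q * P)) = LinearMap.trace ℂ A (P' * Q) := by
    intro P P' Q h
    rw [mul_sub, map_sub, ← mul_assoc, ← mul_assoc, LinearMap.trace_mul_comm ℂ (D.1 * Q),
      ← mul_assoc, h, add_mul, map_add]
    ring
  have hu : re (D.1 (a : A)) = 0 := re_der D a
  rw [traceDer_apply, e, mul_add, mul_add, map_add, map_add, key _ _ _ (der_mul_mulLeft D a),
    key _ _ _ (der_mul_mulLeft D a), key _ _ _ (der_mul_mulRight D a),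
    trace_mulLeft_mulLeft _ _ hu b.2, trace_mulLeft_mulRight _ _ hu b.2,
    trace_mulRight_mulRight _ _ hu b.2, formImag_apply, derImag_apply]
  ring
end

section
variable {A : Type} [NonAssocRing A] [Module ℂ A] [IsScalarTower ℂ A A] [SMulCommClass ℂ A A]
  [ConjAlgebra A] [IsAlternativeRing A]

namespace Herm3

theorem idem_mul_apply (i : Fin 3) (x : Herm3 A) (k l : Fin 3) :
    (idem i * x).1 k l = (1 / 2 : ℂ) • ((if k = i then x.1 k l else 0)
      + (if l = i then x.1 k l else 0)) := by
  rw [coe_mul]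
  simp only [idem, Matrix.smul_apply, Matrix.add_apply, Matrix.diagonal_mul, Matrix.mul_diagonal,
    Pi.single_apply, ite_mul, mul_ite, one_mul, mul_one, zero_mul, mul_zero]

/-- The permutation matrix of the transposition of `i` and `j`. -/
def swapMat (i j : Fin 3) : Herm3 A :=
  ⟨Matrix.of fun k l => if Equiv.swap i j k = l then 1 else 0, fun k l => by
    rw [Matrix.of_apply, Matrix.of_apply]
    by_cases h : Equiv.swap i j k = l
    · have h' : Equiv.swap i j l = k := by rw [← h, Equiv.swap_apply_self]
      rw [if_pos h, if_pos h', conj_one]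
    · have h' : Equiv.swap i j l ≠ k := fun e => h (by rw [← e, Equiv.swap_apply_self])
      rw [if_neg h, if_neg h', map_zero]⟩

theorem swapMat_mul_apply (i j : Fin 3) (x : Herm3 A) (k l : Fin 3) :
    (swapMat i j * x).1 k l =
      (1 / 2 : ℂ) • (x.1 (Equiv.swap i j k) l + x.1 k (Equiv.swap i j l)) := by
  rw [coe_mul]
  simp only [swapMat, Matrix.smul_apply, Matrix.add_apply, Matrix.mul_apply, Matrix.of_apply,
    ite_mul, mul_ite, one_mul, mul_one, zero_mul, mul_zero]
  congr 2
  · simp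
  · simp [Equiv.swap_apply_eq_iff]

/-- A linear form on `J₃(A)` that is invariant under the inner derivations is a multiple of the
trace. -/
theorem invariant_form (f : Herm3 A →ₗ[ℂ] ℂ)
    (hf : ∀ a b c : Herm3 A, f (a * (b * c)) = f (b * (a * c))) (w : Herm3 A) :
    3 * f w = f 1 * tr A w := by
  -- Invariance turns `f (e (w e))` into `f (w e)` for `e = idem i`, and the Peirce relation
  -- expresses `e (e w)` through `e w` and `e`.
  have h1 : ∀ (w : Herm3 A) i, f (w * idem i) = re (w.1 i i) * f (idem i) := by
    intro w i
    have h := hf (idem i) w (idem i)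
    rw [idem_idem, mul_comm w, idem_idem_mul, map_add, map_smul, map_smul, smul_eq_mul,
      smul_eq_mul] at h
    rw [mul_comm w]
    linear_combination -2 * h
  -- With `s` the transposition matrix, `s s = 1` and `eᵢ s = eⱼ s`, so `f eᵢ = f (eᵢ (s s)) = f (s
  -- (eᵢ s))` is symmetric in `i` and `j`.
  have h2 : ∀ i j, f (idem i) = f (idem j) := by
    intro i j
    have e1 : (swapMat i j * swapMat i j : Herm3 A) = 1 := by
      apply Subtype.ext
      ext k l
      rw [swapMat_mul_apply, coe_one]
      simp only [swapMat, Matrix.of_apply, Equiv.swap_apply_self, Equiv.swap_apply_eq_iff,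
        Matrix.one_apply, eq_comm (a := l)]
      rw [← two_smul ℂ, smul_smul]
      norm_num
    have e2 : (idem i * swapMat i j : Herm3 A) = idem j * swapMat i j := by
      apply Subtype.ext
      ext k l
      rw [idem_mul_apply, idem_mul_apply]
      simp only [swapMat, Matrix.of_apply]
      fin_cases i <;> fin_cases j <;> fin_cases k <;> fin_cases l <;> simp [Equiv.swap_apply_def]
    have a := hf (idem i) (swapMat i j) (swapMat i j)
    have b := hf (idem j) (swapMat i j) (swapMat i j)
    rw [e1, mul_one] at a b
    rw [a, b, e2]
  have e : w = w * idem 0 + w * idem 1 + w * idem 2 := by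
    rw [← mul_add, ← mul_add, idem_sum, mul_one]
  have e1 : f 1 = 3 * f (idem 0) := by
    rw [← idem_sum, map_add, map_add, h2 1 0, h2 2 0]; ring
  have ew : f w = tr A w * f (idem 0) := by
    conv_lhs => rw [e]
    rw [map_add, map_add, h1, h1, h1, h2 1 0, h2 2 0, tr_apply, Fin.sum_univ_three]; ring
  rw [ew, e1]; ring

theorem tr_mul_eq_zero [PosConjAlgebra A] {x : Herm3 A} (h : ∀ w, tr A (x * w) = 0) : x = 0 := by
  apply (isPosHerm_hermFormJordan A).eq_zero
  rw [hermFormJordan_apply, mul_comm, h]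

/-- Traceless elements killed by all inner derivations vanish. -/
theorem eq_zero_of_jordanDer [PosConjAlgebra A] {x : Herm3 A} (hx : tr A x = 0)
    (h : ∀ a b : Herm3 A, (jordanDer a b).1 x = 0) : x = 0 := by
  refine tr_mul_eq_zero fun w => ?_
  -- The form `w ↦ tr (x w)` is invariant because inner derivations kill `x`; its value at 1 is `tr
  -- x = 0`.
  have hi := invariant_form (tr A ∘ₗ LinearMap.mulLeft ℂ x) (fun a b c => ?_) w
  · simp only [LinearMap.comp_apply, LinearMap.mulLeft_apply, mul_one, hx, zero_mul] at hi
    linear_combination (1 / 3) * hi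
  · have hab : a * (b * x) = b * (a * x) := sub_eq_zero.1 (h a b)
    have key : ∀ a b c : Herm3 A, tr A (x * (a * (b * c))) = tr A (b * (a * x) * c) := by
      intro a b c
      rw [← tr_mul_assoc, ← tr_mul_assoc, mul_comm b, mul_comm a x]
    change tr A (x * (a * (b * c))) = tr A (x * (b * (a * c)))
    rw [key, key, hab]

/-- The algebra of derivations has trivial center. -/
theorem der_center_eq_zero {E : Der (Herm3 A)} (h : ∀ D : Der (Herm3 A), ⁅E, D⁆ = 0) : E = 0 := by
  have hcomm : ∀ (a b c : Herm3 A), E.1 (a * (b * c) - b * (a * c)) =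
      a * (b * E.1 c) - b * (a * E.1 c) := by
    intro a b c
    have := congrArg (fun D : Der (Herm3 A) => D.1 c) (h (jordanDer a b))
    exact sub_eq_zero.1 this
  have h0 : ∀ i : Fin 3, E.1 (idem i) = 0 := by
    intro i
    obtain ⟨j, k, hij, hik, hjk, hall⟩ : ∃ j k : Fin 3, i ≠ j ∧ i ≠ k ∧ j ≠ k ∧
        ∀ l, l = i ∨ l = j ∨ l = k := by
      fin_cases i
      · exact ⟨1, 2, by decide⟩
      · exact ⟨0, 2, by decide⟩
      · exact ⟨0, 1, by decide⟩
    set v := E.1 (idem i) with hv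
    -- The derivation `[L_{eⱼ}, L_s]`, with `s = swapMat j k`, kills `eᵢ`; since `E` commutes with
    -- it, it also kills `v = E eᵢ`. Its entries in column `i` give `v_ki = v_ji = 0`, and `v = 2 eᵢ
    -- v` leaves no other possible nonzero entry.
    have hsw : Equiv.swap j k i = i := Equiv.swap_apply_of_ne_of_ne hij hik
    have e1 : v = idem i * v + idem i * v := by
      have := der_mul E (idem i) (idem i)
      rw [idem_idem, mul_comm (E.1 _)] at this
      exact this
    have hji : (idem j * idem i : Herm3 A) = 0 := by
      apply Subtype.ext
      ext a b
      rw [idem_mul_apply]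
      change _ = (0 : A)
      simp only [idem, Matrix.diagonal_apply, Pi.single_apply]
      rcases hall a with rfl | rfl | rfl <;> rcases hall b with rfl | rfl | rfl <;>
        simp [hij, hik, hjk, hij.symm, hik.symm, hjk.symm]
    have hsi : (swapMat j k * idem i : Herm3 A) = idem i := by
      apply Subtype.ext
      ext a b
      rw [swapMat_mul_apply]
      simp only [idem, Matrix.diagonal_apply, Pi.single_apply]
      rcases hall a with rfl | rfl | rfl <;> rcases hall b with rfl | rfl | rfl <;>
        simp [hij, hik, hjk, hij.symm, hik.symm, hjk.symm, hsw]
      rw [← two_smul ℂ, smul_smul]; norm_num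
    have e2 := hcomm (idem j) (swapMat j k) (idem i)
    rw [hsi, hji, mul_zero, sub_zero, map_zero, ← hv] at e2
    have ent : ∀ a b, (idem j * (swapMat j k * v)).1 a b = (swapMat j k * (idem j * v)).1 a b := by
      intro a b
      rw [sub_eq_zero.1 e2.symm]
    have z1 : v.1 k i = 0 := by
      have := ent j i
      rw [idem_mul_apply, swapMat_mul_apply, swapMat_mul_apply, idem_mul_apply, idem_mul_apply,
        Equiv.swap_apply_left, hsw] at this
      simpa [hij, hik, hjk, hij.symm, hik.symm, hjk.symm] using this
    have z2 : v.1 j i = 0 := by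
      have := ent k i
      rw [idem_mul_apply, swapMat_mul_apply, swapMat_mul_apply, idem_mul_apply, idem_mul_apply,
        Equiv.swap_apply_right, hsw] at this
      simpa [hij, hik, hjk, hij.symm, hik.symm, hjk.symm] using this.symm
    have diag : ∀ a b, (v.1 a b : A) = ((if a = i then v.1 a b else 0)
        + (if b = i then v.1 a b else 0)) := by
      intro a b
      have := congrArg (fun y : Herm3 A => y.1 a b) e1
      simp only [coe_add, Matrix.add_apply, idem_mul_apply] at this
      rw [← two_smul ℂ, smul_smul] at this
      norm_num at this
      exact this
    have z3 : v.1 i k = 0 := by rw [v.2 k i, z1, map_zero]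
    have z4 : v.1 i j = 0 := by rw [v.2 j i, z2, map_zero]
    have z5 : v.1 i i = 0 := by
      have := diag i i
      simpa using this
    apply Subtype.ext
    ext a b
    change v.1 a b = 0
    rcases hall a with rfl | rfl | rfl <;> rcases hall b with rfl | rfl | rfl <;>
      first
        | assumption
        | (rw [diag]; simp [hij, hik, hij.symm, hik.symm])
  -- `[L_{eᵢ}, L_w] eᵢ` equals `-(1/2) eᵢ w` plus a multiple of `eᵢ`, and `E` kills both this
  -- element and `eᵢ`.
  have h1 : ∀ (w : Herm3 A) i, E.1 (w * idem i) = 0 := by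
    intro w i
    have := hcomm (idem i) w (idem i)
    rw [h0, mul_zero, mul_zero, mul_zero, sub_zero, idem_idem, mul_comm w,
      idem_idem_mul, map_sub, map_add, map_smul, map_smul, h0, smul_zero, add_zero] at this
    rw [mul_comm]
    have h2 : (-(1 / 2) : ℂ) • E.1 (idem i * w) = 0 := by
      rw [← this]; module
    exact (smul_eq_zero.1 h2).resolve_left (by norm_num)
  refine der_ext fun w => ?_
  change E.1 w = 0
  rw [← mul_one w, ← idem_sum, mul_add, mul_add, map_add, map_add, h1, h1, h1]
  simp

variable [FiniteDimensional ℂ (Herm3 A)]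

/-- The form `w ↦ tr L_w` is invariant, since `L_{D c} = [D, L_c]` has trace zero; its value at 1 is
the dimension. -/
theorem trace_mulLeft (w : Herm3 A) : 3 * LinearMap.trace ℂ (Herm3 A) (LinearMap.mulLeft ℂ w) =
    Module.finrank ℂ (Herm3 A) * tr A w := by
  have h := invariant_form ((LinearMap.trace ℂ (Herm3 A)) ∘ₗ (LinearMap.mul ℂ (Herm3 A)))
    (fun a b c => ?_) w
  · have e1 : LinearMap.mul ℂ (Herm3 A) 1 = 1 := LinearMap.ext fun x => one_mul x
    rw [LinearMap.comp_apply, LinearMap.comp_apply, e1, LinearMap.trace_one] at h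
    exact h
  · rw [← sub_eq_zero, ← map_sub]
    have e := der_mul_mulLeft (jordanDer a b) c
    have e2 := congrArg (LinearMap.trace ℂ (Herm3 A)) e
    rw [map_add, LinearMap.trace_mul_comm] at e2
    exact left_eq_add.1 e2

/-- Read as an identity of operators in `z`, polarized Cayley-Hamilton relates `L_{xy}` and `L_x L_y
+ L_y L_x` to a scalar and operators of rank at most one. Taking traces gives `2 tr L_{xy} + 4 tr
(L_x L_y) = (dim + 3) tr (xy)`, and `trace_mulLeft` eliminates the first term. -/
theorem trace_mulLeft_mul (x y : Herm3 A) (hx : tr A x = 0) (hy : tr A y = 0) :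
    12 * LinearMap.trace ℂ (Herm3 A) (LinearMap.mulLeft ℂ x * LinearMap.mulLeft ℂ y) =
      (Module.finrank ℂ (Herm3 A) + 9) * tr A (x * y) := by
  have e : (2 : ℂ) • LinearMap.mulLeft ℂ (x * y)
      + (2 : ℂ) • (LinearMap.mulLeft ℂ x * LinearMap.mulLeft ℂ y)
      + (2 : ℂ) • (LinearMap.mulLeft ℂ y * LinearMap.mulLeft ℂ x) =
      (tr A (x * y)) • (1 : Module.End ℂ (Herm3 A)) + (2 : ℂ) • (tr A).smulRight (x * y)
      + (tr A ∘ₗ LinearMap.mulLeft ℂ y).smulRight x + (tr A ∘ₗ LinearMap.mulLeft ℂ x).smulRight y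
      + ((2 : ℂ) • (tr A ∘ₗ LinearMap.mulLeft ℂ (x * y)) - tr A (x * y) • tr A).smulRight 1 := by
    ext1 z
    have h := cayley_hamilton_polar x y z
    rw [hx, hy, mul_comm (y * z) x, mul_comm z x, mul_comm (x * z) y] at h
    simp only [LinearMap.add_apply, LinearMap.smul_apply, LinearMap.mulLeft_apply,
      Module.End.mul_apply, LinearMap.smulRight_apply, LinearMap.comp_apply, Module.End.one_apply,
      LinearMap.sub_apply, smul_eq_mul]
    linear_combination (norm := module) h
  have e2 := congrArg (LinearMap.trace ℂ (Herm3 A)) e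
  have e3 := trace_mulLeft (x * y)
  simp only [map_add, map_smul, trace_smulRight, LinearMap.trace_one, LinearMap.smul_apply,
    LinearMap.comp_apply, LinearMap.mulLeft_apply, LinearMap.sub_apply, smul_eq_mul, tr_one,
    mul_one, LinearMap.trace_mul_comm ℂ (LinearMap.mulLeft ℂ y), mul_comm y x] at e2
  linear_combination 3 * e2 - 2 * e3

/-- The trace form of a derivation with an inner derivation. -/
theorem traceDer_jordanDer (E : Der (Herm3 A)) (x y : Traceless A) :
    4 * traceDer (Herm3 A) E (jordanDerTraceless A x y) =
      (Module.finrank ℂ (Herm3 A) + 9) * formTraceless A (derTraceless E x) y := by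
  have e : (jordanDerTraceless A x y).1 =
      LinearMap.mulLeft ℂ (x : Herm3 A) * LinearMap.mulLeft ℂ (y : Herm3 A)
        - LinearMap.mulLeft ℂ (y : Herm3 A) * LinearMap.mulLeft ℂ (x : Herm3 A) := rfl
  have h := trace_mulLeft_mul (E.1 x) (y : Herm3 A) (tr_der E x) y.2
  rw [traceDer_apply, e, mul_sub, map_sub, ← mul_assoc, ← mul_assoc,
    LinearMap.trace_mul_comm ℂ (E.1 * LinearMap.mulLeft ℂ (y : Herm3 A)), ← mul_assoc,
    der_mul_mulLeft, add_mul, map_add, formTraceless_apply, derTraceless_apply]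
  linear_combination (1 / 3) * h

end Herm3
end

end

/-! ### The invariant form and the real structure of the Tits algebra -/

section
open ConjAlgebra CayleyDickson BarAlgebra PosConjAlgebra

section
variable {A : Type} [NonAssocRing A] [Module ℂ A]

instance [FiniteDimensional ℂ A] : FiniteDimensional ℂ (CayleyDickson A) :=
  inferInstanceAs (FiniteDimensional ℂ (A × A))

instance {U : Type} [NonUnitalNonAssocRing U] [Module ℂ U] [IsScalarTower ℂ U U]
    [SMulCommClass ℂ U U] [FiniteDimensional ℂ U] : FiniteDimensional ℂ (Der U) :=
  FiniteDimensional.of_injective (derVal U) fun _ _ h => Subtype.ext h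

variable [IsScalarTower ℂ A A] [SMulCommClass ℂ A A] [ConjAlgebra A] [IsAlternativeRing A]

instance [FiniteDimensional ℂ A] : FiniteDimensional ℂ (Herm3 A) :=
  inferInstanceAs (FiniteDimensional ℂ (hermitian3 A))
end

namespace Tits
open Herm3

section
variable {A B : Type} [NonAssocRing A] [Module ℂ A] [IsScalarTower ℂ A A] [SMulCommClass ℂ A A]
  [ConjAlgebra A] [IsAlternativeRing A]
  [NonAssocRing B] [Module ℂ B] [IsScalarTower ℂ B B] [SMulCommClass ℂ B B]
  [ConjAlgebra B] [IsAlternativeRing B]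

noncomputable instance [FiniteDimensional ℂ A] [FiniteDimensional ℂ B] :
    FiniteDimensional ℂ (Tits A B) :=
  inferInstanceAs (FiniteDimensional ℂ (Der A × Der (Herm3 B) × (Imag A ⊗[ℂ] Traceless B)))

variable (A B)

/-- The component in `Der A`. -/
def toDer : Tits A B →ₗ[ℂ] Der A where
  toFun u := u.1
  map_add' _ _ := rfl
  map_smul' _ _ := rfl

/-- The component in `Der J₃(B)`. -/
def toJordanDer : Tits A B →ₗ[ℂ] Der (Herm3 B) where
  toFun u := u.2.1
  map_add' _ _ := rfl
  map_smul' _ _ := rfl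

/-- The component in `Im A ⊗ J₃(B)₀`. -/
def toOdd : Tits A B →ₗ[ℂ] (Imag A ⊗[ℂ] Traceless B) where
  toFun u := u.2.2
  map_add' _ _ := rfl
  map_smul' _ _ := rfl

/-- The invariant form on the odd part. -/
noncomputable def oddForm :
    (Imag A ⊗[ℂ] Traceless B) →ₗ[ℂ] (Imag A ⊗[ℂ] Traceless B) →ₗ[ℂ] ℂ :=
  (TensorProduct.map₂ (formImag A) (formTraceless B)).compr₂
    (TensorProduct.lid ℂ ℂ).toLinearMap

variable {A B}

theorem oddForm_tmul (a b : Imag A) (x y : Traceless B) :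
    oddForm A B (a ⊗ₜ x) (b ⊗ₜ y) = formImag A a b * formTraceless B x y := by
  simp [oddForm]

theorem bilin_ext {M : Type} [AddCommGroup M] [Module ℂ M]
    (β γ : (Imag A ⊗[ℂ] Traceless B) →ₗ[ℂ] (Imag A ⊗[ℂ] Traceless B) →ₗ[ℂ] M)
    (h : ∀ a b x y, β (a ⊗ₜ x) (b ⊗ₜ y) = γ (a ⊗ₜ x) (b ⊗ₜ y))
    (v w : Imag A ⊗[ℂ] Traceless B) : β v w = γ v w := by
  induction v with
  | zero => simp
  | add v v' h h' => rw [map_add, map_add, LinearMap.add_apply, LinearMap.add_apply, h, h']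
  | tmul a x =>
    induction w with
    | zero => simp
    | add w w' h h' => rw [map_add, map_add, h, h']
    | tmul b y => exact h a b x y

theorem oddForm_swap (v w : Imag A ⊗[ℂ] Traceless B) : oddForm A B v w = oddForm A B w v :=
  bilin_ext (oddForm A B) (oddForm A B).flip (fun a b x y => by
    rw [LinearMap.flip_apply, oddForm_tmul, oddForm_tmul, formImag_swap, formTraceless_swap]) v w

theorem oddForm_act (D : Der A) (E : Der (Herm3 B)) (v w : Imag A ⊗[ℂ] Traceless B) :
    oddForm A B (act D E v) w + oddForm A B v (act D E w) = 0 := by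
  refine bilin_ext ((oddForm A B).comp (act D E) + (oddForm A B).compl₂ (act D E)) 0
    (fun a b x y => ?_) v w
  have h1 := formImag_derImag D a b
  have h2 := formTraceless_der E x y
  simp only [LinearMap.add_apply, LinearMap.comp_apply, LinearMap.compl₂_apply, act_tmul, map_add,
    oddForm_tmul, LinearMap.zero_apply]
  linear_combination formTraceless B x y * h1 + formImag A a b * h2

theorem oddForm_oddOdd (u v w : Imag A ⊗[ℂ] Traceless B) :
    oddForm A B (oddOdd A B u v) w = oddForm A B (oddOdd A B v w) u := by
  induction u with
  | zero => simp
  | add u u' h h' => simp only [map_add, LinearMap.add_apply, h, h']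
  | tmul a x =>
    refine bilin_ext ((oddForm A B).comp (oddOdd A B (a ⊗ₜ x)))
      ((oddOdd A B).compr₂ ((oddForm A B).flip (a ⊗ₜ x))) (fun b c y z => ?_) v w
    simp only [LinearMap.comp_apply, LinearMap.compr₂_apply, LinearMap.flip_apply, oddOdd_tmul,
      oddForm_tmul]
    rw [formImag_comm, formTraceless_mul]

/-- The element of the Tits algebra with given components. -/
def mk (D : Der A) (E : Der (Herm3 B)) (w : Imag A ⊗[ℂ] Traceless B) : Tits A B :=
  ((D, E, w) : Der A × Der (Herm3 B) × (Imag A ⊗[ℂ] Traceless B))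

theorem lie_ofDer (u : Tits A B) (E : Der (Herm3 B)) :
    ⁅u, ofDer A B E⁆ = mk 0 ⁅u.2.1, E⁆ (-act (0 : Der A) E u.2.2) := by
  refine Prod.ext ?_ (Prod.ext ?_ ?_)
  · change ⁅u.1, (0 : Der A)⁆ + oddDer A B u.2.2 0 = 0
    rw [lie_zero, map_zero, add_zero]
  · change ⁅u.2.1, E⁆ + oddJordanDer A B u.2.2 0 = ⁅u.2.1, E⁆
    rw [map_zero, add_zero]
  · change act u.1 u.2.1 0 - act (0 : Der A) E u.2.2 + oddOdd A B u.2.2 0 = -act (0 : Der A) E u.2.2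
    rw [map_zero, map_zero, zero_sub, add_zero]

variable [FiniteDimensional ℂ A] [FiniteDimensional ℂ B]

/-- The two trace forms meet the bracket of odd elements with constants `dim A + 4` and `dim J₃(B) +
9`. Weighting each form by the constant of the other gives both terms the same factor, which becomes
the weight of the odd form in `invForm`. -/
theorem traceDer_odd (D : Der A) (E : Der (Herm3 B)) (v w : Imag A ⊗[ℂ] Traceless B) :
    ((Module.finrank ℂ (Herm3 B) + 9 : ℕ) : ℂ) * traceDer A D (oddDer A B v w)
      + ((Module.finrank ℂ A + 4 : ℕ) : ℂ) * traceDer (Herm3 B) E (oddJordanDer A B v w) =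
    ((Module.finrank ℂ A + 4 : ℕ) : ℂ) * ((Module.finrank ℂ (Herm3 B) + 9 : ℕ) : ℂ)
      * oddForm A B (act D E v) w := by
  refine bilin_ext
    (((Module.finrank ℂ (Herm3 B) + 9 : ℕ) : ℂ) • (oddDer A B).compr₂ (traceDer A D)
      + ((Module.finrank ℂ A + 4 : ℕ) : ℂ) • (oddJordanDer A B).compr₂ (traceDer (Herm3 B) E))
    ((((Module.finrank ℂ A + 4 : ℕ) : ℂ) * ((Module.finrank ℂ (Herm3 B) + 9 : ℕ) : ℂ)) •
      (oddForm A B).comp (act D E)) (fun a b x y => ?_) v w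
  have h1 := traceDer_innerDer D a b
  have h2 := traceDer_jordanDer E x y
  simp only [LinearMap.add_apply, LinearMap.smul_apply, LinearMap.comp_apply,
    LinearMap.compr₂_apply, oddDer_tmul, oddJordanDer_tmul, act_tmul, map_add, map_smul,
    oddForm_tmul, smul_eq_mul]
  push_cast
  linear_combination ((Module.finrank ℂ (Herm3 B) : ℂ) + 9) * formTraceless B x y * h1
    + ((Module.finrank ℂ A : ℂ) + 4) * formImag A a b * h2

variable (A B) in
/-- The invariant form of the Tits algebra. -/
noncomputable def invForm : Tits A B →ₗ[ℂ] Tits A B →ₗ[ℂ] ℂ :=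
  ((Module.finrank ℂ (Herm3 B) + 9 : ℕ) : ℂ) • (traceDer A).compl₁₂ (toDer A B) (toDer A B)
  + ((Module.finrank ℂ A + 4 : ℕ) : ℂ) •
    (traceDer (Herm3 B)).compl₁₂ (toJordanDer A B) (toJordanDer A B)
  + (((Module.finrank ℂ A + 4 : ℕ) : ℂ) * ((Module.finrank ℂ (Herm3 B) + 9 : ℕ) : ℂ)) •
    (oddForm A B).compl₁₂ (toOdd A B) (toOdd A B)

theorem invForm_apply (u v : Tits A B) : invForm A B u v =
    ((Module.finrank ℂ (Herm3 B) + 9 : ℕ) : ℂ) * traceDer A u.1 v.1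
    + ((Module.finrank ℂ A + 4 : ℕ) : ℂ) * traceDer (Herm3 B) u.2.1 v.2.1
    + ((Module.finrank ℂ A + 4 : ℕ) : ℂ) * ((Module.finrank ℂ (Herm3 B) + 9 : ℕ) : ℂ)
      * oddForm A B u.2.2 v.2.2 := rfl

theorem traceDer_swap {U : Type} [NonUnitalNonAssocRing U] [Module ℂ U] [IsScalarTower ℂ U U]
    [SMulCommClass ℂ U U] (D E : Der U) : traceDer U D E = traceDer U E D := by
  rw [traceDer_apply, traceDer_apply, LinearMap.trace_mul_comm]

theorem invForm_lie (u v w : Tits A B) : invForm A B ⁅u, v⁆ w = -invForm A B v ⁅u, w⁆ := by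
  have aux : ∀ (D1 D2 D3 : Der A) (E1 E2 E3 : Der (Herm3 B)) (p q r : Imag A ⊗[ℂ] Traceless B),
      ((Module.finrank ℂ (Herm3 B) + 9 : ℕ) : ℂ) * traceDer A (⁅D1, D2⁆ + oddDer A B p q) D3
      + ((Module.finrank ℂ A + 4 : ℕ) : ℂ)
        * traceDer (Herm3 B) (⁅E1, E2⁆ + oddJordanDer A B p q) E3
      + ((Module.finrank ℂ A + 4 : ℕ) : ℂ) * ((Module.finrank ℂ (Herm3 B) + 9 : ℕ) : ℂ)
        * oddForm A B (act D1 E1 q - act D2 E2 p + oddOdd A B p q) r =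
      -(((Module.finrank ℂ (Herm3 B) + 9 : ℕ) : ℂ) * traceDer A D2 (⁅D1, D3⁆ + oddDer A B p r)
      + ((Module.finrank ℂ A + 4 : ℕ) : ℂ)
        * traceDer (Herm3 B) E2 (⁅E1, E3⁆ + oddJordanDer A B p r)
      + ((Module.finrank ℂ A + 4 : ℕ) : ℂ) * ((Module.finrank ℂ (Herm3 B) + 9 : ℕ) : ℂ)
        * oddForm A B q (act D1 E1 r - act D3 E3 p + oddOdd A B p r)) := by
    intro D1 D2 D3 E1 E2 E3 p q r
    -- The terms mixing even and odd parts cancel by `traceDer_odd`, used once for each pair of odd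
    -- arguments; the purely odd term by cyclicity of `oddOdd`.
    have h1 := traceDer_odd D3 E3 p q
    have h2 := traceDer_odd D2 E2 p r
    have h3 := oddForm_act D1 E1 q r
    have h4 : oddForm A B (oddOdd A B p q) r + oddForm A B q (oddOdd A B p r) = 0 := by
      rw [oddForm_swap q, oddForm_oddOdd p q, oddForm_oddOdd q r, oddOdd_swap r p, map_neg,
        LinearMap.neg_apply, neg_add_cancel]
    have h5 := traceDer_lie D1 D2 D3
    have h6 := traceDer_lie E1 E2 E3
    rw [traceDer_swap] at h5 h6
    simp only [map_add, map_sub, LinearMap.add_apply, LinearMap.sub_apply,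
      traceDer_swap _ D3, traceDer_swap _ E3, oddForm_swap q (act D3 E3 p)]
    linear_combination h1 + h2 + ((Module.finrank ℂ (Herm3 B) + 9 : ℕ) : ℂ) * h5
      + ((Module.finrank ℂ A + 4 : ℕ) : ℂ) * h6
      + ((Module.finrank ℂ A + 4 : ℕ) : ℂ) * ((Module.finrank ℂ (Herm3 B) + 9 : ℕ) : ℂ) * (h3 + h4)
  rw [invForm_apply, invForm_apply]
  exact aux u.1 v.1 w.1 u.2.1 v.2.1 w.2.1 u.2.2 v.2.2 w.2.2

end

section
variable {A B : Type} [NonAssocRing A] [Module ℂ A] [IsScalarTower ℂ A A] [SMulCommClass ℂ A A]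
  [ConjAlgebra A] [PosConjAlgebra A] [IsAlternativeRing A]
  [NonAssocRing B] [Module ℂ B] [IsScalarTower ℂ B B] [SMulCommClass ℂ B B]
  [ConjAlgebra B] [PosConjAlgebra B] [IsAlternativeRing B]

variable (A B) in
/-- The real structure on the odd part. -/
noncomputable def barOdd : (Imag A ⊗[ℂ] Traceless B) →ₗ⋆[ℂ] (Imag A ⊗[ℂ] Traceless B) :=
  TensorProduct.map barImag barTraceless

theorem barOdd_tmul (a : Imag A) (x : Traceless B) :
    barOdd A B (a ⊗ₜ x) = barImag a ⊗ₜ barTraceless x := rfl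

variable (A B) in
/-- The real structure on the Tits algebra. -/
noncomputable def barTits : Tits A B →ₗ⋆[ℂ] Tits A B where
  toFun u := ((barDer u.1, barDer u.2.1, barOdd A B u.2.2) :
    Der A × Der (Herm3 B) × (Imag A ⊗[ℂ] Traceless B))
  map_add' u v := Prod.ext (map_add barDer u.1 v.1)
    (Prod.ext (map_add barDer u.2.1 v.2.1) (map_add (barOdd A B) u.2.2 v.2.2))
  map_smul' c u := Prod.ext (map_smulₛₗ barDer c u.1)
    (Prod.ext (map_smulₛₗ barDer c u.2.1) (map_smulₛₗ (barOdd A B) c u.2.2))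

theorem bar_ext {M : Type} [AddCommGroup M] [Module ℂ M] (τ : M →ₗ⋆[ℂ] M)
    (β : (Imag A ⊗[ℂ] Traceless B) →ₗ[ℂ] (Imag A ⊗[ℂ] Traceless B) →ₗ[ℂ] M)
    (h : ∀ a b x y, τ (β (a ⊗ₜ x) (b ⊗ₜ y)) = β (barOdd A B (a ⊗ₜ x)) (barOdd A B (b ⊗ₜ y)))
    (v w : Imag A ⊗[ℂ] Traceless B) : τ (β v w) = β (barOdd A B v) (barOdd A B w) := by
  induction v with
  | zero => simp
  | add v v' h h' => simp only [map_add, LinearMap.add_apply, h, h']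
  | tmul a x =>
    induction w with
    | zero => simp
    | add w w' h h' => simp only [map_add, h, h']
    | tmul b y => exact h a b x y

theorem formImag_bar (a b : Imag A) :
    formImag A (barImag a) (barImag b) = star (formImag A a b) := by
  rw [formImag_apply, formImag_apply, coe_barImag, coe_barImag, ← bar_mul, re_bar]

theorem formTraceless_bar (x y : Traceless B) :
    formTraceless B (barTraceless x) (barTraceless y) = star (formTraceless B x y) := by
  rw [formTraceless_apply, formTraceless_apply, coe_barTraceless, coe_barTraceless, ← bar_mul,
    tr_bar, star_div₀]
  simp

theorem barDer_innerDer (a b : Imag A) :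
    barDer (innerDerImag A a b) = innerDerImag A (barImag a) (barImag b) :=
  MagicSquare.der_ext fun x => by
    change bar (innerDerFun (a : A) b (bar x)) = innerDerFun (bar (a : A)) (bar (b : A)) x
    simp only [innerDerFun, map_add, map_sub, bar_mul, bar_bar]

theorem barDer_jordanDer (x y : Traceless B) :
    barDer (jordanDerTraceless B x y) = jordanDerTraceless B (barTraceless x) (barTraceless y) :=
  Herm3.der_ext fun z => by
    change bar ((x : Herm3 B) * (y * bar z) - y * (x * bar z)) =
      bar (x : Herm3 B) * (bar (y : Herm3 B) * z) - bar (y : Herm3 B) * (bar (x : Herm3 B) * z)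
    simp only [map_sub, bar_mul, bar_bar]

theorem barDer_oddDer (v w : Imag A ⊗[ℂ] Traceless B) :
    barDer (oddDer A B v w) = oddDer A B (barOdd A B v) (barOdd A B w) :=
  bar_ext barDer (oddDer A B) (fun a b x y => by
    rw [barOdd_tmul, barOdd_tmul, oddDer_tmul, oddDer_tmul, formTraceless_bar, map_smulₛₗ,
      barDer_innerDer]
    rfl) v w

theorem barDer_oddJordanDer (v w : Imag A ⊗[ℂ] Traceless B) :
    barDer (oddJordanDer A B v w) = oddJordanDer A B (barOdd A B v) (barOdd A B w) :=
  bar_ext barDer (oddJordanDer A B) (fun a b x y => by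
    rw [barOdd_tmul, barOdd_tmul, oddJordanDer_tmul, oddJordanDer_tmul, formImag_bar, map_smulₛₗ,
      barDer_jordanDer, map_mul, Complex.conj_ofNat]
    rfl) v w

theorem barOdd_oddOdd (v w : Imag A ⊗[ℂ] Traceless B) :
    barOdd A B (oddOdd A B v w) = oddOdd A B (barOdd A B v) (barOdd A B w) :=
  bar_ext (barOdd A B) (oddOdd A B) (fun a b x y => by
    rw [barOdd_tmul, barOdd_tmul, oddOdd_tmul, oddOdd_tmul, barOdd_tmul]
    congr 1
    · apply Subtype.ext
      rw [coe_barImag, commImag_apply, commImag_apply, map_sub, bar_mul, bar_mul]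
      rfl
    · apply Subtype.ext
      have h := formTraceless_bar x y
      rw [formTraceless_apply, formTraceless_apply] at h
      rw [coe_barTraceless, mulTraceless_apply, mulTraceless_apply, map_sub, bar_mul, map_smulₛₗ,
        h]
      have e1 : bar (1 : Herm3 B) = 1 := by
        have h := bar_mul (bar (1 : Herm3 B)) 1
        rw [mul_one, bar_bar, one_mul] at h
        exact h.symm
      rw [e1]
      rfl) v w

theorem barOdd_act (D : Der A) (E : Der (Herm3 B)) (w : Imag A ⊗[ℂ] Traceless B) :
    barOdd A B (act D E w) = act (barDer D) (barDer E) (barOdd A B w) := by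
  induction w with
  | zero => simp
  | add w w' h h' => simp only [map_add, h, h']
  | tmul a x =>
    rw [act_tmul, map_add, barOdd_tmul, barOdd_tmul, barOdd_tmul, act_tmul]
    congr 2
    · exact Subtype.ext (barDer_bar D (a : A)).symm
    · exact Subtype.ext (barDer_bar E (x : Herm3 B)).symm

theorem barTits_lie (u v : Tits A B) : barTits A B ⁅u, v⁆ = ⁅barTits A B u, barTits A B v⁆ := by
  obtain ⟨D1, E1, p⟩ := u
  obtain ⟨D2, E2, q⟩ := v
  refine Prod.ext ?_ (Prod.ext ?_ ?_)
  · change barDer (⁅D1, D2⁆ + oddDer A B p q) =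
      ⁅barDer D1, barDer D2⁆ + oddDer A B (barOdd A B p) (barOdd A B q)
    rw [map_add, barDer_lie, barDer_oddDer]
  · change barDer (⁅E1, E2⁆ + oddJordanDer A B p q) =
      ⁅barDer E1, barDer E2⁆ + oddJordanDer A B (barOdd A B p) (barOdd A B q)
    rw [map_add, barDer_lie, barDer_oddJordanDer]
  · change barOdd A B (act D1 E1 q - act D2 E2 p + oddOdd A B p q) =
      act (barDer D1) (barDer E1) (barOdd A B q) - act (barDer D2) (barDer E2) (barOdd A B p)
        + oddOdd A B (barOdd A B p) (barOdd A B q)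
    rw [map_add, map_sub, barOdd_act, barOdd_act, barOdd_oddOdd]

variable [FiniteDimensional ℂ A] [FiniteDimensional ℂ B]

variable (A B) in
-- The minus sign comes from `re (ab)`, negative definite on real imaginary elements; the trace form
-- is positive.
theorem isPosHerm_oddForm : IsPosHerm (-((oddForm A B).comp (barOdd A B))) :=
  (isPosHerm_imag A).tensor (isPosHerm_traceless B) fun a b x y => by
    change -oddForm A B (barImag a ⊗ₜ barTraceless x) (b ⊗ₜ y) =
      -formImag A (barImag a) b * formTraceless B (barTraceless x) y
    rw [oddForm_tmul, neg_mul]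

variable (A B) in
theorem isPosHerm_invForm : IsPosHerm (-((invForm A B).comp (barTits A B))) := by
  have H1 := isPosHerm_traceDer_conjAlgebra A
  have H2 := isPosHerm_traceDer_jordan B
  have H3 := isPosHerm_oddForm A B
  have e : ∀ u v : Tits A B, (-((invForm A B).comp (barTits A B))) u v =
      ((Module.finrank ℂ (Herm3 B) + 9 : ℕ) : ℂ) * (-((traceDer A).comp barDer)) u.1 v.1
      + ((Module.finrank ℂ A + 4 : ℕ) : ℂ) * (-((traceDer (Herm3 B)).comp barDer)) u.2.1 v.2.1
      + (((Module.finrank ℂ A + 4) * (Module.finrank ℂ (Herm3 B) + 9) : ℕ) : ℂ)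
        * (-((oddForm A B).comp (barOdd A B))) u.2.2 v.2.2 := by
    intro u v
    change -invForm A B (barTits A B u) v = _
    rw [invForm_apply, Nat.cast_mul]
    simp only [LinearMap.neg_apply, LinearMap.comp_apply]
    change -(_ * traceDer A (barDer u.1) v.1 + _ * traceDer (Herm3 B) (barDer u.2.1) v.2.1
      + _ * oddForm A B (barOdd A B u.2.2) v.2.2) = _
    ring
  have starNat : ∀ n : ℕ, star (n : ℂ) = n := fun n => Complex.conj_natCast n
  refine ⟨fun u v => ?_, fun u hu => ?_⟩
  · rw [e, e, star_add, star_add, star_mul', star_mul', star_mul', H1.symm, H2.symm, H3.symm,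
      starNat, starNat, starNat]
  · rw [e, Complex.add_re, Complex.add_re]
    have re_nat : ∀ (n : ℕ) (z : ℂ), ((n : ℂ) * z).re = n * z.re := fun n z => by simp
    rw [re_nat, re_nat, re_nat]
    have p1 : (0 : ℝ) < (Module.finrank ℂ (Herm3 B) + 9 : ℕ) := by positivity
    have p2 : (0 : ℝ) < (Module.finrank ℂ A + 4 : ℕ) := by positivity
    have p3 : (0 : ℝ) < ((Module.finrank ℂ A + 4) * (Module.finrank ℂ (Herm3 B) + 9) : ℕ) := by
      positivity
    have n1 := mul_nonneg p1.le (H1.nonneg u.1)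
    have n2 := mul_nonneg p2.le (H2.nonneg u.2.1)
    have n3 := mul_nonneg p3.le (H3.nonneg u.2.2)
    by_cases h1 : u.1 = 0
    · by_cases h2 : u.2.1 = 0
      · have h3 : u.2.2 ≠ 0 := fun h3 => hu (Prod.ext h1 (Prod.ext h2 h3))
        have := mul_pos p3 (H3.pos _ h3)
        linarith
      · have := mul_pos p2 (H2.pos _ h2)
        linarith
    · have := mul_pos p1 (H1.pos _ h1)
      linarith

/-- Contracting the first factor with any `a` is equivariant, and its values are traceless elements
killed by all inner derivations, hence zero. So `w` is orthogonal to everything. -/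
theorem eq_zero_of_act {w : Imag A ⊗[ℂ] Traceless B}
    (h : ∀ E : Der (Herm3 B), act (0 : Der A) E w = 0) : w = 0 := by
  let c : Imag A → (Imag A ⊗[ℂ] Traceless B →ₗ[ℂ] Traceless B) := fun a =>
    (TensorProduct.lid ℂ (Traceless B)).toLinearMap ∘ₗ (formImag A a).rTensor (Traceless B)
  have c_tmul : ∀ a b y, c a (b ⊗ₜ y) = formImag A a b • y := fun a b y => rfl
  have c_act : ∀ a (E : Der (Herm3 B)) w, c a (act (0 : Der A) E w) = derTraceless E (c a w) := by
    intro a E w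
    induction w with
    | zero => simp
    | add w w' h h' => simp only [map_add, h, h']
    | tmul b y => rw [act_tmul, map_zero, LinearMap.zero_apply, TensorProduct.zero_tmul, zero_add,
        c_tmul, c_tmul, map_smul]
  have c_zero : ∀ a, c a w = 0 := by
    intro a
    apply Subtype.ext
    refine eq_zero_of_jordanDer (c a w).2 fun x y => ?_
    have := c_act a (jordanDer x y) w
    rw [h, map_zero] at this
    exact (congrArg Subtype.val this).symm
  have key : ∀ v w : Imag A ⊗[ℂ] Traceless B, (∀ a, c a w = 0) → oddForm A B v w = 0 := by
    intro v w hw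
    induction v with
    | zero => simp
    | add v v' h h' => rw [map_add, LinearMap.add_apply, h, h', add_zero]
    | tmul a x =>
      have e : ∀ w, oddForm A B (a ⊗ₜ x) w = formTraceless B x (c a w) := by
        intro w
        induction w with
        | zero => simp
        | add w w' h h' => rw [map_add, map_add, map_add, h, h']
        | tmul b y => rw [oddForm_tmul, c_tmul, map_smul, smul_eq_mul]
      rw [e, hw, map_zero]
  apply (isPosHerm_oddForm A B).eq_zero
  rw [LinearMap.neg_apply, LinearMap.neg_apply, LinearMap.comp_apply, key _ _ c_zero, neg_zero]

theorem eq_zero_of_derImag (B : Type) [NonAssocRing B] [Module ℂ B] [IsScalarTower ℂ B B]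
    [SMulCommClass ℂ B B] [ConjAlgebra B] [PosConjAlgebra B] [IsAlternativeRing B] {D : Der A}
    (h : ∀ b : Imag A, ∀ y : Traceless B, derImag D b ⊗ₜ[ℂ] y = 0) : D = 0 := by
  have hy : (idem 0 - idem 1 : Herm3 B) ∈ Traceless B := by
    rw [mem_traceless, map_sub, tr_apply, tr_apply, Fin.sum_univ_three, Fin.sum_univ_three]
    simp [idem, re_one]
  have hy0 : (⟨_, hy⟩ : Traceless B) ≠ 0 := by
    intro h0
    have h1 := congrArg (fun y : Traceless B => re ((y : Herm3 B).1 0 0)) h0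
    change re ((idem 0).1 0 0 - (idem 1 : Herm3 B).1 0 0) = re (0 : B) at h1
    simp [idem, re_one] at h1
  have hb : ∀ b : Imag A, derImag D b = 0 := by
    intro b
    by_contra hne
    have p1 := (isPosHerm_imag A).pos _ hne
    have p2 := (isPosHerm_traceless B).pos _ hy0
    have e : formImag A (barImag (derImag D b)) (derImag D b) *
        formTraceless B (barTraceless ⟨_, hy⟩) ⟨_, hy⟩ = 0 := by
      rw [← oddForm_tmul, h, map_zero]
    rcases mul_eq_zero.1 e with e | e
    · rw [LinearMap.neg_apply, LinearMap.neg_apply, LinearMap.comp_apply, e] at p1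
      simp at p1
    · rw [LinearMap.comp_apply, e] at p2
      simp at p2
  refine MagicSquare.der_ext fun x => ?_
  change D.1 x = 0
  have h := congrArg Subtype.val (hb ⟨x - re x • 1, by rw [mem_imag]; simp [re_one]⟩)
  change D.1 (x - re x • 1) = 0 at h
  rwa [map_sub, map_smul, MagicSquare.der_one, smul_zero, sub_zero] at h

/-- Brackets with `Der J₃(B)` remove the second and third components; brackets with odd elements
then remove the first. -/
theorem center_eq_zero (z : Tits A B) (hz : ∀ y : Tits A B, ⁅z, y⁆ = 0) : z = 0 := by
  have hE : z.2.1 = 0 := der_center_eq_zero fun E => by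
    have h := hz (ofDer A B E)
    rw [lie_ofDer] at h
    exact congrArg (toJordanDer A B) h
  have hw : z.2.2 = 0 := eq_zero_of_act fun E => by
    have h := hz (ofDer A B E)
    rw [lie_ofDer] at h
    exact neg_eq_zero.1 (congrArg (toOdd A B) h)
  have hD : z.1 = 0 := eq_zero_of_derImag B fun b y => by
    have h : act z.1 z.2.1 (b ⊗ₜ y) - act (0 : Der A) (0 : Der (Herm3 B)) z.2.2
        + oddOdd A B z.2.2 (b ⊗ₜ y) = 0 := congrArg (toOdd A B) (hz (mk 0 0 (b ⊗ₜ y)))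
    rwa [hE, hw, map_zero, map_zero, LinearMap.zero_apply, sub_zero, add_zero, act_tmul, map_zero,
      LinearMap.zero_apply, TensorProduct.tmul_zero, add_zero] at h
  exact Prod.ext hD (Prod.ext hE hw)

variable (A B) in
theorem isKilling : LieAlgebra.IsKilling ℂ (Tits A B) :=
  isKilling_of_isPosHerm (invForm A B) (barTits A B) barTits_lie invForm_lie
    (isPosHerm_invForm A B) center_eq_zero

end
end Tits

theorem Herm3.isKilling_der (A : Type) [NonAssocRing A] [Module ℂ A] [IsScalarTower ℂ A A]
    [SMulCommClass ℂ A A] [ConjAlgebra A] [PosConjAlgebra A] [IsAlternativeRing A]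
    [FiniteDimensional ℂ A] : LieAlgebra.IsKilling ℂ (Der (Herm3 A)) :=
  isKilling_of_isPosHerm (traceDer (Herm3 A)) barDer barDer_lie traceDer_lie
    (isPosHerm_traceDer_jordan A) fun _ h => der_center_eq_zero h

end

/-! ### Dimension counts in the decomposition over `Der J₃(B)` -/

section
open ConjAlgebra CayleyDickson BarAlgebra PosConjAlgebra

/-- By flatness the kernel of `1 ⊗ f` is `V ⊗ ker f`. -/
theorem finrank_ker_lTensor {V W : Type*} [AddCommGroup V] [Module ℂ V] [FiniteDimensional ℂ V]
    [AddCommGroup W] [Module ℂ W] [FiniteDimensional ℂ W] (f : Module.End ℂ W) :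
    Module.finrank ℂ (LinearMap.ker (f.lTensor V)) =
      Module.finrank ℂ V * Module.finrank ℂ (LinearMap.ker f) := by
  have h : LinearMap.ker (f.lTensor V) =
      LinearMap.range ((LinearMap.ker f).subtype.lTensor V) :=
    LinearMap.exact_iff.1 (Module.Flat.lTensor_exact V f.exact_subtype_ker_map)
  rw [h, LinearMap.finrank_range_of_inj
    (Module.Flat.lTensor_preserves_injective_linearMap _ (Submodule.subtype_injective _)),
    Module.finrank_tensorProduct]

theorem finrank_submodule_prod {U V W : Type*} [AddCommGroup U] [Module ℂ U]
    [FiniteDimensional ℂ U] [AddCommGroup V] [Module ℂ V] [FiniteDimensional ℂ V]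
    [AddCommGroup W] [Module ℂ W] [FiniteDimensional ℂ W] (P : Submodule ℂ U)
    (Q : Submodule ℂ V) (R : Submodule ℂ W) : Module.finrank ℂ (P × Q × R) =
      Module.finrank ℂ P + (Module.finrank ℂ Q + Module.finrank ℂ R) := by
  rw [Module.finrank_prod, Module.finrank_prod]

theorem finrank_imag (A : Type) [NonAssocRing A] [Module ℂ A] [ConjAlgebra A]
    [FiniteDimensional ℂ A] :
    (Module.finrank ℂ (Imag A) : ℤ) = Module.finrank ℂ A - 1 := by
  have h := LinearMap.finrank_range_add_finrank_ker (re : A →ₗ[ℂ] ℂ)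
  have hs : LinearMap.range (re : A →ₗ[ℂ] ℂ) = ⊤ := LinearMap.range_eq_top.2 fun c =>
    ⟨c • 1, by rw [map_smul, re_one, smul_eq_mul, mul_one]⟩
  rw [hs, finrank_top, Module.finrank_self] at h
  change ((Module.finrank ℂ (LinearMap.ker (re : A →ₗ[ℂ] ℂ)) : ℕ) : ℤ) = _
  omega

theorem finrank_cayleyDickson (A : Type) [NonAssocRing A] [Module ℂ A] [FiniteDimensional ℂ A] :
    Module.finrank ℂ (CayleyDickson A) = 2 * Module.finrank ℂ A :=
  (Module.finrank_prod (R := ℂ) (M := A) (M' := A)).trans (two_mul _).symm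

theorem IsTriple.isEndTriple {L V : Type} [LieRing L] [LieAlgebra ℂ L] [AddCommGroup V]
    [Module ℂ V] {ρ : L →ₗ[ℂ] Module.End ℂ V} (hρ : ∀ x y, ρ ⁅x, y⁆ = ρ x * ρ y - ρ y * ρ x)
    {X Y H : L} (t : IsTriple X Y H) : IsEndTriple (ρ X) (ρ Y) (ρ H) where
  lie_h_x := by rw [← hρ, t.lie_H_X, map_smul]
  lie_h_y := by rw [← hρ, t.lie_H_Y, map_neg, map_smul]
  lie_x_y := by rw [← hρ, t.lie_X_Y]

theorem IsTriple.isEndTriple_ad {L : Type} [LieRing L] [LieAlgebra ℂ L] {X Y H : L}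
    (t : IsTriple X Y H) :
    IsEndTriple (LieAlgebra.ad ℂ L X) (LieAlgebra.ad ℂ L Y) (LieAlgebra.ad ℂ L H) where
  lie_h_x := by rw [← ad_lie, t.lie_H_X, map_smul]
  lie_h_y := by rw [← ad_lie, t.lie_H_Y, map_neg, map_smul]
  lie_x_y := by rw [← ad_lie, t.lie_X_Y]

namespace Tits
open Herm3

variable {A B : Type} [NonAssocRing A] [Module ℂ A] [IsScalarTower ℂ A A] [SMulCommClass ℂ A A]
  [ConjAlgebra A] [IsAlternativeRing A]
  [NonAssocRing B] [Module ℂ B] [IsScalarTower ℂ B B] [SMulCommClass ℂ B B]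
  [ConjAlgebra B] [IsAlternativeRing B]

/-- A submodule of the Tits algebra defined componentwise is a product. -/
def submoduleEquivProd (S : Submodule ℂ (Tits A B)) (P : Submodule ℂ (Der A))
    (Q : Submodule ℂ (Der (Herm3 B))) (R : Submodule ℂ (Imag A ⊗[ℂ] Traceless B))
    (h : ∀ u : Tits A B, u ∈ S ↔ u.1 ∈ P ∧ u.2.1 ∈ Q ∧ u.2.2 ∈ R) : S ≃ₗ[ℂ] P × Q × R where
  toFun u := (⟨u.1.1, ((h _).1 u.2).1⟩, ⟨u.1.2.1, ((h _).1 u.2).2.1⟩, ⟨u.1.2.2, ((h _).1 u.2).2.2⟩)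
  invFun p := ⟨((p.1.1, p.2.1.1, p.2.2.1) : Der A × Der (Herm3 B) × (Imag A ⊗[ℂ] Traceless B)),
    (h _).2 ⟨p.1.2, p.2.1.2, p.2.2.2⟩⟩
  map_add' _ _ := rfl
  map_smul' _ _ := rfl
  left_inv _ := rfl
  right_inv _ := rfl

theorem finrank_eq_of_mem_iff [FiniteDimensional ℂ A] [FiniteDimensional ℂ B]
    (S : Submodule ℂ (Tits A B)) (P : Submodule ℂ (Der A))
    (Q : Submodule ℂ (Der (Herm3 B))) (R : Submodule ℂ (Imag A ⊗[ℂ] Traceless B))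
    (h : ∀ u : Tits A B, u ∈ S ↔ u.1 ∈ P ∧ u.2.1 ∈ Q ∧ u.2.2 ∈ R) :
    (Module.finrank ℂ S : ℤ) =
      Module.finrank ℂ P + Module.finrank ℂ Q + Module.finrank ℂ R := by
  rw [(submoduleEquivProd S P Q R h).finrank_eq, finrank_submodule_prod]
  push_cast
  ring

theorem act_zero_left (E : Der (Herm3 B)) :
    act (0 : Der A) E = (derTraceless E).lTensor (Imag A) := by
  change (derImag (0 : Der A)).rTensor _ + _ = _
  rw [map_zero, LinearMap.rTensor_zero, zero_add]

theorem ad_ofDer (E : Der (Herm3 B)) (u : Tits A B) :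
    LieAlgebra.ad ℂ (Tits A B) (ofDer A B E) u =
      mk 0 (LieAlgebra.ad ℂ (Der (Herm3 B)) E u.2.1)
        ((derTraceless E).lTensor (Imag A) u.2.2) := by
  rw [LieAlgebra.ad_apply, ← lie_skew, lie_ofDer, LieAlgebra.ad_apply, ← lie_skew E,
    ← act_zero_left]
  exact Prod.ext neg_zero (Prod.ext rfl (neg_neg _))

/-- The exponent must be positive: only then is the component in `Der A` killed. -/
theorem ad_ofDer_pow (E : Der (Herm3 B)) (k : ℕ) (u : Tits A B) :
    (LieAlgebra.ad ℂ (Tits A B) (ofDer A B E) ^ (k + 1)) u =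
      mk 0 ((LieAlgebra.ad ℂ (Der (Herm3 B)) E ^ (k + 1)) u.2.1)
        (((derTraceless E) ^ (k + 1)).lTensor (Imag A) u.2.2) := by
  induction k with
  | zero => rw [zero_add, pow_one, pow_one, pow_one, ad_ofDer]
  | succ k ih =>
    rw [pow_succ', Module.End.mul_apply, ih, ad_ofDer, pow_succ' _ (k + 1), Module.End.mul_apply,
      pow_succ' (derTraceless E) (k + 1), LinearMap.lTensor_mul, Module.End.mul_apply]
    rfl

variable [FiniteDimensional ℂ A] [FiniteDimensional ℂ B]

variable (A) in
theorem finrank_ker_ad_ofDer_pow (E : Der (Herm3 B)) (k : ℕ) :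
    (Module.finrank ℂ (LinearMap.ker (LieAlgebra.ad ℂ (Tits A B) (ofDer A B E) ^ (k + 1))) : ℤ) =
      Module.finrank ℂ (Der A)
        + Module.finrank ℂ (LinearMap.ker (LieAlgebra.ad ℂ (Der (Herm3 B)) E ^ (k + 1)))
        + (Module.finrank ℂ A - 1)
          * Module.finrank ℂ (LinearMap.ker (derTraceless E ^ (k + 1))) := by
  rw [finrank_eq_of_mem_iff _ ⊤ (LinearMap.ker (LieAlgebra.ad ℂ (Der (Herm3 B)) E ^ (k + 1)))
    (LinearMap.ker ((derTraceless E ^ (k + 1)).lTensor (Imag A))) fun u => ?_,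
    finrank_top, finrank_ker_lTensor, Nat.cast_mul, finrank_imag]
  rw [LinearMap.mem_ker, ad_ofDer_pow]
  exact ⟨fun h => ⟨trivial, congrArg (toJordanDer A B) h, congrArg (toOdd A B) h⟩,
      fun h => Prod.ext rfl (Prod.ext h.2.1 h.2.2)⟩

-- `Der A` lies in the eigenspace 0, so `i ≠ 0` removes the one summand whose dimension is not
-- controlled by `dim A`.
variable (A) in
theorem finrank_gradedPiece_ofDer (E : Der (Herm3 B)) {i : ℤ} (hi : i ≠ 0) :
    (Module.finrank ℂ (gradedPiece (ofDer A B E) i) : ℤ) =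
      Module.finrank ℂ
        (Module.End.eigenspace (LieAlgebra.ad ℂ (Der (Herm3 B)) E : Module.End ℂ _) (i : ℂ))
      + (Module.finrank ℂ A - 1)
        * Module.finrank ℂ (Module.End.eigenspace (derTraceless E) (i : ℂ)) := by
  have e : (derTraceless E - (i : ℂ) • 1).lTensor (Imag A) =
      (derTraceless E).lTensor (Imag A) - (i : ℂ) • LinearMap.id := by
    rw [LinearMap.lTensor_sub, LinearMap.lTensor_smul]
    congr 2
    exact LinearMap.lTensor_id _ _
  have he : Module.End.eigenspace (derTraceless E) (i : ℂ) =
      LinearMap.ker (derTraceless E - (i : ℂ) • 1) := Module.End.eigenspace_def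
  rw [finrank_eq_of_mem_iff _ ⊥
    (Module.End.eigenspace (LieAlgebra.ad ℂ (Der (Herm3 B)) E : Module.End ℂ _) (i : ℂ))
    (LinearMap.ker ((derTraceless E - (i : ℂ) • 1).lTensor (Imag A))) fun u => ?_,
    finrank_bot, finrank_ker_lTensor, Nat.cast_mul, finrank_imag, Nat.cast_zero, zero_add, he]
  have hu : u ∈ gradedPiece (ofDer A B E) i ↔
      LieAlgebra.ad ℂ (Tits A B) (ofDer A B E) u = (i : ℂ) • u := Module.End.mem_eigenspace_iff
  rw [hu, ad_ofDer, Module.End.mem_eigenspace_iff, e, LinearMap.mem_ker, LinearMap.sub_apply,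
    sub_eq_zero, Submodule.mem_bot]
  refine ⟨fun h => ⟨?_, congrArg (toJordanDer A B) h, congrArg (toOdd A B) h⟩,
    fun h => Prod.ext ?_ (Prod.ext h.2.1 h.2.2)⟩
  · have h0 : (0 : Der A) = (i : ℂ) • u.1 := congrArg (toDer A B) h
    exact (smul_eq_zero.1 h0.symm).resolve_left (Int.cast_ne_zero.2 hi)
  · change (0 : Der A) = (i : ℂ) • u.1
    rw [h.1, smul_zero]

/-- Nilpotency in `Der J₃(B)` yields `E = [E, F]` there. This relation survives the embedding, and
Jacobson's lemma gives nilpotency in the larger algebra. -/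
theorem isNilpotent_ad_ofDer [PosConjAlgebra B] {E : Der (Herm3 B)}
    (h : IsNilpotent (LieAlgebra.ad ℂ (Der (Herm3 B)) E)) :
    IsNilpotent (LieAlgebra.ad ℂ (Tits A B) (ofDer A B E)) := by
  have := Herm3.isKilling_der B
  obtain ⟨F, hF⟩ := mem_range_ad_self h
  have e : ⁅ofDer A B E, ofDer A B F⁆ = ofDer A B E := by rw [← LieHom.map_lie, hF]
  refine isNilpotent_commutator (LieAlgebra.ad ℂ _ (ofDer A B E))
    (LieAlgebra.ad ℂ _ (ofDer A B F)) _ ?_ rfl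
  rw [← ad_lie, e]

/-- Kernel dimensions pass from `Z` to `E` along the orbit in the Tits algebra, split over its
summands, and pass from `E` to `X` along the orbit in `Der J₃(B)`. The coefficients involve `X`
only, so they are common to all `A`. -/
theorem finrank_nilpotentRadical_eq [PosConjAlgebra A] [PosConjAlgebra B] {a : ℤ}
    (ha : (Module.finrank ℂ A : ℤ) = a) {X E : Der (Herm3 B)}
    {Z : Tits A B} (hX : IsNilpotent (LieAlgebra.ad ℂ (Der (Herm3 B)) X))
    (hE : E ∈ adjointOrbit X) (hZ : Z ∈ adjointOrbit (ofDer A B E)) :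
    (Module.finrank ℂ (nilpotentRadical (stabilizer (Tits A B) Z)) : ℤ) =
      (Module.finrank ℂ (LinearMap.ker (derTraceless X ^ 2))
        - Module.finrank ℂ (LinearMap.ker (derTraceless X ^ 1))) * a
      + (Module.finrank ℂ (LinearMap.ker (LieAlgebra.ad ℂ (Der (Herm3 B)) X ^ 2))
        - Module.finrank ℂ (LinearMap.ker (LieAlgebra.ad ℂ (Der (Herm3 B)) X ^ 1))
        - (Module.finrank ℂ (LinearMap.ker (derTraceless X ^ 2))
          - Module.finrank ℂ (LinearMap.ker (derTraceless X ^ 1)))) := by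
  subst ha
  have := Tits.isKilling A B
  have hEn := isNilpotent_ad_ofDer (A := A) (isNilpotent_ad_of_mem_adjointOrbit hE hX)
  have h := finrank_nilpotentRadical (isNilpotent_ad_of_mem_adjointOrbit hZ hEn)
  rw [← pow_one (LieAlgebra.ad ℂ (Tits A B) Z), ← pow_mul, one_mul,
    finrank_ker_ad_pow_of_mem_adjointOrbit hZ, finrank_ker_ad_pow_of_mem_adjointOrbit hZ] at h
  have h1 := finrank_ker_ad_ofDer_pow A E 0
  have h2 := finrank_ker_ad_ofDer_pow A E 1
  have hρ : ∀ x y : Der (Herm3 B), derTraceless ⁅x, y⁆ =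
    derTraceless x * derTraceless y - derTraceless y * derTraceless x := fun _ _ => rfl
  rw [zero_add, finrank_ker_ad_pow_of_mem_adjointOrbit hE,
    finrank_ker_pow_of_mem_adjointOrbit hρ hE] at h1
  rw [one_add_one_eq_two, finrank_ker_ad_pow_of_mem_adjointOrbit hE,
    finrank_ker_pow_of_mem_adjointOrbit hρ hE] at h2
  zify at h
  -- The dimension of `Der A` occurs in both `h1` and `h2` and cancels.
  linear_combination -h + h2 - h1

/-- The reference triple `t₀` supplies the coefficients. Any other triple over the same orbit has
equal kernel dimensions, hence equal weight multiplicities, on both `Der J₃(B)` and the traceless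
part. -/
theorem finrank_gradedPiece_eq {a : ℤ} (ha : (Module.finrank ℂ A : ℤ) = a) {X₀ X Y₀ H₀ Y H X' : Der (Herm3 B)} (t₀ : IsTriple X₀ Y₀ H₀)
    (t : IsTriple X Y H) (hX₀ : X₀ ∈ adjointOrbit X') (hX : X ∈ adjointOrbit X') {i : ℤ}
    (hi : i ≠ 0) :
    (Module.finrank ℂ (gradedPiece (ofDer A B H) i) : ℤ) =
      Module.finrank ℂ (Module.End.eigenspace (derTraceless H₀) (i : ℂ)) * a
      + (Module.finrank ℂ
        (Module.End.eigenspace (LieAlgebra.ad ℂ (Der (Herm3 B)) H₀ : Module.End ℂ _) (i : ℂ))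
        - Module.finrank ℂ (Module.End.eigenspace (derTraceless H₀) (i : ℂ))) := by
  subst ha
  have hρ : ∀ x y : Der (Herm3 B), derTraceless ⁅x, y⁆ =
    derTraceless x * derTraceless y - derTraceless y * derTraceless x := fun _ _ => rfl
  have e1 := t.isEndTriple_ad.finrank_eigenspace_int_eq t₀.isEndTriple_ad (fun k =>
      (finrank_ker_ad_pow_of_mem_adjointOrbit hX k).trans
        (finrank_ker_ad_pow_of_mem_adjointOrbit hX₀ k).symm) i
  have e2 := (t.isEndTriple hρ).finrank_eigenspace_int_eq (t₀.isEndTriple hρ) (fun k =>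
      (finrank_ker_pow_of_mem_adjointOrbit hρ hX k).trans
        (finrank_ker_pow_of_mem_adjointOrbit hρ hX₀ k).symm) i
  rw [finrank_gradedPiece_ofDer A H hi, e1, e2]
  ring

end Tits

theorem finrank_nilpotentRadical_of_mem_seriesOrbit {A : Type} [NonAssocRing A] [Module ℂ A]
    [IsScalarTower ℂ A A] [SMulCommClass ℂ A A] [ConjAlgebra A] [IsAlternativeRing A]
    [FiniteDimensional ℂ A] [PosConjAlgebra A] {a : ℤ} (ha : (Module.finrank ℂ A : ℤ) = a)
    {X : F4} (hX : IsNilpotent (LieAlgebra.ad ℂ F4 X)) (Z : Exc A)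
    (hZ : Z ∈ seriesOrbit A (adjointOrbit X)) :
    (Module.finrank ℂ (nilpotentRadical (stabilizer (Exc A) Z)) : ℤ) =
      (Module.finrank ℂ (LinearMap.ker (Herm3.derTraceless X ^ 2))
        - Module.finrank ℂ (LinearMap.ker (Herm3.derTraceless X ^ 1))) * a
      + (Module.finrank ℂ (LinearMap.ker (LieAlgebra.ad ℂ F4 X ^ 2))
        - Module.finrank ℂ (LinearMap.ker (LieAlgebra.ad ℂ F4 X ^ 1))
        - (Module.finrank ℂ (LinearMap.ker (Herm3.derTraceless X ^ 2))
          - Module.finrank ℂ (LinearMap.ker (Herm3.derTraceless X ^ 1)))) := by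
  obtain ⟨E, hE, hZ⟩ := hZ
  exact Tits.finrank_nilpotentRadical_eq ha hX hE hZ

theorem finrank_algR : (Module.finrank ℂ AlgR : ℤ) = 1 := by
  rw [Module.finrank_self ℂ, Nat.cast_one]

theorem finrank_algC : (Module.finrank ℂ AlgC : ℤ) = 2 := by
  rw [finrank_cayleyDickson, Nat.cast_mul, finrank_algR]
  norm_num

theorem finrank_algH : (Module.finrank ℂ AlgH : ℤ) = 4 := by
  rw [finrank_cayleyDickson, Nat.cast_mul, finrank_algC]
  norm_num

theorem finrank_algO : (Module.finrank ℂ AlgO : ℤ) = 8 := by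
  rw [finrank_cayleyDickson, Nat.cast_mul, finrank_algH]
  norm_num

set_option maxHeartbeats 1000000 in
theorem exists_finrank_nilpotentRadical_eq {X₀ : F4}
    (hX₀ : IsNilpotent (LieAlgebra.ad ℂ F4 X₀)) :
    ∃ m b : ℤ,
      (∀ Z ∈ seriesOrbit AlgR (adjointOrbit X₀),
        (Module.finrank ℂ (nilpotentRadical (stabilizer (Exc AlgR) Z)) : ℤ) = m * 1 + b) ∧
      (∀ Z ∈ seriesOrbit AlgC (adjointOrbit X₀),
        (Module.finrank ℂ (nilpotentRadical (stabilizer (Exc AlgC) Z)) : ℤ) = m * 2 + b) ∧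
      (∀ Z ∈ seriesOrbit AlgH (adjointOrbit X₀),
        (Module.finrank ℂ (nilpotentRadical (stabilizer (Exc AlgH) Z)) : ℤ) = m * 4 + b) ∧
      (∀ Z ∈ seriesOrbit AlgO (adjointOrbit X₀),
        (Module.finrank ℂ (nilpotentRadical (stabilizer (Exc AlgO) Z)) : ℤ) = m * 8 + b) :=
  -- `m` is `dim ker X² - dim ker X` on `J₃(𝕆)₀`, and `b` is the same difference for `ad X` on `f₄`,
  -- minus `m`.
  ⟨_, _, finrank_nilpotentRadical_of_mem_seriesOrbit finrank_algR hX₀,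
    finrank_nilpotentRadical_of_mem_seriesOrbit finrank_algC hX₀,
    finrank_nilpotentRadical_of_mem_seriesOrbit finrank_algH hX₀,
    finrank_nilpotentRadical_of_mem_seriesOrbit finrank_algO hX₀⟩

set_option maxHeartbeats 1000000 in
theorem exists_finrank_gradedPiece_eq (X₀ : F4) {i : ℤ} (hi : i ≠ 0) :
    ∃ m b : ℤ, ∀ X ∈ adjointOrbit X₀, ∀ Y H : F4, IsTriple X Y H →
      (Module.finrank ℂ (gradedPiece (inclF4 AlgR H) i) : ℤ) = m * 1 + b ∧
      (Module.finrank ℂ (gradedPiece (inclF4 AlgC H) i) : ℤ) = m * 2 + b ∧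
      (Module.finrank ℂ (gradedPiece (inclF4 AlgH H) i) : ℤ) = m * 4 + b ∧
      (Module.finrank ℂ (gradedPiece (inclF4 AlgO H) i) : ℤ) = m * 8 + b := by
  -- Without a triple over the orbit the claim is vacuous, so the existence of triples need not be
  -- established.
  by_cases h : ∃ X₁ ∈ adjointOrbit X₀, ∃ Y₁ H₁ : F4, IsTriple X₁ Y₁ H₁
  · obtain ⟨X₁, hX₁, Y₁, H₁, t₁⟩ := h
    exact ⟨_, _, fun X hX Y H t =>
      ⟨Tits.finrank_gradedPiece_eq finrank_algR t₁ t hX₁ hX hi,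
        Tits.finrank_gradedPiece_eq finrank_algC t₁ t hX₁ hX hi,
        Tits.finrank_gradedPiece_eq finrank_algH t₁ t hX₁ hX hi,
        Tits.finrank_gradedPiece_eq finrank_algO t₁ t hX₁ hX hi⟩⟩
  · exact ⟨0, 0, fun X hX Y H t => absurd ⟨X, hX, Y, H, t⟩ h⟩

end

end MagicSquare

theorem proposition2p2 (O₁ : Set F4) (hO : IsNilpotentOrbit O₁) :
    (∃ m b : ℤ,
      (∀ Z ∈ seriesOrbit AlgR O₁,
        (Module.finrank ℂ (nilpotentRadical (stabilizer (Exc AlgR) Z)) : ℤ) = m * 1 + b) ∧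
      (∀ Z ∈ seriesOrbit AlgC O₁,
        (Module.finrank ℂ (nilpotentRadical (stabilizer (Exc AlgC) Z)) : ℤ) = m * 2 + b) ∧
      (∀ Z ∈ seriesOrbit AlgH O₁,
        (Module.finrank ℂ (nilpotentRadical (stabilizer (Exc AlgH) Z)) : ℤ) = m * 4 + b) ∧
      (∀ Z ∈ seriesOrbit AlgO O₁,
        (Module.finrank ℂ (nilpotentRadical (stabilizer (Exc AlgO) Z)) : ℤ) = m * 8 + b)) ∧
    (∀ i : ℤ, i ≠ 0 → ∃ m b : ℤ, ∀ X ∈ O₁, ∀ Y H : F4, IsTriple X Y H →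
      (Module.finrank ℂ (gradedPiece (inclF4 AlgR H) i) : ℤ) = m * 1 + b ∧
      (Module.finrank ℂ (gradedPiece (inclF4 AlgC H) i) : ℤ) = m * 2 + b ∧
      (Module.finrank ℂ (gradedPiece (inclF4 AlgH H) i) : ℤ) = m * 4 + b ∧
      (Module.finrank ℂ (gradedPiece (inclF4 AlgO H) i) : ℤ) = m * 8 + b) := by
  obtain ⟨X₀, hX₀, rfl⟩ := hO
  exact ⟨exists_finrank_nilpotentRadical_eq hX₀, fun _ hi => exists_finrank_gradedPiece_eq X₀ hi⟩
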